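/- Theorem (parameters of $C_L(Y,\mathcal F_4)$). Let $\mathbf F_q$ be a finite field with $q\ge 3$ elements, and let $\varphi$ be the $q$-power Frobenius map. Let $P$ be a rational point of the projective plane $\mathbf P^2$ over $\mathbf F_q$, let $l$ and $l^{\varphi}$ be two distinct conjugate lines, defined over $\mathbf F_{q^2}$, that meet at $P$, and let $R$ be a closed point of degree $4$ of $\mathbf P^2$ lying on the conic $l\cup l^{\varphi}$. Let $\pi:Y\to\mathbf P^2$ be the blow-up of $\mathbf P^2$ at $P$ and $R$, with exceptional divisors $E$ over $P$ and $F$ over $R$, and let $\mathcal F_4=\pi^{*}\mathcal O_{\mathbf P^2}(4)\otimes\mathcal O_Y(-2E-F)$, the line bundle on $Y$ associated to the linear system $\pi^{*}\Lambda_4-2E-F$, where $\Lambda_4$ is the system of plane quartics that contain $R$ and have multiplicity at least $2$ at $P$. Let $C_L(Y,\mathcal F_4)$ be the code obtained by evaluating the global sections of $\mathcal F_4$ at all rational points of $Y$, i.e. the image of $H^0(Y,\mathcal F_4)\to\bigoplus_{y\in Y(\mathbf F_q)}(\mathcal F_4)_y$, $f\mapsto (f_y)_y$, where each fibre $(\mathcal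 F_4)_y$ is a one-dimensional $\mathbf F_q$-vector space identified with $\mathbf F_q$ by the choice of a basis. Then, for every choice of these bases, $C_L(Y,\mathcal F_4)$ has length $(q+1)^2$, dimension $8$ and minimum distance exactly $q^2-q-2$; that is, it is a $[(q+1)^2,\,8,\,q^2-q-2]$ code. -/

import Mathlib

open scoped LinearAlgebra.Projectivization

noncomputable section

namespace RationalSurfaceCode

/-! ### Closed points of the projective plane over a finite field -/

section ClosedPoints

variable (K Ω : Type*) [Field K] [Finite K] [Field Ω] [Algebra K Ω]

/-- The `q`-power map on coordinates, `q = #K`, as a map semilinear over the Frobenius of `Ω / K`. -/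
def frobVec : (Fin 3 → Ω) →ₛₗ[(letI := Fintype.ofFinite K
    FiniteField.frobeniusAlgHom K Ω).toRingHom] (Fin 3 → Ω) where
  toFun v i := letI := Fintype.ofFinite K; FiniteField.frobeniusAlgHom K Ω (v i)
  map_add' v w := by
    funext i
    simp only [Pi.add_apply, map_add]
  map_smul' c v := by
    funext i
    simp only [Pi.smul_apply, smul_eq_mul, map_mul]
    rfl

/-- The Frobenius map `φ : (x₀ : x₁ : x₂) ↦ (x₀^q : x₁^q : x₂^q)`. It acts on geometric points of
the plane and, through the coefficients of an equation, on lines (points of the dual plane). -/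
def frob : ℙ Ω (Fin 3 → Ω) → ℙ Ω (Fin 3 → Ω) :=
  Projectivization.map (frobVec K Ω) (by
    intro v w h
    funext i
    exact (letI := Fintype.ofFinite K; FiniteField.frobeniusAlgHom K Ω).toRingHom.injective
      (congrFun h i))

/-- The degree of the closed point of the plane over `K` that lies under a geometric point `p`,
i.e. the number of conjugates of `p`. -/
def closedPointDegree (p : ℙ Ω (Fin 3 → Ω)) : ℕ := Function.minimalPeriod (frob K Ω) p

variable {Ω}

/-- The homogeneous ideal of the closed point of the plane over `K` lying under the geometric
point `p`: it is generated by the forms over `K` vanishing at `p`. -/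
def closedPointIdeal (p : ℙ Ω (Fin 3 → Ω)) : Ideal (MvPolynomial (Fin 3) K) :=
  Ideal.span {f | (∃ n, f.IsHomogeneous n) ∧ MvPolynomial.aeval p.rep f = 0}

end ClosedPoints

section Fibre

variable {K F : Type*} [Field K] [Field F] [Algebra K F] (O : Subalgebra K F) [IsLocalRing O]
  (L : Submodule O F)

/-- The fibre `L / 𝔪 L` of a module `L` over a local ring `O` with maximal ideal `𝔪`. -/
def FibreOf : Type _ := L ⧸ (IsLocalRing.maximalIdeal O • (⊤ : Submodule O L))

instance : AddCommGroup (FibreOf O L) :=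
  inferInstanceAs (AddCommGroup (L ⧸ (IsLocalRing.maximalIdeal O • (⊤ : Submodule O L))))

instance : Module K (FibreOf O L) :=
  inferInstanceAs (Module K (L ⧸ (IsLocalRing.maximalIdeal O • (⊤ : Submodule O L))))

/-- The quotient map from `L` to its fibre. -/
def toFibreOf : L.restrictScalars K →ₗ[K] FibreOf O L :=
  (Submodule.mkQ (IsLocalRing.maximalIdeal O • (⊤ : Submodule O L))).restrictScalars K

end Fibre

/-! ### Blow-ups of the projective plane

An integral separated scheme with function field `F` is described by the local rings of its points,
regarded as subrings of `F` (distinct points have distinct local rings).  We use the field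
`K(X₀, X₁, X₂)`, whose homogeneous elements of degree `0` form the function field of the plane and
whose homogeneous elements of degree `m` are the rational sections of `𝒪(m)`. -/

section Blowup

variable {K : Type*} [Field K]

variable (K) in
/-- The field of rational functions in the homogeneous coordinates of the plane. -/
abbrev CoordField : Type _ := FractionRing (MvPolynomial (Fin 3) K)

/-- A polynomial in the homogeneous coordinates, viewed in `K(X₀, X₁, X₂)`. -/
def toField (f : MvPolynomial (Fin 3) K) : CoordField K :=
  algebraMap (MvPolynomial (Fin 3) K) (CoordField K) f

/-- The homogeneous coordinate `X i`, viewed in `K(X₀, X₁, X₂)`. -/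
def coord (i : Fin 3) : CoordField K := toField (MvPolynomial.X i)

/-- An affine chart of the blow-up of the plane along the homogeneous ideal `J`.  Over the affine
plane `X i ≠ 0`, with coordinate ring `A = K[X j / X i]` and ideal
`J_i = {f / X i ^ n | f ∈ J homogeneous of degree n}`, and for a nonzero element `γ = g / X i ^ d`
of `J_i`, it is the affine blow-up algebra `A[J_i / γ]`. -/
def blowupChart (J : Ideal (MvPolynomial (Fin 3) K)) (i : Fin 3) (d : ℕ)
    (g : MvPolynomial (Fin 3) K) : Subalgebra K (CoordField K) :=
  Algebra.adjoin K
    ({z | ∃ j, z = coord j / coord i} ∪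
      {z | ∃ n, ∃ f ∈ J, f.IsHomogeneous n ∧
        z = (toField f / coord i ^ n) / (toField g / coord i ^ d)})

/-- The localization of a subalgebra `B` of a field at a prime ideal `𝔭`, inside the field. -/
def localizationAt {F : Type*} [Field F] [Algebra K F] (B : Subalgebra K F)
    (𝔭 : Ideal B) [h𝔭 : 𝔭.IsPrime] : Subalgebra K F where
  carrier := {z | ∃ a s : B, s ∉ 𝔭 ∧ z = (a : F) / (s : F)}
  mul_mem' := by
    rintro _ _ ⟨a, s, hs, rfl⟩ ⟨b, t, ht, rfl⟩
    refine ⟨a * b, s * t, fun h => (h𝔭.mem_or_mem h).elim hs ht, ?_⟩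
    push_cast
    rw [div_mul_div_comm]
  add_mem' := by
    rintro _ _ ⟨a, s, hs, rfl⟩ ⟨b, t, ht, rfl⟩
    have hs0 : (s : F) ≠ 0 := fun h => hs (by
      have : s = 0 := Subtype.ext h
      rw [this]; exact 𝔭.zero_mem)
    have ht0 : (t : F) ≠ 0 := fun h => ht (by
      have : t = 0 := Subtype.ext h
      rw [this]; exact 𝔭.zero_mem)
    refine ⟨a * t + s * b, s * t, fun h => (h𝔭.mem_or_mem h).elim hs ht, ?_⟩
    push_cast
    rw [div_add_div _ _ hs0 ht0]
  algebraMap_mem' c := by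
    refine ⟨algebraMap K B c, 1, fun h => h𝔭.ne_top ((Ideal.eq_top_iff_one 𝔭).2 h), ?_⟩
    simp

theorem isLocalRing_localizationAt {F : Type*} [Field F] [Algebra K F] (B : Subalgebra K F)
    (𝔭 : Ideal B) [h𝔭 : 𝔭.IsPrime] : IsLocalRing (localizationAt B 𝔭) := by
  have h0 : ∀ s : B, s ∉ 𝔭 → (s : F) ≠ 0 := fun s hs h => hs (by
    have : s = 0 := Subtype.ext h
    rw [this]; exact 𝔭.zero_mem)
  refine IsLocalRing.of_isUnit_or_isUnit_one_sub_self ?_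
  rintro ⟨_, a, s, hs, rfl⟩
  by_cases ha : a ∈ 𝔭
  · right
    have hsa : s - a ∉ 𝔭 := fun h => hs (by simpa using 𝔭.add_mem h ha)
    refine IsUnit.of_mul_eq_one ⟨(s : F) / ((s - a : B) : F), s, s - a, hsa, rfl⟩ ?_
    apply Subtype.ext
    have h1 := h0 s hs
    have h2 := h0 _ hsa
    push_cast at h2 ⊢
    field_simp
  · left
    refine IsUnit.of_mul_eq_one ⟨(s : F) / (a : F), s, a, ha, rfl⟩ ?_
    apply Subtype.ext
    have h1 := h0 s hs
    have h2 := h0 a ha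
    push_cast
    field_simp

/-- `O` is the local ring of a (scheme-theoretic) point of the blow-up of the plane along `J`. -/
def IsBlowupPoint (J : Ideal (MvPolynomial (Fin 3) K)) (O : Subalgebra K (CoordField K)) : Prop :=
  ∃ (i : Fin 3) (d : ℕ) (g : MvPolynomial (Fin 3) K), g ∈ J ∧ g.IsHomogeneous d ∧ g ≠ 0 ∧
    ∃ (𝔭 : Ideal (blowupChart J i d g)) (_ : 𝔭.IsPrime), O = localizationAt _ 𝔭

/-- The blow-up of the plane along the homogeneous ideal `J`, as the set of its points, each given
by its local ring. -/
def Blowup (J : Ideal (MvPolynomial (Fin 3) K)) : Type _ :=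
  {O : Subalgebra K (CoordField K) // IsBlowupPoint J O}

variable {J : Ideal (MvPolynomial (Fin 3) K)}

/-- The local ring of a point of the blow-up. -/
abbrev Blowup.localRing (y : Blowup J) : Subalgebra K (CoordField K) := y.1

instance (y : Blowup J) : IsLocalRing y.localRing := by
  obtain ⟨O, i, d, g, -, -, -, 𝔭, h𝔭, rfl⟩ := y
  exact isLocalRing_localizationAt _ 𝔭

/-- A rational point: a point whose residue field is `K`. -/
def Blowup.IsRational (y : Blowup J) : Prop :=
  Function.Surjective (algebraMap K (IsLocalRing.ResidueField y.localRing))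

variable (J) in
/-- The set of rational points of the blow-up. -/
def RationalPoint : Type _ := {y : Blowup J // y.IsRational}

/-! ### Line bundles, global sections and evaluation codes -/

/-- The stalk at `y` of `I · π^*𝒪(m)`, where `π` is the blow-up map: the module over the local ring
at `y` generated by the `f / X i ^ e`, with `f ∈ I` homogeneous of degree `m + e` and `X i`
a coordinate that does not vanish at `π y`. -/
def twistedStalk (I : Ideal (MvPolynomial (Fin 3) K)) (m : ℕ) (y : Blowup J) :
    Submodule y.localRing (CoordField K) :=
  Submodule.span y.localRing
    {z | ∃ (i : Fin 3) (e : ℕ), (∀ j, coord j / coord i ∈ y.localRing) ∧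
      ∃ f ∈ I, f.IsHomogeneous (m + e) ∧ z = toField f / coord i ^ e}

variable (J) in
/-- The space of global sections of the subsheaf `I · π^*𝒪(m)` of the constant sheaf
`K(X₀, X₁, X₂)` on the blow-up along `J`. -/
def globalSections (I : Ideal (MvPolynomial (Fin 3) K)) (m : ℕ) : Submodule K (CoordField K) :=
  ⨅ y : Blowup J, (twistedStalk I m y).restrictScalars K

/-- The fibre at `y` of `I · π^*𝒪(m)`: its stalk modulo the maximal ideal of `y`. -/
abbrev Fibre (I : Ideal (MvPolynomial (Fin 3) K)) (m : ℕ) (y : Blowup J) : Type _ :=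
  FibreOf y.localRing (twistedStalk I m y)

/-- The value `f_y` of a global section `f` in the fibre at `y`. -/
def evalAt (I : Ideal (MvPolynomial (Fin 3) K)) (m : ℕ) (y : Blowup J) :
    globalSections J I m →ₗ[K] Fibre I m y :=
  (toFibreOf y.localRing (twistedStalk I m y)).comp (Submodule.inclusion (iInf_le _ y))

/-- The evaluation code of `I · π^*𝒪(m)` at all rational points of the blow-up along `J`, with
respect to coordinates `e` on the fibres. -/
def evaluationCode (I : Ideal (MvPolynomial (Fin 3) K)) (m : ℕ)
    (e : ∀ y : RationalPoint J, Fibre I m y.1 ≃ₗ[K] K) : Submodule K (RationalPoint J → K) :=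
  LinearMap.range (LinearMap.pi fun y : RationalPoint J =>
    (e y).toLinearMap.comp (evalAt I m y.1))

end Blowup

/-- `C` is an `[n, k, d]` code: a linear code of length `n`, dimension `k` and minimum
distance (= least Hamming weight of a nonzero codeword) exactly `d`. -/
def HasParameters {K ι : Type*} [Field K] (C : Submodule K (ι → K)) (n k d : ℕ) : Prop :=
  Finite ι ∧ Nat.card ι = n ∧ Module.finrank K C = k ∧
    IsLeast {w : ℕ | ∃ c ∈ C, c ≠ 0 ∧ w = Set.ncard {i | c i ≠ 0}} d

/-! ### The surface `Y` and the line bundles `𝓕_i` -/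

section SurfaceY

variable (K : Type*) {Ω : Type*} [Field K] [Finite K] [Field Ω] [Algebra K Ω]

/-- The homogeneous ideal of the union of the closed points under `P` and `R`. The surface `Y` is
the blow-up of the plane along it, `Blowup (centreY K P R)`. -/
def centreY (P R : ℙ Ω (Fin 3 → Ω)) : Ideal (MvPolynomial (Fin 3) K) :=
  closedPointIdeal K P ⊓ closedPointIdeal K R

/-- The ideal `I_P² I_R`. As `I_P · 𝒪_Y = 𝒪(-E)` and `I_R · 𝒪_Y = 𝒪(-F)`, where `E` and `F` are the
exceptional divisors over `P` and `R`, the line bundle `𝓕_i = π^*𝒪(i) ⊗ 𝒪(-2E - F)` is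
`I_P² I_R · π^*𝒪(i)`. -/
def idealF (P R : ℙ Ω (Fin 3 → Ω)) : Ideal (MvPolynomial (Fin 3) K) :=
  closedPointIdeal K P ^ 2 * closedPointIdeal K R

/-- The rational points of the surface `Y`. -/
abbrev RationalPointY (P R : ℙ Ω (Fin 3 → Ω)) : Type _ := RationalPoint (centreY K P R)

/-- The fibre of `𝓕_i` at a rational point of `Y`. -/
abbrev FibreF (P R : ℙ Ω (Fin 3 → Ω)) (i : ℕ) (y : RationalPointY K P R) : Type _ :=
  Fibre (idealF K P R) i y.1

/-- The code `C_L(Y, 𝓕_i)`, for coordinates `e` on the fibres of `𝓕_i`. -/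
def codeYF (P R : ℙ Ω (Fin 3 → Ω)) (i : ℕ)
    (e : ∀ y : RationalPointY K P R, FibreF K P R i y ≃ₗ[K] K) :
    Submodule K (RationalPointY K P R → K) :=
  evaluationCode (idealF K P R) i e

end SurfaceY

end RationalSurfaceCode

end

/-! Choose coordinates with P = (0:0:1) and R = (1:α:β), where α generates the quadratic extension
of K and β has degree two over K(α). The conics through the four conjugates of R form a pencil
spanned by the line pair N = y² - txy + nx² and a conic Q = z² + (l₀x + l₁y)z + x(m₀x + m₁y)
avoiding P. A quartic with a double point at P, divided by Q and N, becomes aQ + N(bz + c), with a,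
c quadratic and b linear in x, y, plus a remainder with four coefficients. Vanishing at R kills the
remainder because 1, α, β, αβ are independent over K. This gives dimension 3 + 2 + 3 = 8
(`IsNormalized.mem_globalSections_iff`).

No rational point of Y lies over R, so the rational points are those of the plane blown up at P. The
lines through P sort them into q + 1 fibres with q + 1 points each, one of them on E; the length is
(q + 1)² (`IsCentre.indexEquiv`).

On a fibre a section has degree 4 - 2 = 2, hence at most two zeros unless it vanishes on the whole
fibre. With at most one such fibre there are at most 3q + 1 zeros. With two, b = 0 and a, c are
proportional or a = 0. If a = 0, the zeros are E and at most two fibres, at most 3q + 1 points. If c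
= ra, they are at most two fibres and the conic Q + rN. That conic has exactly q + 1 points: each
member has at most q + 1 of them, and the q members partition the q(q + 1) rational points off E. So
3q + 3 bounds the zeros (`ConicPencil.card_zeros_value_le`), and (q + 1)² - (3q + 3) = q² - q - 2.
The bound is attained when two lines through P miss Q + rN; some r has at most one tangent through
P, and then counting yields two such lines if q ≥ 3 (`ConicPencil.exists_card_zeros_value_eq`).

The rest links this to the sheaf. Local rings at rational points are identified with explicit local
rings at the origin of affine planes. Global sections are shown to be polynomials vanishing at R by
valuation rings centred on Y; the stalks along E force the double point. -/

noncomputable section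

namespace RationalSurfaceCode

/-! ### Zeros of ternary quadratic forms over a finite field -/

section Counting

variable {K : Type*} [Field K]

/-- The number of zeros in `K³` of a ternary quadratic form `z² + (l₀x + l₁y)z + Ax² + Bxy + Cy²`,
with a zero in `x ≠ 0`, that vanishes on no plane. -/
theorem card_zeros_le_aux [Fintype K] [DecidableEq K] (l₀ l₁ A B C y₀ z₀ : K)
    (hline : ∀ e f : K, ¬ (A + l₀ * e + e ^ 2 = 0 ∧ C + l₁ * f + f ^ 2 = 0 ∧
      B + l₀ * f + l₁ * e + 2 * e * f = 0))
    (h0 : z₀ ^ 2 + (l₀ + l₁ * y₀) * z₀ + A + B * y₀ + C * y₀ ^ 2 = 0) :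
    (Finset.univ.filter fun v : K × K × K => v.2.2 ^ 2 + (l₀ * v.1 + l₁ * v.2.1) * v.2.2 +
      A * v.1 ^ 2 + B * v.1 * v.2.1 + C * v.2.1 ^ 2 = 0).card ≤ Fintype.card K ^ 2 := by
  -- Projection from the zero v₀ = (1, y₀, z₀): on x·v₀ + (0, y', z') the form equals x(py' + rz')
  -- plus its value at (0, y', z').
  set p : K := B + 2 * C * y₀ + l₁ * z₀ with hp
  set r : K := l₀ + l₁ * y₀ + 2 * z₀ with hr
  -- A common nonzero zero (y, z) of the polar form and of the restriction to x = 0 would make the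
  -- form vanish on the plane spanned by v₀ and (0, y, z).
  have key : ∀ y z : K, p * y + r * z = 0 → z ^ 2 + l₁ * y * z + C * y ^ 2 = 0 → y = 0 ∧ z = 0 := by
    intro y z h1 h2
    by_cases hy : y = 0
    · subst hy
      refine ⟨rfl, ?_⟩
      have : z ^ 2 = 0 := by linear_combination h2
      exact pow_eq_zero_iff (two_ne_zero) |>.1 this
    · exfalso
      set g := z / y with hg
      have hz : z = g * y := by rw [hg]; field_simp
      have e1 : p + r * g = 0 := by
        apply mul_left_cancel₀ hy; rw [hz] at h1; linear_combination h1
      have e2 : C + l₁ * g + g ^ 2 = 0 := by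
        apply mul_left_cancel₀ (pow_ne_zero 2 hy); rw [hz] at h2; linear_combination h2
      refine hline (z₀ - g * y₀) g ⟨?_, e2, ?_⟩
      · linear_combination h0 - y₀ * e1 + y₀ ^ 2 * e2 + y₀ * hp + y₀ * g * hr
      · linear_combination e1 - 2 * y₀ * e2 - hp - g * hr
  have hexp : ∀ x y z : K, z ^ 2 + (l₀ * x + l₁ * y) * z + A * x ^ 2 + B * x * y + C * y ^ 2 = 0 →
      x * (p * (y - y₀ * x) + r * (z - z₀ * x)) + ((z - z₀ * x) ^ 2 +
        l₁ * (y - y₀ * x) * (z - z₀ * x) + C * (y - y₀ * x) ^ 2) = 0 := by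
    intro x y z h
    linear_combination h - x ^ 2 * h0 + x * (y - y₀ * x) * hp + x * (z - z₀ * x) * hr
  have hcard : Fintype.card K ^ 2 = (Finset.univ : Finset (K × K)).card := by
    rw [Finset.card_univ, Fintype.card_prod, sq]
  rw [hcard]
  -- Off the line of v₀ the projection (y', z') determines x, because py' + rz' ≠ 0 there. The line
  -- of v₀ itself is sent to the kernel of the polar form, which no other zero reaches; if p = r = 0
  -- there are no other zeros and any injection of the line will do.
  refine Finset.card_le_card_of_injOn (fun v => if v.2.1 - y₀ * v.1 = 0 ∧ v.2.2 - z₀ * v.1 = 0 then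
    (if p = 0 ∧ r = 0 then (v.1, 0) else (v.1 * r, - (v.1 * p))) else
      (v.2.1 - y₀ * v.1, v.2.2 - z₀ * v.1)) (fun _ _ => Finset.mem_coe.2 (Finset.mem_univ _)) ?_
  rintro ⟨x, y, z⟩ hv ⟨x', y', z'⟩ hv' heq
  simp only [Finset.coe_filter, Finset.mem_univ, true_and, Set.mem_ofPred_eq] at hv hv' heq
  have h1 := hexp x y z hv
  have h2 := hexp x' y' z' hv'
  by_cases hc : y - y₀ * x = 0 ∧ z - z₀ * x = 0 <;> by_cases hc' : y' - y₀ * x' = 0 ∧ z' - z₀ * x' = 0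
  · rw [if_pos hc, if_pos hc'] at heq
    have hx : x = x' := by
      by_cases hpr : p = 0 ∧ r = 0
      · rw [if_pos hpr, if_pos hpr] at heq; exact (Prod.ext_iff.1 heq).1
      · rw [if_neg hpr, if_neg hpr] at heq
        obtain ⟨q1, q2⟩ := Prod.ext_iff.1 heq
        by_cases hr0 : r = 0
        · have hp0 : p ≠ 0 := fun h => hpr ⟨h, hr0⟩
          exact mul_right_cancel₀ hp0 (neg_injective q2)
        · exact mul_right_cancel₀ hr0 q1
    subst hx
    obtain rfl : y = y' := by linear_combination hc.1 - hc'.1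
    obtain rfl : z = z' := by linear_combination hc.2 - hc'.2
    rfl
  · rw [if_pos hc, if_neg hc'] at heq
    exfalso
    apply hc'
    by_cases hpr : p = 0 ∧ r = 0
    · refine key _ _ (by rw [hpr.1, hpr.2]; ring) ?_
      rw [hpr.1, hpr.2] at h2; linear_combination h2
    · rw [if_neg hpr] at heq
      obtain ⟨q1, q2⟩ := Prod.ext_iff.1 heq
      simp only at q1 q2
      have hL : p * (y' - y₀ * x') + r * (z' - z₀ * x') = 0 := by rw [← q1, ← q2]; ring
      exact key _ _ hL (by rw [hL] at h2; linear_combination h2)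
  · rw [if_neg hc, if_pos hc'] at heq
    exfalso
    apply hc
    by_cases hpr : p = 0 ∧ r = 0
    · refine key _ _ (by rw [hpr.1, hpr.2]; ring) ?_
      rw [hpr.1, hpr.2] at h1; linear_combination h1
    · rw [if_neg hpr] at heq
      obtain ⟨q1, q2⟩ := Prod.ext_iff.1 heq
      simp only at q1 q2
      have hL : p * (y - y₀ * x) + r * (z - z₀ * x) = 0 := by rw [q1, q2]; ring
      exact key _ _ hL (by rw [hL] at h1; linear_combination h1)
  · rw [if_neg hc, if_neg hc'] at heq
    obtain ⟨q1, q2⟩ := Prod.ext_iff.1 heq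
    simp only at q1 q2
    have hL : p * (y - y₀ * x) + r * (z - z₀ * x) ≠ 0 := fun hL =>
      hc (key _ _ hL (by rw [hL] at h1; linear_combination h1))
    have hx : x = x' := by
      apply mul_right_cancel₀ hL
      rw [← q1, ← q2] at h2
      linear_combination h1 - h2
    subst hx
    obtain rfl : y = y' := by linear_combination q1
    obtain rfl : z = z' := by linear_combination q2
    rfl

/-- A ternary quadratic form `z² + (l₀x + l₁y)z + Ax² + Bxy + Cy²` over a field with `q` elements
that vanishes on no plane has at most `q²` zeros in `K³`. -/
theorem card_zeros_le [Fintype K] [DecidableEq K] (l₀ l₁ A B C : K)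
    (hline : ∀ e f : K, ¬ (A + l₀ * e + e ^ 2 = 0 ∧ C + l₁ * f + f ^ 2 = 0 ∧
      B + l₀ * f + l₁ * e + 2 * e * f = 0)) :
    (Finset.univ.filter fun v : K × K × K => v.2.2 ^ 2 + (l₀ * v.1 + l₁ * v.2.1) * v.2.2 +
      A * v.1 ^ 2 + B * v.1 * v.2.1 + C * v.2.1 ^ 2 = 0).card ≤ Fintype.card K ^ 2 := by
  by_cases hx : ∃ x y z : K, x ≠ 0 ∧
      z ^ 2 + (l₀ * x + l₁ * y) * z + A * x ^ 2 + B * x * y + C * y ^ 2 = 0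
  · obtain ⟨x, y, z, hx, h⟩ := hx
    refine card_zeros_le_aux l₀ l₁ A B C (y / x) (z / x) hline ?_
    field_simp
    linear_combination h
  by_cases hy : ∃ x y z : K, y ≠ 0 ∧
      z ^ 2 + (l₀ * x + l₁ * y) * z + A * x ^ 2 + B * x * y + C * y ^ 2 = 0
  · obtain ⟨x, y, z, hy, h⟩ := hy
    have h' := card_zeros_le_aux l₁ l₀ C B A (x / y) (z / y)
      (fun e f hef => hline f e ⟨hef.2.1, hef.1, by linear_combination hef.2.2⟩)
      (by field_simp; linear_combination h)
    refine le_trans (Finset.card_le_card_of_injOn (fun v => (v.2.1, v.1, v.2.2)) ?_ ?_) h'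
    · rintro ⟨a, b, c⟩ hv
      simp only [Finset.coe_filter, Finset.mem_univ, true_and, Set.mem_ofPred_eq] at hv ⊢
      linear_combination hv
    · rintro ⟨a, b, c⟩ _ ⟨a', b', c'⟩ _ heq
      simp only [Prod.mk.injEq] at heq ⊢
      tauto
  · push Not at hx hy
    refine le_trans (Finset.card_le_card (t := {(0, 0, 0)}) ?_) ?_
    · rintro ⟨a, b, c⟩ hv
      simp only [Finset.mem_filter, Finset.mem_univ, true_and] at hv
      have ha : a = 0 := by by_contra h; exact hx a b c h hv
      have hb : b = 0 := by by_contra h; exact hy a b c h hv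
      subst ha; subst hb
      have : c ^ 2 = 0 := by linear_combination hv
      have : c = 0 := pow_eq_zero_iff two_ne_zero |>.1 this
      simp [this]
    · rw [Finset.card_singleton]
      exact Nat.one_le_pow _ _ Fintype.card_pos

end Counting

/-! ### A pencil of conics and the associated space of quartics -/

section Pencil

variable {K : Type*} [Field K]

/-- The pencil of conics spanned by `y² - txy + nx²` and `z² + (l₀x + l₁y)z + x(m₀x + m₁y)`. -/
structure ConicPencil (K : Type*) where
  (t n l₀ l₁ m₀ m₁ : K)

/-- A binary linear form. -/
def linForm (b : Fin 2 → K) {S : Type*} [CommRing S] [Algebra K S] (x y : S) : S :=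
  algebraMap K S (b 0) * x + algebraMap K S (b 1) * y

/-- A binary quadratic form. -/
def quadForm (a : Fin 3 → K) {S : Type*} [CommRing S] [Algebra K S] (x y : S) : S :=
  algebraMap K S (a 0) * x ^ 2 + algebraMap K S (a 1) * (x * y) + algebraMap K S (a 2) * y ^ 2

namespace ConicPencil

variable (c : ConicPencil K) {S : Type*} [CommRing S] [Algebra K S]

/-- The member of the pencil that is a pair of lines through `(0 : 0 : 1)`. -/
def normForm (x y : S) : S :=
  y ^ 2 - algebraMap K S c.t * (x * y) + algebraMap K S c.n * x ^ 2

/-- A member of the pencil that does not contain `(0 : 0 : 1)`. -/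
def conic (x y z : S) : S :=
  z ^ 2 + (algebraMap K S c.l₀ * x + algebraMap K S c.l₁ * y) * z +
    x * (algebraMap K S c.m₀ * x + algebraMap K S c.m₁ * y)

/-- The quartics with a double point at `(0 : 0 : 1)` through the base points of the pencil. -/
def quartic (v : (Fin 3 → K) × (Fin 2 → K) × (Fin 3 → K)) (x y z : S) : S :=
  quadForm v.1 x y * c.conic x y z +
    c.normForm x y * (linForm v.2.1 x y * z + quadForm v.2.2 x y)

/-- The pencil has no rational base point, no member containing a rational line, and its smooth
members are not all tangent to the lines through `(0 : 0 : 1)`. -/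
structure IsGeneral : Prop where
  normForm_eq_zero : ∀ x y : K, c.normForm x y = 0 → x = 0 ∧ y = 0
  no_line : ∀ r e f : K, ¬ (c.m₀ + r * c.n + c.l₀ * e + e ^ 2 = 0 ∧ r + c.l₁ * f + f ^ 2 = 0 ∧
    c.m₁ - r * c.t + c.l₀ * f + c.l₁ * e + 2 * e * f = 0)
  char_two : (2 : K) = 0 → c.l₀ ≠ 0 ∨ c.l₁ ≠ 0

end ConicPencil

/-- First coordinate of the point of the projective line with index `d`. -/
def dirX : Option K → K
  | none => 0
  | some _ => 1

/-- Second coordinate of the point of the projective line with index `d`. -/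
def dirY : Option K → K
  | none => 1
  | some c => c

theorem dir_ne_zero (d : Option K) : ¬ (dirX d = 0 ∧ dirY d = 0) := by
  cases d <;> simp [dirX, dirY]

theorem dir_eq {d d' : Option K} (h : dirX d * dirY d' = dirY d * dirX d') : d = d' := by
  cases d <;> cases d' <;> simp_all [dirX, dirY]

/-- The value of a quartic at the rational point with index `(d, η)` of the blow-up. -/
def ConicPencil.value (c : ConicPencil K) (v : (Fin 3 → K) × (Fin 2 → K) × (Fin 3 → K)) :
    Option K × Option K → K
  | (d, some z) => c.quartic v (dirX d) (dirY d) z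
  | (d, none) => quadForm v.1 (dirX d) (dirY d)

theorem linForm_eq_zero {b : Fin 2 → K} {d d' : Option K} (hd : d ≠ d')
    (h : linForm b (dirX d) (dirY d) = 0) (h' : linForm b (dirX d') (dirY d') = 0) : b = 0 := by
  simp only [linForm, Algebra.algebraMap_self, RingHom.id_apply] at h h'
  have hD : dirX d * dirY d' - dirY d * dirX d' ≠ 0 := fun h => hd (dir_eq (sub_eq_zero.1 h))
  funext i
  fin_cases i
  · apply mul_right_cancel₀ hD
    simp only [Fin.zero_eta, Pi.zero_apply]
    linear_combination dirY d' * h - dirY d * h'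
  · apply mul_right_cancel₀ hD
    simp only [Fin.mk_one, Pi.zero_apply]
    linear_combination dirX d * h' - dirX d' * h

theorem ConicPencil.normForm_dir_ne_zero {c : ConicPencil K} (hc : c.IsGeneral) (d : Option K) :
    c.normForm (dirX d) (dirY d) ≠ 0 :=
  fun h => dir_ne_zero d (hc.normForm_eq_zero _ _ h)

/-! ### Counting zeros of the quartics over a finite field -/

section FiniteField

variable [Fintype K] [DecidableEq K]

/-- The first summand counts the root at infinity of the binary quadratic form with coefficients a,
b, c. -/
theorem card_roots_le_two {a b c : K} (h : ¬ (a = 0 ∧ b = 0 ∧ c = 0)) :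
    (if a = 0 then 1 else 0) +
      (Finset.univ.filter fun z : K => a * z ^ 2 + b * z + c = 0).card ≤ 2 := by
  by_cases ha : a = 0
  · subst ha
    rw [if_pos rfl]
    have : (Finset.univ.filter fun z : K => 0 * z ^ 2 + b * z + c = 0).card ≤ 1 := by
      rw [Finset.card_le_one]
      intro z hz w hw
      simp only [Finset.mem_filter, Finset.mem_univ, true_and] at hz hw
      have hb : b ≠ 0 := by
        rintro rfl
        exact h ⟨rfl, rfl, by linear_combination hz⟩
      apply mul_left_cancel₀ hb
      linear_combination hz - hw
    omega
  · rw [if_neg ha, zero_add]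
    by_cases he : (Finset.univ.filter fun z : K => a * z ^ 2 + b * z + c = 0) = ∅
    · rw [he]; simp
    obtain ⟨z, hz⟩ := Finset.nonempty_iff_ne_empty.2 he
    simp only [Finset.mem_filter, Finset.mem_univ, true_and] at hz
    refine le_trans (Finset.card_le_card (t := {z, -(b / a) - z}) ?_) Finset.card_le_two
    intro w hw
    simp only [Finset.mem_filter, Finset.mem_univ, true_and] at hw
    rw [Finset.mem_insert, Finset.mem_singleton]
    by_cases hwz : w = z
    · exact Or.inl hwz
    · right
      have : a * (w + z) + b = 0 := by
        apply mul_left_cancel₀ (sub_ne_zero.2 hwz)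
        linear_combination hw - hz
      field_simp
      linear_combination this

theorem card_quadForm_zeros_le {a : Fin 3 → K} (h : a ≠ 0) :
    (Finset.univ.filter fun d : Option K => quadForm a (dirX d) (dirY d) = 0).card ≤ 2 := by
  have h' : ¬ (a 2 = 0 ∧ a 1 = 0 ∧ a 0 = 0) := by
    rintro ⟨h2, h1, h0⟩
    exact h (funext fun i => by fin_cases i <;> assumption)
  refine le_trans (le_of_eq ?_) (card_roots_le_two h')
  rw [Finset.card_filter, Fintype.sum_option, Finset.card_filter]
  congr 1
  · simp [quadForm, dirX, dirY]
  · refine Finset.sum_congr rfl fun z _ => ?_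
    refine if_congr ?_ rfl rfl
    simp only [quadForm, dirX, dirY, Algebra.algebraMap_self, RingHom.id_apply]
    constructor <;> intro h <;> linear_combination h

/-- Choosing r so that a' - ra also vanishes at a third direction, where a does not, gives a binary
quadratic form with three zeros, which must be 0. -/
theorem quadForm_proportional (hq : 3 ≤ Fintype.card K) {a a' : Fin 3 → K} {d d' : Option K}
    (hd : d ≠ d') (ha : a ≠ 0)
    (h₁ : quadForm a (dirX d) (dirY d) = 0) (h₂ : quadForm a (dirX d') (dirY d') = 0)
    (h₁' : quadForm a' (dirX d) (dirY d) = 0) (h₂' : quadForm a' (dirX d') (dirY d') = 0) :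
    ∃ r : K, a' = r • a := by
  have hc : (Finset.univ.filter fun d : Option K => quadForm a (dirX d) (dirY d) = 0).card <
      (Finset.univ : Finset (Option K)).card := by
    refine lt_of_le_of_lt (card_quadForm_zeros_le ha) ?_
    rw [Finset.card_univ, Fintype.card_option]; omega
  obtain ⟨e, -, he⟩ := Finset.exists_mem_notMem_of_card_lt_card hc
  simp only [Finset.mem_filter, Finset.mem_univ, true_and] at he
  set r := quadForm a' (dirX e) (dirY e) / quadForm a (dirX e) (dirY e) with hr
  refine ⟨r, ?_⟩
  by_contra hne
  have hlin : ∀ x y : K, quadForm (a' - r • a) x y = quadForm a' x y - r * quadForm a x y := by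
    intro x y
    simp only [quadForm, Algebra.algebraMap_self, RingHom.id_apply, Pi.sub_apply, Pi.smul_apply,
      smul_eq_mul]
    ring
  have hle := card_quadForm_zeros_le (sub_ne_zero.2 hne)
  have hsub : ({d, d', e} : Finset (Option K)) ⊆
      Finset.univ.filter fun d : Option K => quadForm (a' - r • a) (dirX d) (dirY d) = 0 := by
    intro u hu
    simp only [Finset.mem_insert, Finset.mem_singleton] at hu
    simp only [Finset.mem_filter, Finset.mem_univ, true_and, hlin]
    rcases hu with rfl | rfl | rfl
    · rw [h₁, h₁']; ring
    · rw [h₂, h₂']; ring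
    · rw [hr]; field_simp; ring
  have h3 : ({d, d', e} : Finset (Option K)).card = 3 := by
    rw [Finset.card_eq_three]
    refine ⟨d, d', e, hd, ?_, ?_, rfl⟩
    · rintro rfl; exact he h₁
    · rintro rfl; exact he h₂
  have := Finset.card_le_card hsub
  omega

namespace ConicPencil

variable {c : ConicPencil K}

/-- The number of points of a member of the pencil on the line with index `d`. -/
def fibreCard (c : ConicPencil K) (r : K) (d : Option K) : ℕ :=
  (Finset.univ.filter fun z : K =>
    c.conic (dirX d) (dirY d) z + r * c.normForm (dirX d) (dirY d) = 0).card

/-- Scaling turns each point of the conic into q - 1 nonzero zeros of its equation in K³, and there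
are at most q² - 1 of those. No point is lost by using the coordinates (d, z), since the conic
avoids (0:0:1). -/
theorem sum_fibreCard_le (hc : c.IsGeneral) (r : K) :
    ∑ d, c.fibreCard r d ≤ Fintype.card K + 1 := by
  have h := card_zeros_le c.l₀ c.l₁ (c.m₀ + r * c.n) (c.m₁ - r * c.t) r
    (fun e f h => hc.no_line r e f h)
  set Z := Finset.univ.filter fun p : Option K × K =>
    c.conic (dirX p.1) (dirY p.1) p.2 + r * c.normForm (dirX p.1) (dirY p.1) = 0 with hZ
  have hsum : ∑ d, c.fibreCard r d = Z.card := by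
    rw [hZ, Finset.card_filter, Fintype.sum_prod_type]
    exact Finset.sum_congr rfl fun d _ => Finset.card_filter _ _
  rw [hsum]
  set S := Finset.univ.filter fun v : K × K × K => v.2.2 ^ 2 + (c.l₀ * v.1 + c.l₁ * v.2.1) * v.2.2 +
      (c.m₀ + r * c.n) * v.1 ^ 2 + (c.m₁ - r * c.t) * v.1 * v.2.1 + r * v.2.1 ^ 2 = 0 with hS
  have hinj : ((Finset.univ : Finset Kˣ) ×ˢ Z).card ≤ (S.erase (0, 0, 0)).card := by
    refine Finset.card_le_card_of_injOn
      (fun p => ((p.1 : K) * dirX p.2.1, (p.1 : K) * dirY p.2.1, (p.1 : K) * p.2.2)) ?_ ?_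
    · rintro ⟨u, d, z⟩ hp
      simp only [Finset.coe_product, Set.mem_prod, Finset.mem_coe, Finset.mem_univ, true_and, hZ,
        Finset.mem_filter] at hp
      simp only [Finset.coe_erase, hS, Set.mem_sdiff, Finset.mem_coe, Finset.mem_filter,
        Finset.mem_univ, true_and, Set.mem_singleton_iff, Prod.mk.injEq, mul_eq_zero, Units.ne_zero,
        false_or]
      refine ⟨?_, fun h => dir_ne_zero d ⟨h.1, h.2.1⟩⟩
      simp only [conic, normForm, Algebra.algebraMap_self, RingHom.id_apply] at hp
      linear_combination (u : K) ^ 2 * hp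
    · rintro ⟨u, d, z⟩ - ⟨u', d', z'⟩ - heq
      simp only [Prod.mk.injEq] at heq
      obtain ⟨h1, h2, h3⟩ := heq
      have hd : d = d' := by
        apply dir_eq
        apply mul_left_cancel₀ (mul_ne_zero u.ne_zero u'.ne_zero)
        linear_combination (u' : K) * dirY d' * h1 - (u' : K) * dirX d' * h2
      subst hd
      have hu : (u : K) = u' := by
        by_cases hx : dirX d = 0
        · exact mul_right_cancel₀ (fun hy => dir_ne_zero d ⟨hx, hy⟩) h2
        · exact mul_right_cancel₀ hx h1
      have hu' : u = u' := Units.ext hu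
      subst hu'
      rw [mul_left_cancel₀ u.ne_zero h3]
  have h0 : (0, 0, 0) ∈ S := by simp [hS]
  rw [Finset.card_product, Finset.card_univ, Fintype.card_units, Finset.card_erase_of_mem h0] at hinj
  have hq : 1 < Fintype.card K := Fintype.one_lt_card
  obtain ⟨q, hq'⟩ : ∃ q, Fintype.card K = q + 1 := ⟨_, (Nat.sub_add_cancel hq.le).symm⟩
  rw [hq'] at hinj h ⊢
  simp only [Nat.add_sub_cancel] at hinj
  have hq0 : 0 < q := by omega
  have : q * Z.card ≤ q * (q + 2) := by
    refine le_trans hinj (le_trans (Nat.sub_le_sub_right h 1) (le_of_eq ?_))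
    have : (q + 1) ^ 2 = q * (q + 2) + 1 := by ring
    omega
  have := Nat.le_of_mul_le_mul_left this hq0
  omega

/-- Since `normForm` has no nontrivial rational zero, every point (d, z) lies on exactly one member
of the pencil with parameter r in K. The q members thus share q(q + 1) points, and the upper bound
for each must be an equality. -/
theorem sum_fibreCard_eq (hc : c.IsGeneral) (r : K) :
    ∑ d, c.fibreCard r d = Fintype.card K + 1 := by
  have htot : ∑ s : K, ∑ d, c.fibreCard s d = ∑ _s : K, (Fintype.card K + 1) := by
    rw [Finset.sum_comm]
    have : ∀ d, ∑ s : K, c.fibreCard s d = Fintype.card K := by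
      intro d
      simp only [fibreCard, Finset.card_filter]
      rw [Finset.sum_comm, ← Finset.card_univ, Finset.card_eq_sum_ones]
      refine Finset.sum_congr rfl fun z _ => ?_
      rw [← Finset.card_filter, Finset.card_eq_one]
      refine ⟨- c.conic (dirX d) (dirY d) z / c.normForm (dirX d) (dirY d), ?_⟩
      ext s
      simp only [Finset.mem_filter, Finset.mem_univ, true_and, Finset.mem_singleton]
      rw [eq_div_iff (normForm_dir_ne_zero hc d)]
      constructor <;> intro h <;> linear_combination h
    simp only [this, Finset.sum_const, Finset.card_univ, Fintype.card_option, smul_eq_mul]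
    ring
  exact (Finset.sum_eq_sum_iff_of_le fun s _ => sum_fibreCard_le hc s).1 htot r (Finset.mem_univ r)

/-- The involution z ↦ -z - (l₀x + l₁y) exchanges the two roots on a line, so it fixes a root that
is alone. -/
theorem two_mul_add_eq_zero_of_fibreCard {r : K} {d : Option K} (h : c.fibreCard r d = 1) :
    ∃ z : K, c.conic (dirX d) (dirY d) z + r * c.normForm (dirX d) (dirY d) = 0 ∧
      2 * z + (c.l₀ * dirX d + c.l₁ * dirY d) = 0 := by
  obtain ⟨z, hz⟩ := Finset.card_eq_one.1 h
  have h1 : z ∈ Finset.univ.filter fun z : K =>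
    c.conic (dirX d) (dirY d) z + r * c.normForm (dirX d) (dirY d) = 0 := by simp [hz]
  simp only [Finset.mem_filter, Finset.mem_univ, true_and] at h1
  refine ⟨z, h1, ?_⟩
  have h2 : - z - (c.l₀ * dirX d + c.l₁ * dirY d) ∈ Finset.univ.filter fun z : K =>
      c.conic (dirX d) (dirY d) z + r * c.normForm (dirX d) (dirY d) = 0 := by
    simp only [Finset.mem_filter, Finset.mem_univ, true_and]
    simp only [conic, Algebra.algebraMap_self, RingHom.id_apply] at h1 ⊢
    linear_combination h1
  rw [hz, Finset.mem_singleton] at h2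
  linear_combination - h2

/-- In characteristic 2 tangency forces l₀x + l₁y = 0, and this nonzero linear form has at most one
zero, whatever r is. In odd characteristic the point of tangency on a line is determined, hence so
is r: the q + 1 lines give at most q + 1 tangencies, too few for two on each of the q members. -/
theorem exists_few_tangents (hc : c.IsGeneral) (hq : 3 ≤ Fintype.card K) :
    ∃ r : K, (Finset.univ.filter fun d => c.fibreCard r d = 1).card ≤ 1 := by
  by_cases h2 : (2 : K) = 0
  · refine ⟨0, ?_⟩
    rw [Finset.card_le_one]
    intro d hd d' hd'
    simp only [Finset.mem_filter, Finset.mem_univ, true_and] at hd hd'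
    obtain ⟨z, -, hz⟩ := two_mul_add_eq_zero_of_fibreCard hd
    obtain ⟨z', -, hz'⟩ := two_mul_add_eq_zero_of_fibreCard hd'
    by_contra hne
    have := linForm_eq_zero (b := ![c.l₀, c.l₁]) hne
      (by simp [linForm]; linear_combination hz - z * h2)
      (by simp [linForm]; linear_combination hz' - z' * h2)
    have h0 := congrFun this 0
    have h1 := congrFun this 1
    simp only [Matrix.cons_val_zero, Matrix.cons_val_one, Pi.zero_apply] at h0 h1
    rcases hc.char_two h2 with h | h
    · exact h h0
    · exact h h1
  · by_contra hcon
    push Not at hcon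
    have h3 : ∑ _r : K, 2 ≤ ∑ r : K, (Finset.univ.filter fun d => c.fibreCard r d = 1).card :=
      Finset.sum_le_sum fun r _ => hcon r
    simp only [Finset.card_filter] at h3
    rw [Finset.sum_comm] at h3
    have h4 : ∀ d : Option K, (∑ r : K, if c.fibreCard r d = 1 then 1 else 0) ≤ 1 := by
      intro d
      rw [← Finset.card_filter, Finset.card_le_one]
      intro r hr s hs
      simp only [Finset.mem_filter, Finset.mem_univ, true_and] at hr hs
      obtain ⟨z, hz, hz'⟩ := two_mul_add_eq_zero_of_fibreCard hr
      obtain ⟨w, hw, hw'⟩ := two_mul_add_eq_zero_of_fibreCard hs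
      have : z = w := mul_left_cancel₀ h2 (by linear_combination hz' - hw')
      subst this
      apply mul_right_cancel₀ (normForm_dir_ne_zero hc d)
      linear_combination hz - hw
    have h5 := le_trans h3 (Finset.sum_le_sum fun d _ => h4 d)
    simp only [Finset.sum_const, Finset.card_univ, Fintype.card_option, smul_eq_mul] at h5
    omega

theorem exists_two_external (hc : c.IsGeneral) (hq : 3 ≤ Fintype.card K) :
    ∃ (r : K) (d d' : Option K), d ≠ d' ∧ c.fibreCard r d = 0 ∧ c.fibreCard r d' = 0 := by
  obtain ⟨r, hr⟩ := exists_few_tangents hc hq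
  refine ⟨r, ?_⟩
  -- A line with n ≤ 1 points makes up its deficit from 2 through the indicators: 1 for a tangent, 2
  -- for an external line. Summing, 2(q + 1) ≤ (q + 1) + 1 + 2·#external, so q ≥ 3 forces two
  -- external lines.
  have h1 : ∑ _d : Option K, 2 ≤ ∑ d : Option K, (c.fibreCard r d +
      (if c.fibreCard r d = 1 then 1 else 0) + 2 * (if c.fibreCard r d = 0 then 1 else 0)) := by
    refine Finset.sum_le_sum fun d _ => ?_
    split_ifs <;> omega
  rw [Finset.sum_add_distrib, Finset.sum_add_distrib, ← Finset.mul_sum, ← Finset.card_filter,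
    ← Finset.card_filter, sum_fibreCard_eq hc] at h1
  simp only [Finset.sum_const, Finset.card_univ, Fintype.card_option, smul_eq_mul] at h1
  have h2 : 1 < (Finset.univ.filter fun d => c.fibreCard r d = 0).card := by omega
  obtain ⟨d, hd, d', hd', hne⟩ := Finset.one_lt_card.1 h2
  simp only [Finset.mem_filter, Finset.mem_univ, true_and] at hd hd'
  exact ⟨d, d', hne, hd, hd'⟩

/-- The number of zeros of a quartic on the fibre with index `d`. -/
theorem card_value_eq_zero (v : (Fin 3 → K) × (Fin 2 → K) × (Fin 3 → K)) :
    (Finset.univ.filter fun p => c.value v p = 0).card =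
      ∑ d : Option K, (Finset.univ.filter fun s : Option K => c.value v (d, s) = 0).card := by
  rw [Finset.card_filter, Fintype.sum_prod_type]
  exact Finset.sum_congr rfl fun d _ => (Finset.card_filter _ _).symm

theorem card_fibre_zeros (v : (Fin 3 → K) × (Fin 2 → K) × (Fin 3 → K)) (d : Option K) :
    (Finset.univ.filter fun s : Option K => c.value v (d, s) = 0).card =
      (if quadForm v.1 (dirX d) (dirY d) = 0 then 1 else 0) +
      (Finset.univ.filter fun z : K => c.quartic v (dirX d) (dirY d) z = 0).card := by
  rw [Finset.card_filter, Fintype.sum_option, Finset.card_filter]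
  rfl

/-- On a fibre the section is a polynomial of degree at most 2 in z whose leading coefficient is its
value at the point of E. As `normForm` is nonzero there, it vanishes identically only if all three
forms a, b, c do. -/
theorem card_fibre_zeros_le (hc : c.IsGeneral) (v : (Fin 3 → K) × (Fin 2 → K) × (Fin 3 → K))
    (d : Option K) (h : ¬ (quadForm v.1 (dirX d) (dirY d) = 0 ∧ linForm v.2.1 (dirX d) (dirY d) = 0 ∧
      quadForm v.2.2 (dirX d) (dirY d) = 0)) :
    (Finset.univ.filter fun s : Option K => c.value v (d, s) = 0).card ≤ 2 := by
  rw [card_fibre_zeros]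
  set A := quadForm v.1 (dirX d) (dirY d)
  set N := c.normForm (dirX d) (dirY d) with hN
  have hN0 : N ≠ 0 := normForm_dir_ne_zero hc d
  have := card_roots_le_two (a := A)
    (b := A * (c.l₀ * dirX d + c.l₁ * dirY d) + N * linForm v.2.1 (dirX d) (dirY d))
    (c := A * (dirX d * (c.m₀ * dirX d + c.m₁ * dirY d)) + N * quadForm v.2.2 (dirX d) (dirY d))
    (by
      rintro ⟨h0, h1, h2⟩
      rw [h0] at h1 h2
      refine h ⟨h0, ?_, ?_⟩
      · exact mul_left_cancel₀ hN0 (by linear_combination h1)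
      · exact mul_left_cancel₀ hN0 (by linear_combination h2))
  refine le_trans (le_of_eq ?_) this
  congr 2
  ext z
  rw [Finset.mem_filter_univ, Finset.mem_filter_univ]
  simp only [quartic, conic, Algebra.algebraMap_self, RingHom.id_apply]
  constructor <;> intro h <;> linear_combination h

theorem card_fibre_zeros_le_succ (v : (Fin 3 → K) × (Fin 2 → K) × (Fin 3 → K)) (d : Option K) :
    (Finset.univ.filter fun s : Option K => c.value v (d, s) = 0).card ≤ Fintype.card K + 1 := by
  rw [← Fintype.card_option]
  exact Finset.card_le_univ _

theorem card_zeros_value_le (hc : c.IsGeneral) (hq : 3 ≤ Fintype.card K)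
    {v : (Fin 3 → K) × (Fin 2 → K) × (Fin 3 → K)} (hv : v ≠ 0) :
    (Finset.univ.filter fun p => c.value v p = 0).card ≤ 3 * Fintype.card K + 3 := by
  rw [card_value_eq_zero]
  -- M indexes the fibres on which the section vanishes identically.
  set M := Finset.univ.filter fun d : Option K => quadForm v.1 (dirX d) (dirY d) = 0 ∧
    linForm v.2.1 (dirX d) (dirY d) = 0 ∧ quadForm v.2.2 (dirX d) (dirY d) = 0 with hM
  have hmem : ∀ d, d ∈ M ↔ quadForm v.1 (dirX d) (dirY d) = 0 ∧
    linForm v.2.1 (dirX d) (dirY d) = 0 ∧ quadForm v.2.2 (dirX d) (dirY d) = 0 := by simp [hM]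
  by_cases hM1 : M.card ≤ 1
  -- At most one full fibre: 2(q + 1) + (q - 1) = 3q + 1 zeros.
  · have h1 : ∑ d : Option K, (Finset.univ.filter fun s : Option K => c.value v (d, s) = 0).card ≤
        ∑ d : Option K, (2 + (Fintype.card K - 1) * (if d ∈ M then 1 else 0)) := by
      refine Finset.sum_le_sum fun d _ => ?_
      split_ifs with hd
      · have := card_fibre_zeros_le_succ (c := c) v d
        omega
      · have := card_fibre_zeros_le hc v d (fun h => hd ((hmem d).2 h))
        omega
    refine le_trans h1 ?_
    rw [Finset.sum_add_distrib, ← Finset.mul_sum, ← Finset.card_filter]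
    simp only [Finset.filter_univ_mem, Finset.sum_const, Finset.card_univ, Fintype.card_option,
      smul_eq_mul]
    have := Nat.mul_le_mul_left (Fintype.card K - 1) hM1
    omega
  · push Not at hM1
    obtain ⟨d, hd, d', hd', hne⟩ := Finset.one_lt_card.1 hM1
    have hd := (hmem d).1 hd
    have hd' := (hmem d').1 hd'
    have hb : v.2.1 = 0 := linForm_eq_zero hne hd.2.1 hd'.2.1
    have hb' : ∀ x y : K, linForm v.2.1 x y = 0 := by intro x y; simp [hb, linForm]
    by_cases ha : v.1 = 0
    -- The section is N·c: one zero per fibre on E and q more on each of at most two full fibres.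
    · have ha' : ∀ x y : K, quadForm v.1 x y = 0 := by intro x y; simp [ha, quadForm]
      have hc0 : v.2.2 ≠ 0 := fun h => hv (Prod.ext ha (Prod.ext hb h))
      have hM2 : M.card ≤ 2 := by
        refine le_trans (Finset.card_le_card fun d hd => ?_) (card_quadForm_zeros_le hc0)
        simpa using ((hmem d).1 hd).2.2
      have h1 : ∑ d : Option K, (Finset.univ.filter fun s : Option K => c.value v (d, s) = 0).card ≤
          ∑ d : Option K, (1 + Fintype.card K * (if d ∈ M then 1 else 0)) := by
        refine Finset.sum_le_sum fun d _ => ?_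
        split_ifs with hd
        · have := card_fibre_zeros_le_succ (c := c) v d
          omega
        · rw [card_fibre_zeros, if_pos (ha' _ _), Finset.card_eq_zero.2 ?_, mul_zero]
          rw [Finset.filter_eq_empty_iff]
          intro z _ hz
          simp only [quartic, ha', hb', zero_mul, zero_add, mul_eq_zero,
            normForm_dir_ne_zero hc d, false_or] at hz
          exact hd ((hmem d).2 ⟨ha' _ _, hb' _ _, hz⟩)
      refine le_trans h1 ?_
      rw [Finset.sum_add_distrib, ← Finset.mul_sum, ← Finset.card_filter]
      simp only [Finset.filter_univ_mem, Finset.sum_const, Finset.card_univ, Fintype.card_option,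
        smul_eq_mul]
      have := Nat.mul_le_mul_left (Fintype.card K) hM2
      omega
    -- The section is a·(Q + rN): at most two full fibres, and elsewhere the points of one conic of
    -- the pencil. This is the extremal case, 2(q + 1) + (q + 1).
    · obtain ⟨r, hr⟩ := quadForm_proportional hq hne ha hd.1 hd'.1 hd.2.2 hd'.2.2
      have hr' : ∀ x y : K, quadForm v.2.2 x y = r * quadForm v.1 x y := by
        intro x y
        simp only [hr, quadForm, Algebra.algebraMap_self, RingHom.id_apply, Pi.smul_apply,
          smul_eq_mul]
        ring
      have hM2 : M.card ≤ 2 := by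
        refine le_trans (Finset.card_le_card fun d hd => ?_) (card_quadForm_zeros_le ha)
        simpa using ((hmem d).1 hd).1
      have h1 : ∑ d : Option K, (Finset.univ.filter fun s : Option K => c.value v (d, s) = 0).card ≤
          ∑ d : Option K, (c.fibreCard r d + (Fintype.card K + 1) * (if d ∈ M then 1 else 0)) := by
        refine Finset.sum_le_sum fun d _ => ?_
        split_ifs with hd
        · have := card_fibre_zeros_le_succ (c := c) v d
          omega
        · have ha0 : quadForm v.1 (dirX d) (dirY d) ≠ 0 := fun h =>
            hd ((hmem d).2 ⟨h, hb' _ _, by rw [hr', h, mul_zero]⟩)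
          rw [card_fibre_zeros, if_neg ha0, zero_add, mul_zero, add_zero]
          refine Finset.card_le_card fun z hz => ?_
          simp only [Finset.mem_filter, Finset.mem_univ, true_and, quartic, hb', hr'] at hz ⊢
          exact mul_left_cancel₀ ha0 (by linear_combination hz)
      refine le_trans h1 ?_
      rw [Finset.sum_add_distrib, ← Finset.mul_sum, ← Finset.card_filter, sum_fibreCard_eq hc]
      simp only [Finset.filter_univ_mem]
      have := Nat.mul_le_mul_left (Fintype.card K + 1) hM2
      omega

/-- The extremal section is the product of a member of the pencil and two lines through (0:0:1)
external to it, so that the three sets of zeros are disjoint. -/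
theorem exists_card_zeros_value_eq (hc : c.IsGeneral) (hq : 3 ≤ Fintype.card K) :
    ∃ v : (Fin 3 → K) × (Fin 2 → K) × (Fin 3 → K), v ≠ 0 ∧
      (Finset.univ.filter fun p => c.value v p = 0).card = 3 * Fintype.card K + 3 := by
  obtain ⟨r, d, d', hne, hd, hd'⟩ := exists_two_external hc hq
  set a : Fin 3 → K := ![dirY d * dirY d', - (dirX d * dirY d' + dirY d * dirX d'),
    dirX d * dirX d'] with ha
  have hform : ∀ x y : K, quadForm a x y =
      (dirX d * y - dirY d * x) * (dirX d' * y - dirY d' * x) := by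
    intro x y
    simp only [quadForm, ha, Algebra.algebraMap_self, RingHom.id_apply, Matrix.cons_val]
    ring
  have hzero : ∀ e : Option K, quadForm a (dirX e) (dirY e) = 0 ↔ e = d ∨ e = d' := by
    intro e
    rw [hform, mul_eq_zero, sub_eq_zero, sub_eq_zero]
    constructor
    · rintro (h | h)
      · exact Or.inl (dir_eq h).symm
      · exact Or.inr (dir_eq h).symm
    · rintro (rfl | rfl)
      · exact Or.inl (mul_comm _ _)
      · exact Or.inr (mul_comm _ _)
  have hr' : ∀ x y : K, quadForm (r • a) x y = r * quadForm a x y := by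
    intro x y
    simp only [quadForm, Algebra.algebraMap_self, RingHom.id_apply, Pi.smul_apply, smul_eq_mul]
    ring
  have hval : ∀ x y z : K, c.quartic (a, 0, r • a) x y z =
      quadForm a x y * (c.conic x y z + r * c.normForm x y) := by
    intro x y z
    simp only [quartic, hr', linForm, Pi.zero_apply, map_zero]
    ring
  refine ⟨(a, 0, r • a), ?_, ?_⟩
  · intro h
    have ha0 : a = 0 := congrArg Prod.fst h
    have : (Finset.univ : Finset (Option K)) ⊆ {d, d'} := by
      intro e _
      rw [Finset.mem_insert, Finset.mem_singleton, ← hzero, ha0]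
      simp [quadForm]
    have := Finset.card_le_card this
    rw [Finset.card_univ, Fintype.card_option] at this
    have := this.trans Finset.card_le_two
    omega
  · rw [card_value_eq_zero]
    have h1 : ∀ e : Option K,
        (Finset.univ.filter fun s : Option K => c.value (a, 0, r • a) (e, s) = 0).card =
        c.fibreCard r e + (Fintype.card K + 1) * (if e ∈ ({d, d'} : Finset (Option K)) then 1 else 0) := by
      intro e
      rw [card_fibre_zeros]
      simp only [hval, hzero, Finset.mem_insert, Finset.mem_singleton]
      split_ifs with he
      · have h0 : quadForm a (dirX e) (dirY e) = 0 := (hzero e).2 he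
        have h2 : c.fibreCard r e = 0 := by rcases he with rfl | rfl <;> assumption
        simp only [h0, h2, zero_mul, Finset.filter_true, Finset.card_univ]
        ring
      · have h0 : quadForm a (dirX e) (dirY e) ≠ 0 := fun h => he ((hzero e).1 h)
        simp only [mul_eq_zero, h0, false_or, fibreCard]
        ring
    simp only [h1]
    rw [Finset.sum_add_distrib, ← Finset.mul_sum, ← Finset.card_filter, sum_fibreCard_eq hc]
    simp only [Finset.filter_univ_mem]
    rw [Finset.card_pair hne]
    ring

end ConicPencil

end FiniteField

end Pencil

/-! ### Frobenius and the normal form of the configuration -/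

section Frobenius

variable (K Ω : Type*) [Field K] [Finite K] [Field Ω] [Algebra K Ω]

/-- The `q`-power map of `Ω`, where `q = #K`. -/
def frobHom : Ω →ₐ[K] Ω :=
  letI := Fintype.ofFinite K
  FiniteField.frobeniusAlgHom K Ω

variable {K Ω}

/-- The q elements of K already exhaust the roots of X^q - X. -/
theorem mem_range_of_frobHom_eq {x : Ω} (h : frobHom K Ω x = x) : ∃ a : K, algebraMap K Ω a = x := by
  classical
  let _ := Fintype.ofFinite K
  have hx : x ^ Fintype.card K = x := h
  have hq : 1 < Fintype.card K := Fintype.one_lt_card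
  have hne : (Polynomial.X ^ Fintype.card K - Polynomial.X : Polynomial Ω) ≠ 0 :=
    FiniteField.X_pow_card_sub_X_ne_zero Ω hq
  have hsub : (Finset.univ.image (algebraMap K Ω)) ⊆
      (Polynomial.X ^ Fintype.card K - Polynomial.X : Polynomial Ω).roots.toFinset := by
    intro y hy
    obtain ⟨a, -, rfl⟩ := Finset.mem_image.1 hy
    rw [Multiset.mem_toFinset, Polynomial.mem_roots hne]
    simp [← map_pow, FiniteField.pow_card]
  have hcard : (Polynomial.X ^ Fintype.card K - Polynomial.X : Polynomial Ω).roots.toFinset.card ≤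
      (Finset.univ.image (algebraMap K Ω)).card := by
    rw [Finset.card_image_of_injective _ (algebraMap K Ω).injective, Finset.card_univ]
    refine (Multiset.toFinset_card_le _).trans ((Polynomial.card_roots' _).trans ?_)
    rw [FiniteField.X_pow_card_sub_X_natDegree_eq Ω hq]
  have hmem : x ∈ (Finset.univ.image (algebraMap K Ω)) := by
    rw [Finset.eq_of_subset_of_card_le hsub hcard, Multiset.mem_toFinset, Polynomial.mem_roots hne]
    simp [hx]
  obtain ⟨a, -, ha⟩ := Finset.mem_image.1 hmem
  exact ⟨a, ha⟩

/-! ### Elements of degree two and four over K, and the conics through their point -/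

section Pencil

variable {α β : Ω}

/-- The quotient (φx - x)/(φα - α) is fixed by φ and gives the coefficient of α; the difference x -
bα is then fixed as well. -/
theorem exists_eq_add_mul (hα : frobHom K Ω (frobHom K Ω α) = α) (hα' : frobHom K Ω α ≠ α)
    {x : Ω} (h : frobHom K Ω (frobHom K Ω x) = x) :
    ∃ a b : K, x = algebraMap K Ω a + algebraMap K Ω b * α := by
  have hne : frobHom K Ω α - α ≠ 0 := sub_ne_zero.2 hα'
  have hne' : α - frobHom K Ω α ≠ 0 := sub_ne_zero.2 hα'.symm
  obtain ⟨b, hb⟩ := mem_range_of_frobHom_eq (K := K)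
    (x := (frobHom K Ω x - x) / (frobHom K Ω α - α)) (by
      rw [map_div₀, map_sub, map_sub, h, hα, div_eq_div_iff hne' hne]
      ring)
  have hb' : algebraMap K Ω b * (frobHom K Ω α - α) = frobHom K Ω x - x := by
    rw [hb, div_mul_cancel₀ _ hne]
  obtain ⟨a, ha⟩ := mem_range_of_frobHom_eq (K := K) (x := x - algebraMap K Ω b * α) (by
    rw [map_sub, map_mul, AlgHom.commutes]
    linear_combination - hb')
  exact ⟨a, b, by rw [ha]; ring⟩

theorem add_mul_eq_zero (hα' : frobHom K Ω α ≠ α) {a b : K}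
    (h : algebraMap K Ω a + algebraMap K Ω b * α = 0) : a = 0 ∧ b = 0 := by
  have hb : b = 0 := by
    by_contra hb
    have hb' : algebraMap K Ω b ≠ 0 := (map_ne_zero _).2 hb
    apply hα'
    have h1 : algebraMap K Ω a + algebraMap K Ω b * frobHom K Ω α = 0 := by
      have := congrArg (frobHom K Ω) h
      simpa using this
    apply mul_left_cancel₀ hb'
    linear_combination h1 - h
  subst hb
  simp only [map_zero, zero_mul, add_zero, map_eq_zero] at h
  exact ⟨h, rfl⟩

theorem frobHom_frobHom_add_mul (hα : frobHom K Ω (frobHom K Ω α) = α) (a b : K) :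
    frobHom K Ω (frobHom K Ω (algebraMap K Ω a + algebraMap K Ω b * α)) =
      algebraMap K Ω a + algebraMap K Ω b * α := by
  simp [hα]

/-- The coefficients a₀ + a₁α and b₀ + b₁α are fixed by φ², while β is not; applying φ² and
subtracting kills the coefficient of β. -/
theorem add_mul_add_mul_eq_zero (hα : frobHom K Ω (frobHom K Ω α) = α) (hα' : frobHom K Ω α ≠ α)
    (hβ' : frobHom K Ω (frobHom K Ω β) ≠ β) {a₀ a₁ b₀ b₁ : K}
    (h : (algebraMap K Ω a₀ + algebraMap K Ω a₁ * α) +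
      (algebraMap K Ω b₀ + algebraMap K Ω b₁ * α) * β = 0) :
    a₀ = 0 ∧ a₁ = 0 ∧ b₀ = 0 ∧ b₁ = 0 := by
  have hb : algebraMap K Ω b₀ + algebraMap K Ω b₁ * α = 0 := by
    by_contra hb
    apply hβ'
    have h1 := congrArg (fun x => frobHom K Ω (frobHom K Ω x)) h
    simp only [map_zero] at h1
    rw [map_add, map_add, map_mul, map_mul, frobHom_frobHom_add_mul hα,
      frobHom_frobHom_add_mul hα] at h1
    apply mul_left_cancel₀ hb
    linear_combination h1 - h
  rw [hb, zero_mul, add_zero] at h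
  obtain ⟨h1, h2⟩ := add_mul_eq_zero hα' h
  obtain ⟨h3, h4⟩ := add_mul_eq_zero hα' hb
  exact ⟨h1, h2, h3, h4⟩

/-- The pencil of conics through the four conjugates of `(1 : α : β)`. -/
theorem exists_conicPencil (hα : frobHom K Ω (frobHom K Ω α) = α) (hα' : frobHom K Ω α ≠ α)
    (hβ : frobHom K Ω (frobHom K Ω (frobHom K Ω (frobHom K Ω β))) = β)
    (hβ' : frobHom K Ω (frobHom K Ω β) ≠ β) :
    ∃ c : ConicPencil K, c.IsGeneral ∧ c.normForm 1 α = 0 ∧ c.conic 1 α β = 0 := by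
  -- The trace t and norm n of α give the line pair. The conic comes from the minimal polynomial of
  -- β over K(α), whose coefficients -(β + φ²β) and β·φ²β are written in the basis 1, α.
  obtain ⟨t, ht⟩ := mem_range_of_frobHom_eq (K := K) (x := α + frobHom K Ω α) (by
    rw [map_add, hα, add_comm])
  obtain ⟨n, hn⟩ := mem_range_of_frobHom_eq (K := K) (x := α * frobHom K Ω α) (by
    rw [map_mul, hα, mul_comm])
  obtain ⟨l₀, l₁, hl⟩ := exists_eq_add_mul (K := K) hα hα' (x := - (β + frobHom K Ω (frobHom K Ω β)))
    (by rw [map_neg, map_neg, map_add, map_add, hβ, add_comm])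
  obtain ⟨m₀, m₁, hm⟩ := exists_eq_add_mul (K := K) hα hα' (x := β * frobHom K Ω (frobHom K Ω β))
    (by rw [map_mul, map_mul, hβ, mul_comm])
  have hN : (1 : Ω) * α ^ 2 - algebraMap K Ω t * α + algebraMap K Ω n = 0 := by rw [ht, hn]; ring
  have hQ : β ^ 2 + (algebraMap K Ω l₀ + algebraMap K Ω l₁ * α) * β +
      (algebraMap K Ω m₀ + algebraMap K Ω m₁ * α) = 0 := by rw [← hl, ← hm]; ring
  refine ⟨⟨t, n, l₀, l₁, m₀, m₁⟩, ⟨?_, ?_, ?_⟩, ?_, ?_⟩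
  · intro x y h
    simp only [ConicPencil.normForm, Algebra.algebraMap_self, RingHom.id_apply] at h
    have h' := congrArg (algebraMap K Ω) h
    simp only [map_add, map_sub, map_mul, map_pow, map_zero, ht, hn] at h'
    have hf : (algebraMap K Ω y - α * algebraMap K Ω x) *
        (algebraMap K Ω y - frobHom K Ω α * algebraMap K Ω x) = 0 := by linear_combination h'
    have hx : x = 0 := by
      rcases mul_eq_zero.1 hf with h1 | h1
      · have := add_mul_eq_zero (a := y) (b := -x) hα' (by rw [map_neg]; linear_combination h1)
        exact neg_eq_zero.1 this.2
      · have h2 := congrArg (frobHom K Ω) h1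
        rw [map_sub, map_mul, AlgHom.commutes, AlgHom.commutes, hα, map_zero] at h2
        have := add_mul_eq_zero (a := y) (b := -x) hα' (by rw [map_neg]; linear_combination h2)
        exact neg_eq_zero.1 this.2
    refine ⟨hx, ?_⟩
    subst hx
    have : y ^ 2 = 0 := by linear_combination h
    exact pow_eq_zero_iff two_ne_zero |>.1 this
  · rintro r e f ⟨h1, h2, h3⟩
    simp only at h1 h2 h3
    have h1' := congrArg (algebraMap K Ω) h1
    have h2' := congrArg (algebraMap K Ω) h2
    have h3' := congrArg (algebraMap K Ω) h3
    simp only [map_add, map_sub, map_mul, map_pow, map_zero, map_ofNat] at h1' h2' h3'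
    -- A member vanishing on z = ex + fy splits into two rational linear factors; evaluated at (1,
    -- α, β), one of them puts β in K + Kα, where φ² is trivial.
    have hf : (β - (algebraMap K Ω e + algebraMap K Ω f * α)) *
        (β + (algebraMap K Ω (e + l₀) + algebraMap K Ω (f + l₁) * α)) = 0 := by
      simp only [map_add]
      linear_combination hQ - h1' - α * h3' - α ^ 2 * h2' + algebraMap K Ω r * hN
    rcases mul_eq_zero.1 hf with h | h
    · apply hβ'
      rw [sub_eq_zero.1 h, frobHom_frobHom_add_mul hα]
    · apply hβ'
      rw [eq_neg_of_add_eq_zero_left h, map_neg, map_neg, frobHom_frobHom_add_mul hα]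
  · intro h2
    by_contra hcon
    push Not at hcon
    obtain ⟨h0, h1⟩ := hcon
    simp only at h0 h1
    rw [h0, h1, map_zero, zero_mul, add_zero] at hl
    -- With l₀ = l₁ = 0 one has β + φ²β = 0, which in characteristic 2 says φ²β = β.
    have h2' : (2 : Ω) = 0 := by rw [← map_ofNat (algebraMap K Ω) 2, h2, map_zero]
    apply hβ'
    linear_combination - hl - β * h2'
  · simp only [ConicPencil.normForm]; linear_combination hN
  · simp only [ConicPencil.conic]; linear_combination hQ

end Pencil

/-! ### Conjugates of points of the plane -/

theorem frob_iterate_mk (k : ℕ) (v : Fin 3 → Ω) (hv : v ≠ 0) :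
    ∃ h, (frob K Ω)^[k] (Projectivization.mk Ω v hv) =
      Projectivization.mk Ω (fun i => (frobHom K Ω)^[k] (v i)) h := by
  induction k with
  | zero => exact ⟨hv, rfl⟩
  | succ k ih =>
    obtain ⟨h, ih⟩ := ih
    have h' : (fun i => (frobHom K Ω)^[k + 1] (v i)) ≠ 0 := by
      intro h0
      apply h
      funext i
      have := congrFun h0 i
      simpa only [Function.iterate_succ_apply', Pi.zero_apply, map_eq_zero] using this
    refine ⟨h', ?_⟩
    rw [Function.iterate_succ_apply', ih]
    simp only [Function.iterate_succ_apply']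
    rfl

/-- Two coordinate vectors represent the same point exactly when their 2 × 2 minors vanish; this
form avoids choosing a scaling factor. -/
theorem frob_iterate_eq_iff (k : ℕ) (p : ℙ Ω (Fin 3 → Ω)) :
    (frob K Ω)^[k] p = p ↔
      ∀ i j, (frobHom K Ω)^[k] (p.rep i) * p.rep j = (frobHom K Ω)^[k] (p.rep j) * p.rep i := by
  obtain ⟨h, hk⟩ := frob_iterate_mk (K := K) k p.rep p.rep_nonzero
  rw [Projectivization.mk_rep] at hk
  have hiff : (frob K Ω)^[k] p = p ↔ ∃ a : Ω, a • p.rep = fun i => (frobHom K Ω)^[k] (p.rep i) := by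
    rw [← Projectivization.mk_eq_mk_iff' Ω _ _ h p.rep_nonzero, Projectivization.mk_rep, hk]
  rw [hiff]
  constructor
  · rintro ⟨a, ha⟩ i j
    have hi := congrFun ha i
    have hj := congrFun ha j
    simp only [Pi.smul_apply, smul_eq_mul] at hi hj
    rw [← hi, ← hj]; ring
  · intro hij
    obtain ⟨i, hi⟩ := Function.ne_iff.1 p.rep_nonzero
    refine ⟨(frobHom K Ω)^[k] (p.rep i) / p.rep i, ?_⟩
    funext j
    rw [Pi.zero_apply] at hi
    rw [Pi.smul_apply, smul_eq_mul, div_mul_eq_mul_div, div_eq_iff hi]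
    exact hij i j

theorem frobHom_iterate_add (k : ℕ) (x y : Ω) : (frobHom K Ω)^[k] (x + y) =
    (frobHom K Ω)^[k] x + (frobHom K Ω)^[k] y := by
  rw [← AlgHom.coe_pow, map_add]

theorem frobHom_iterate_mul (k : ℕ) (x y : Ω) : (frobHom K Ω)^[k] (x * y) =
    (frobHom K Ω)^[k] x * (frobHom K Ω)^[k] y := by
  rw [← AlgHom.coe_pow, map_mul]

theorem frobHom_iterate_algebraMap (k : ℕ) (a : K) :
    (frobHom K Ω)^[k] (algebraMap K Ω a) = algebraMap K Ω a := by
  rw [← AlgHom.coe_pow, AlgHom.commutes]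

theorem frob_iterate_eq_of_rep {k : ℕ} {p : ℙ Ω (Fin 3 → Ω)} {u : Ω} {w : Fin 3 → Ω}
    (h : ∀ i, p.rep i = u * w i) (hw : ∀ i, (frobHom K Ω)^[k] (w i) = w i) :
    (frob K Ω)^[k] p = p := by
  rw [frob_iterate_eq_iff]
  intro i j
  rw [h, h, frobHom_iterate_mul, frobHom_iterate_mul, hw, hw]
  ring

end Frobenius

/-! ### Linear change of coordinates to the normal form of P and R -/

section NormalForm

open MvPolynomial

variable {K Ω : Type*} [Field K] [Field Ω] [Algebra K Ω]

/-- The change of coordinates given by a permutation of the coordinates followed by the shear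
`x_j ↦ x_j - c_j x_2`. -/
def shearEquiv (e : Equiv.Perm (Fin 3)) (c : Fin 3 → K) (hc : c 2 = 0) :
    MvPolynomial (Fin 3) K ≃ₐ[K] MvPolynomial (Fin 3) K :=
  AlgEquiv.ofAlgHom (aeval fun j => X (e j) - C (c j) * X (e 2))
    (aeval fun i => X (e.symm i) + C (c (e.symm i)) * X 2)
    (by
      ext i : 1
      simp [hc, algebraMap_eq])
    (by
      ext i : 1
      simp [hc])

theorem aeval_shearEquiv_X (e : Equiv.Perm (Fin 3)) (c : Fin 3 → K) (hc : c 2 = 0) (v : Fin 3 → Ω)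
    (j : Fin 3) : aeval v (shearEquiv e c hc (X j)) = v (e j) - algebraMap K Ω (c j) * v (e 2) := by
  simp [shearEquiv]

theorem shearEquiv_homog (e : Equiv.Perm (Fin 3)) (c : Fin 3 → K) (hc : c 2 = 0) (j : Fin 3) :
    (shearEquiv e c hc (X j)).IsHomogeneous 1 := by
  simp only [shearEquiv, AlgEquiv.ofAlgHom_apply, aeval_X]
  exact (isHomogeneous_X _ _).sub (isHomogeneous_C_mul_X _ _)

theorem shearEquiv_symm_homog (e : Equiv.Perm (Fin 3)) (c : Fin 3 → K) (hc : c 2 = 0) (j : Fin 3) :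
    ((shearEquiv e c hc).symm (X j)).IsHomogeneous 1 := by
  simp only [shearEquiv, AlgEquiv.ofAlgHom_symm_apply, aeval_X]
  exact (isHomogeneous_X _ _).add (isHomogeneous_C_mul_X _ _)

/-- The linear change of coordinates `T`, the pencil `c` and the coordinates `α`, `β` bring `P` and
`R` to the form `(0 : 0 : 1)` and `(1 : α : β)`. -/
structure IsNormalized (P R : ℙ Ω (Fin 3 → Ω))
    (T : MvPolynomial (Fin 3) K ≃ₐ[K] MvPolynomial (Fin 3) K) (c : ConicPencil K) (α β : Ω) :
    Prop where
  homog : ∀ i, (T (X i)).IsHomogeneous 1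
  homog_symm : ∀ i, (T.symm (X i)).IsHomogeneous 1
  general : c.IsGeneral
  aeval_P : ∃ u : Ω, u ≠ 0 ∧ ∀ i, aeval P.rep (T (X i)) = u * ![0, 0, 1] i
  aeval_R : ∃ u : Ω, u ≠ 0 ∧ ∀ i, aeval R.rep (T (X i)) = u * ![1, α, β] i
  normForm_eq : c.normForm 1 α = 0
  conic_eq : c.conic 1 α β = 0
  indep : ∀ a₀ a₁ b₀ b₁ : K, (algebraMap K Ω a₀ + algebraMap K Ω a₁ * α) +
      (algebraMap K Ω b₀ + algebraMap K Ω b₁ * α) * β = 0 → a₀ = 0 ∧ a₁ = 0 ∧ b₀ = 0 ∧ b₁ = 0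

theorem dotProduct_rep_eq_zero {l p : ℙ Ω (Fin 3 → Ω)} (h : Projectivization.orthogonal l p) :
    l.rep ⬝ᵥ p.rep = 0 := by
  have : Projectivization.orthogonal (Projectivization.mk Ω l.rep l.rep_nonzero)
      (Projectivization.mk Ω p.rep p.rep_nonzero) := by
    rwa [Projectivization.mk_rep, Projectivization.mk_rep]
  rwa [Projectivization.orthogonal_mk] at this

variable [Finite K]

theorem exists_isNormalized_of_orthogonal (P R l : ℙ Ω (Fin 3 → Ω))
    (hP : closedPointDegree K Ω P = 1) (hl : Function.minimalPeriod (frob K Ω) l = 2)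
    (hPl : Projectivization.orthogonal l P) (hR : closedPointDegree K Ω R = 4)
    (hRl : Projectivization.orthogonal l R) :
    ∃ T c α β, IsNormalized (K := K) P R T c α β := by
  have hPfix : (frob K Ω)^[1] P = P := by
    rw [← hP]; exact Function.iterate_minimalPeriod
  have hPfix := (frob_iterate_eq_iff 1 P).1 hPfix
  obtain ⟨i₀, hi₀⟩ := Function.ne_iff.1 P.rep_nonzero
  rw [Pi.zero_apply] at hi₀
  -- A nonzero coordinate of P is moved to the last place; the ratios c of the others to it lie in K
  -- because P is rational, and the shear by them sends P to (0:0:1).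
  set e : Equiv.Perm (Fin 3) := Equiv.swap 2 i₀ with he
  have he2 : e 2 = i₀ := Equiv.swap_apply_left _ _
  rw [← he2] at hi₀
  have hex : ∀ j : Fin 3, ∃ a : K, algebraMap K Ω a = if j = 2 then 0 else P.rep (e j) / P.rep (e 2) := by
    intro j
    split_ifs with hj
    · exact ⟨0, map_zero _⟩
    · apply mem_range_of_frobHom_eq
      rw [map_div₀, div_eq_div_iff ((map_ne_zero _).2 hi₀) hi₀]
      exact (hPfix (e j) (e 2)).trans (mul_comm _ _)
  choose c hc using hex
  have hc2 : c 2 = 0 := by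
    have := hc 2
    rwa [if_pos rfl, map_eq_zero] at this
  have hcj : ∀ j, j ≠ 2 → P.rep (e j) = algebraMap K Ω (c j) * P.rep (e 2) := by
    intro j hj
    rw [hc j, if_neg hj, div_mul_cancel₀ _ hi₀]
  have hc0 := hcj 0 (by decide)
  have hc1 := hcj 1 (by decide)
  have hsum : ∀ f : Fin 3 → Ω, ∑ i, f i = f (e 0) + f (e 1) + f (e 2) := by
    intro f
    rw [← Equiv.sum_comp e f, Fin.sum_univ_three]
  set A := l.rep (e 0) with hA
  set B := l.rep (e 1) with hB
  have hlP := dotProduct_rep_eq_zero hPl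
  have hlR := dotProduct_rep_eq_zero hRl
  rw [dotProduct, hsum] at hlP hlR
  -- As l passes through P, its equation in the new coordinates is Ax + By = 0.
  have hC : l.rep (e 2) = - (A * algebraMap K Ω (c 0) + B * algebraMap K Ω (c 1)) := by
    apply mul_right_cancel₀ hi₀
    linear_combination hlP - A * hc0 - B * hc1
  set v := R.rep with hv
  set x := v (e 0) - algebraMap K Ω (c 0) * v (e 2) with hx
  set y := v (e 1) - algebraMap K Ω (c 1) * v (e 2) with hy
  have hAB : A * x + B * y = 0 := by
    rw [hC] at hlR
    linear_combination hlR
  have hl2 : (frob K Ω)^[2] l = l := by rw [← hl]; exact Function.iterate_minimalPeriod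
  have hl2 : frobHom K Ω (frobHom K Ω A) * B = frobHom K Ω (frobHom K Ω B) * A :=
    (frob_iterate_eq_iff 2 l).1 hl2 _ _
  -- The third coefficient of l is a K-combination of A and B, so a rational ratio A : B would make
  -- l itself rational.
  have hl1 : frobHom K Ω A * B ≠ frobHom K Ω B * A := by
    intro h
    have h1 : (frob K Ω)^[1] l = l := by
      rw [frob_iterate_eq_iff]
      have hφ : frobHom K Ω (l.rep (e 2)) = - (frobHom K Ω A * algebraMap K Ω (c 0) +
          frobHom K Ω B * algebraMap K Ω (c 1)) := by
        rw [hC]; simp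
      have h02 : frobHom K Ω (l.rep (e 0)) * l.rep (e 2) =
          frobHom K Ω (l.rep (e 2)) * l.rep (e 0) := by
        rw [hφ, hC]; linear_combination - algebraMap K Ω (c 1) * h
      have h12 : frobHom K Ω (l.rep (e 1)) * l.rep (e 2) =
          frobHom K Ω (l.rep (e 2)) * l.rep (e 1) := by
        rw [hφ, hC]; linear_combination algebraMap K Ω (c 0) * h
      have hall : ∀ i j, frobHom K Ω (l.rep (e i)) * l.rep (e j) =
          frobHom K Ω (l.rep (e j)) * l.rep (e i) := by
        intro i j
        fin_cases i <;> fin_cases j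
        exacts [rfl, h, h02, h.symm, rfl, h12, h02.symm, h12.symm, rfl]
      intro i j
      obtain ⟨i, rfl⟩ := e.surjective i
      obtain ⟨j, rfl⟩ := e.surjective j
      exact hall i j
    have := Function.IsPeriodicPt.minimalPeriod_le one_pos h1
    omega
  have hB0 : B ≠ 0 := fun h => hl1 (by rw [h]; simp)
  -- Otherwise x = y = 0 and R would coincide with the rational point P.
  have hx0 : x ≠ 0 := by
    intro h
    have hy0 : y = 0 := by
      rw [h, mul_zero, zero_add] at hAB
      exact (mul_eq_zero.1 hAB).resolve_left hB0
    have h1 : (frob K Ω)^[1] R = R := by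
      refine frob_iterate_eq_of_rep (u := v (e 2))
        (w := fun i => algebraMap K Ω (![c 0, c 1, 1] (e.symm i))) ?_
        (fun i => frobHom_iterate_algebraMap 1 _)
      intro i
      obtain ⟨j, rfl⟩ := e.surjective i
      simp only [Equiv.symm_apply_apply]
      fin_cases j
      · simp; linear_combination h
      · simp; linear_combination hy0
      · simp [hv]
    have := Function.IsPeriodicPt.minimalPeriod_le one_pos h1
    have hR' : Function.minimalPeriod (frob K Ω) R = 4 := hR
    omega
  have hα : y / x = - A / B := by
    rw [div_eq_div_iff hx0 hB0]; linear_combination hAB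
  have hφB : frobHom K Ω B ≠ 0 := (map_ne_zero _).2 hB0
  have hα2 : frobHom K Ω (frobHom K Ω (y / x)) = y / x := by
    rw [hα, map_div₀, map_div₀, map_neg, map_neg, div_eq_div_iff ((map_ne_zero _).2 hφB) hB0]
    linear_combination - hl2
  have hα1 : frobHom K Ω (y / x) ≠ y / x := by
    rw [hα, map_div₀, map_neg, Ne, div_eq_div_iff hφB hB0]
    intro h
    apply hl1
    linear_combination - h
  set α := y / x with hαd
  set β := v (e 2) / x with hβd
  have hβ4 : frobHom K Ω (frobHom K Ω (frobHom K Ω (frobHom K Ω β))) = β := by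
    have h4 : (frob K Ω)^[4] R = R := by
      have hR' : Function.minimalPeriod (frob K Ω) R = 4 := hR
      rw [← hR']; exact Function.iterate_minimalPeriod
    have h4 := (frob_iterate_eq_iff 4 R).1 h4 (e 2) (e 0)
    change (frobHom K Ω)^[4] β = β
    have hβx : β * x = v (e 2) := div_mul_cancel₀ _ hx0
    have hφ := congrArg (frobHom K Ω)^[4] hβx
    rw [frobHom_iterate_mul] at hφ
    have hφx : (frobHom K Ω)^[4] x = (frobHom K Ω)^[4] (v (e 0)) -
        algebraMap K Ω (c 0) * (frobHom K Ω)^[4] (v (e 2)) := by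
      have : v (e 0) = x + algebraMap K Ω (c 0) * v (e 2) := by rw [hx]; ring
      rw [this, frobHom_iterate_add, frobHom_iterate_mul, frobHom_iterate_algebraMap]
      ring
    have hφx0 : (frobHom K Ω)^[4] x ≠ 0 := by
      rw [← AlgHom.coe_pow]; exact (map_ne_zero _).2 hx0
    apply mul_right_cancel₀ hφx0
    apply mul_right_cancel₀ hx0
    rw [hφ, mul_right_comm, hβx, hφx, hx]
    linear_combination h4
  -- Otherwise (1 : α : β), hence R, would be fixed by φ², contradicting degree 4.
  have hβ2 : frobHom K Ω (frobHom K Ω β) ≠ β := by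
    intro h
    have h1 : (frob K Ω)^[2] R = R := by
      refine frob_iterate_eq_of_rep (u := x) (w := fun i => ![1, α, β] (e.symm i) +
        algebraMap K Ω (c (e.symm i)) * β) ?_ ?_
      · intro i
        obtain ⟨j, rfl⟩ := e.surjective i
        simp only [Equiv.symm_apply_apply]
        fin_cases j
        · simp [hβd]; field_simp; rw [hx]; ring
        · simp [hβd, hαd]; field_simp; rw [hy]; ring
        · simp [hβd, hc2]; field_simp; rfl
      · intro i
        rw [frobHom_iterate_add, frobHom_iterate_mul, frobHom_iterate_algebraMap]
        have hβ' : (frobHom K Ω)^[2] β = β := h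
        have hα' : (frobHom K Ω)^[2] α = α := hα2
        have h1' : (frobHom K Ω)^[2] 1 = 1 := by rw [← AlgHom.coe_pow, map_one]
        rw [hβ']
        congr 1
        generalize e.symm i = j
        fin_cases j
        exacts [h1', hα', hβ']
    have := Function.IsPeriodicPt.minimalPeriod_le two_pos h1
    have hR' : Function.minimalPeriod (frob K Ω) R = 4 := hR
    omega
  obtain ⟨cp, hg, hn, hq⟩ := exists_conicPencil hα2 hα1 hβ4 hβ2
  refine ⟨shearEquiv e c hc2, cp, α, β, shearEquiv_homog e c hc2, shearEquiv_symm_homog e c hc2, hg,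
    ⟨P.rep (e 2), hi₀, ?_⟩, ⟨x, hx0, ?_⟩, hn, hq,
    fun a₀ a₁ b₀ b₁ h => add_mul_add_mul_eq_zero hα2 hα1 hβ2 h⟩
  · intro j
    rw [aeval_shearEquiv_X]
    fin_cases j
    · simp; linear_combination hc0
    · simp; linear_combination hc1
    · simp [hc2]
  · intro j
    rw [aeval_shearEquiv_X]
    fin_cases j
    · simp [hx, hv]
    · simp only [hαd]; simp; field_simp; rfl
    · simp [hc2, hβd]; field_simp; rfl

/-- The two conjugate lines play symmetric roles: if R lies on the image of l under `frob`, that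
line, which has the same period, replaces l. -/
theorem exists_isNormalized (P R l : ℙ Ω (Fin 3 → Ω))
    (hP : closedPointDegree K Ω P = 1) (hl : Function.minimalPeriod (frob K Ω) l = 2)
    (hPl : Projectivization.orthogonal l P ∧ Projectivization.orthogonal (frob K Ω l) P)
    (hR : closedPointDegree K Ω R = 4)
    (hRl : Projectivization.orthogonal l R ∨ Projectivization.orthogonal (frob K Ω l) R) :
    ∃ T c α β, IsNormalized (K := K) P R T c α β := by
  rcases hRl with h | h
  · exact exists_isNormalized_of_orthogonal P R l hP hl hPl.1 hR h
  · refine exists_isNormalized_of_orthogonal P R (frob K Ω l) hP ?_ hPl.2 hR h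
    rw [Function.minimalPeriod_apply, hl]
    rw [← Function.minimalPeriod_pos_iff_mem_periodicPts, hl]
    exact two_pos

end NormalForm

/-! ### Local rings with rational residue field inside a field -/

/-- A local subring of a field with its residue map to `K`. -/
structure PointRing (K F : Type*) [Field K] [Field F] [Algebra K F] where
  ring : Subalgebra K F
  res : ring →ₐ[K] K
  inv_mem : ∀ a : ring, res a ≠ 0 → (a : F)⁻¹ ∈ ring

namespace PointRing

variable {K F : Type*} [Field K] [Field F] [Algebra K F] (A : PointRing K F)

/-- `z` is regular at the point and has the value `c` there. -/
def HasValue (z : F) (c : K) : Prop := ∃ h : z ∈ A.ring, A.res ⟨z, h⟩ = c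

variable {A} {z w : F} {c d : K}

theorem HasValue.mem (h : A.HasValue z c) : z ∈ A.ring := h.1

theorem exists_hasValue (h : z ∈ A.ring) : ∃ c, A.HasValue z c := ⟨_, h, rfl⟩

theorem HasValue.unique (h : A.HasValue z c) (h' : A.HasValue z d) : c = d :=
  h.2.symm.trans h'.2

theorem hasValue_algebraMap (c : K) : A.HasValue (algebraMap K F c) c :=
  ⟨A.ring.algebraMap_mem c, A.res.commutes c⟩

theorem hasValue_one : A.HasValue 1 1 := by
  simpa using hasValue_algebraMap (A := A) 1

theorem HasValue.add (h : A.HasValue z c) (h' : A.HasValue w d) : A.HasValue (z + w) (c + d) := by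
  obtain ⟨h, rfl⟩ := h
  obtain ⟨h', rfl⟩ := h'
  exact ⟨A.ring.add_mem h h', map_add A.res ⟨z, h⟩ ⟨w, h'⟩⟩

theorem HasValue.sub (h : A.HasValue z c) (h' : A.HasValue w d) : A.HasValue (z - w) (c - d) := by
  obtain ⟨h, rfl⟩ := h
  obtain ⟨h', rfl⟩ := h'
  exact ⟨A.ring.sub_mem h h', map_sub A.res ⟨z, h⟩ ⟨w, h'⟩⟩

theorem HasValue.mul (h : A.HasValue z c) (h' : A.HasValue w d) : A.HasValue (z * w) (c * d) := by
  obtain ⟨h, rfl⟩ := h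
  obtain ⟨h', rfl⟩ := h'
  exact ⟨A.ring.mul_mem h h', map_mul A.res ⟨z, h⟩ ⟨w, h'⟩⟩

theorem HasValue.pow (h : A.HasValue z c) (n : ℕ) : A.HasValue (z ^ n) (c ^ n) := by
  obtain ⟨h, rfl⟩ := h
  exact ⟨A.ring.pow_mem h n, map_pow A.res ⟨z, h⟩ n⟩

theorem HasValue.ne_zero (h : A.HasValue z c) (hc : c ≠ 0) : z ≠ 0 := by
  rintro rfl
  apply hc
  refine h.unique ?_
  simpa using hasValue_algebraMap (A := A) 0

theorem HasValue.inv (h : A.HasValue z c) (hc : c ≠ 0) : A.HasValue z⁻¹ c⁻¹ := by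
  have hz := h.ne_zero hc
  obtain ⟨hm, rfl⟩ := h
  obtain ⟨d, hd⟩ := exists_hasValue (A.inv_mem ⟨z, hm⟩ hc)
  have h1 : A.HasValue (z * z⁻¹) (A.res ⟨z, hm⟩ * d) := HasValue.mul ⟨hm, rfl⟩ hd
  rw [mul_inv_cancel₀ hz] at h1
  have h2 := h1.unique hasValue_one
  rw [eq_inv_of_mul_eq_one_right h2] at hd
  exact hd

theorem HasValue.div (h : A.HasValue z c) (h' : A.HasValue w d) (hd : d ≠ 0) :
    A.HasValue (z / w) (c / d) := by
  rw [div_eq_mul_inv, div_eq_mul_inv]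
  exact h.mul (h'.inv hd)

theorem HasValue.ne_zero_of_inv_mem (h : A.HasValue z c) (hz : z ≠ 0) (h' : z⁻¹ ∈ A.ring) :
    c ≠ 0 := by
  rintro rfl
  obtain ⟨d, hd⟩ := exists_hasValue h'
  have h1 := h.mul hd
  rw [mul_inv_cancel₀ hz, zero_mul] at h1
  exact zero_ne_one (h1.unique hasValue_one)

theorem hasValue_aeval {σ : Type*} {x : σ → F} {p : σ → K} (h : ∀ i, A.HasValue (x i) (p i))
    (f : MvPolynomial σ K) : A.HasValue (MvPolynomial.aeval x f) (MvPolynomial.aeval p f) := by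
  induction f using MvPolynomial.induction_on with
  | C a =>
    rw [MvPolynomial.aeval_C, MvPolynomial.aeval_C]
    exact hasValue_algebraMap a
  | add f g hf hg => rw [map_add, map_add]; exact hf.add hg
  | mul_X f i hf =>
    rw [map_mul, map_mul, MvPolynomial.aeval_X, MvPolynomial.aeval_X]
    exact hf.mul (h i)

/-- A local subalgebra whose residue field is `K`. -/
def ofLocal (O : Subalgebra K F) [IsLocalRing O]
    (h : Function.Surjective (algebraMap K (IsLocalRing.ResidueField O))) : PointRing K F where
  ring := O
  res := (AlgEquiv.ofBijective (Algebra.ofId K (IsLocalRing.ResidueField O))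
    ⟨(algebraMap K (IsLocalRing.ResidueField O)).injective, h⟩).symm.toAlgHom.comp
      (IsScalarTower.toAlgHom K O (IsLocalRing.ResidueField O))
  inv_mem a ha := by
    have hu : IsUnit a := by
      by_contra hu
      apply ha
      have : IsLocalRing.residue O a = 0 := (IsLocalRing.residue_eq_zero_iff a).2 hu
      change (AlgEquiv.ofBijective (Algebra.ofId K (IsLocalRing.ResidueField O))
        ⟨(algebraMap K (IsLocalRing.ResidueField O)).injective, h⟩).symm
        (IsLocalRing.residue O a) = 0
      rw [this, map_zero]
    obtain ⟨b, hb⟩ := hu.exists_right_inv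
    have : (a : F)⁻¹ = b := inv_eq_of_mul_eq_one_right (congrArg Subtype.val hb)
    rw [this]
    exact b.2

variable (A) in
theorem isUnit_iff (a : A.ring) : IsUnit a ↔ A.res a ≠ 0 := by
  constructor
  · intro h
    exact (h.map A.res).ne_zero
  · intro h
    have h0 : (a : F) ≠ 0 := HasValue.ne_zero (A := A) (c := A.res a) ⟨a.2, rfl⟩ h
    exact IsUnit.of_mul_eq_one ⟨(a : F)⁻¹, A.inv_mem a h⟩ (Subtype.ext (mul_inv_cancel₀ h0))

/-! ### The local ring at the origin of an affine plane inside a field -/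

section Origin

variable {t : Fin 2 → F} (ht : AlgebraicIndependent K t)

/-- The value at the origin of a polynomial in the coordinates `t`. -/
def originHom : Algebra.adjoin K (Set.range t) →ₐ[K] K :=
  (MvPolynomial.aeval (0 : Fin 2 → K)).comp ht.aevalEquiv.symm.toAlgHom

instance : (RingHom.ker (originHom ht)).IsPrime := RingHom.ker_isPrime _

theorem originHom_aeval (f : MvPolynomial (Fin 2) K) :
    originHom ht (ht.aevalEquiv f) = MvPolynomial.aeval (0 : Fin 2 → K) f := by
  simp [originHom]

theorem coe_aevalEquiv (f : MvPolynomial (Fin 2) K) :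
    ((ht.aevalEquiv f : Algebra.adjoin K (Set.range t)) : F) = MvPolynomial.aeval t f := by
  rw [AlgebraicIndependent.algebraMap_aevalEquiv ht f |>.symm]
  rfl

theorem mem_localizationAt_origin {z : F} :
    z ∈ localizationAt (Algebra.adjoin K (Set.range t)) (RingHom.ker (originHom ht)) ↔
      ∃ f g : MvPolynomial (Fin 2) K, MvPolynomial.aeval (0 : Fin 2 → K) g ≠ 0 ∧
        z = MvPolynomial.aeval t f / MvPolynomial.aeval t g := by
  constructor
  · rintro ⟨a, s, hs, rfl⟩
    obtain ⟨f, rfl⟩ := ht.aevalEquiv.surjective a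
    obtain ⟨g, rfl⟩ := ht.aevalEquiv.surjective s
    refine ⟨f, g, ?_, by rw [coe_aevalEquiv, coe_aevalEquiv]⟩
    rwa [RingHom.mem_ker, originHom_aeval] at hs
  · rintro ⟨f, g, hg, rfl⟩
    refine ⟨ht.aevalEquiv f, ht.aevalEquiv g, ?_, by rw [coe_aevalEquiv, coe_aevalEquiv]⟩
    rwa [RingHom.mem_ker, originHom_aeval]

include ht in
theorem aeval_ne_zero {g : MvPolynomial (Fin 2) K} (hg : MvPolynomial.aeval (0 : Fin 2 → K) g ≠ 0) :
    MvPolynomial.aeval t g ≠ 0 := by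
  intro h
  have : g = 0 := ht (by rw [h, map_zero])
  rw [this, map_zero] at hg
  exact hg rfl

instance : IsLocalRing (localizationAt (Algebra.adjoin K (Set.range t)) (RingHom.ker (originHom ht))) :=
  isLocalRing_localizationAt _ _

/-- By algebraic independence, an inverse yields an identity ff' = gg' of polynomials, which fails
at the origin. -/
theorem not_isUnit_localizationAt_origin {f g : MvPolynomial (Fin 2) K}
    (hf : MvPolynomial.aeval (0 : Fin 2 → K) f = 0) (hg : MvPolynomial.aeval (0 : Fin 2 → K) g ≠ 0)
    (x : localizationAt (Algebra.adjoin K (Set.range t)) (RingHom.ker (originHom ht)))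
    (hx : (x : F) = MvPolynomial.aeval t f / MvPolynomial.aeval t g) : ¬ IsUnit x := by
  intro hu
  obtain ⟨⟨y, hy⟩, hxy⟩ := hu.exists_right_inv
  obtain ⟨f', g', hg', rfl⟩ := (mem_localizationAt_origin ht).1 hy
  have h1 := congrArg Subtype.val hxy
  change (x : F) * (MvPolynomial.aeval t f' / MvPolynomial.aeval t g') = 1 at h1
  rw [hx, div_mul_div_comm, div_eq_one_iff_eq (mul_ne_zero (aeval_ne_zero ht hg)
    (aeval_ne_zero ht hg')), ← map_mul, ← map_mul] at h1
  have h2 := congrArg (MvPolynomial.aeval (0 : Fin 2 → K)) (ht h1)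
  rw [map_mul, map_mul, hf, zero_mul] at h2
  exact mul_ne_zero hg hg' h2.symm

theorem surjective_residue_origin : Function.Surjective (algebraMap K (IsLocalRing.ResidueField
    (localizationAt (Algebra.adjoin K (Set.range t)) (RingHom.ker (originHom ht))))) := by
  intro r
  obtain ⟨⟨z, hz⟩, rfl⟩ := IsLocalRing.residue_surjective r
  obtain ⟨f, g, hg, rfl⟩ := (mem_localizationAt_origin ht).1 hz
  set a := MvPolynomial.aeval (0 : Fin 2 → K) f with ha
  set b := MvPolynomial.aeval (0 : Fin 2 → K) g with hb
  refine ⟨a / b, ?_⟩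
  change IsLocalRing.residue _ (algebraMap K (localizationAt (Algebra.adjoin K (Set.range t))
    (RingHom.ker (originHom ht))) (a / b)) = _
  rw [← sub_eq_zero, ← map_sub, IsLocalRing.residue_eq_zero_iff, IsLocalRing.mem_maximalIdeal]
  refine not_isUnit_localizationAt_origin ht (f := MvPolynomial.C a * g - MvPolynomial.C b * f)
    (g := MvPolynomial.C b * g) ?_ ?_ _ ?_
  · rw [map_sub, map_mul, map_mul, MvPolynomial.aeval_C, MvPolynomial.aeval_C, ← ha, ← hb]
    exact sub_eq_zero.2 (mul_comm _ _)
  · rw [map_mul, MvPolynomial.aeval_C, ← hb]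
    exact mul_ne_zero hg hg
  · have h1 := aeval_ne_zero ht hg
    have h2 : algebraMap K F b ≠ 0 := (map_ne_zero _).2 hg
    change algebraMap K F (a / b) - MvPolynomial.aeval t f / MvPolynomial.aeval t g = _
    simp only [map_sub, map_mul, MvPolynomial.aeval_C, map_div₀]
    field_simp

/-- The local ring at the origin of the affine plane with coordinates `t`. -/
def origin : PointRing K F :=
  ofLocal (localizationAt (Algebra.adjoin K (Set.range t)) (RingHom.ker (originHom ht)))
    (surjective_residue_origin ht)

theorem mem_origin {z : F} : z ∈ (origin ht).ring ↔
    ∃ f g : MvPolynomial (Fin 2) K, MvPolynomial.aeval (0 : Fin 2 → K) g ≠ 0 ∧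
      z = MvPolynomial.aeval t f / MvPolynomial.aeval t g :=
  mem_localizationAt_origin ht

theorem origin_hasValue (i : Fin 2) : (origin ht).HasValue (t i) 0 := by
  have hmem : t i ∈ (origin ht).ring := (mem_origin ht).2 ⟨MvPolynomial.X i, 1, by simp, by simp⟩
  refine ⟨hmem, ?_⟩
  by_contra h
  exact not_isUnit_localizationAt_origin ht (f := MvPolynomial.X i) (g := 1) (by simp) (by simp)
    ⟨t i, hmem⟩ (by simp) (((origin ht).isUnit_iff ⟨t i, hmem⟩).2 h)

theorem origin_le {L : Subalgebra K F} (h : ∀ i, t i ∈ L)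
    (h' : ∀ z ∈ L, ∀ c ≠ 0, (origin ht).HasValue z c → z⁻¹ ∈ L) : (origin ht).ring ≤ L := by
  intro z hz
  obtain ⟨f, g, hg, rfl⟩ := (mem_origin ht).1 hz
  have hL : ∀ f : MvPolynomial (Fin 2) K, MvPolynomial.aeval t f ∈ L := by
    intro f
    induction f using MvPolynomial.induction_on with
    | C a => rw [MvPolynomial.aeval_C]; exact L.algebraMap_mem a
    | add f g hf hg => rw [map_add]; exact L.add_mem hf hg
    | mul_X f i hf => rw [map_mul, MvPolynomial.aeval_X]; exact L.mul_mem hf (h i)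
  rw [div_eq_mul_inv]
  exact L.mul_mem (hL f) (h' _ (hL g) _ hg (hasValue_aeval (p := 0) (origin_hasValue ht) g))

/-- Domination: an element regular at the origin is a quotient of polynomials in t with denominator
nonzero at 0, so its value anywhere t vanishes is already decided. -/
theorem HasValue.of_origin (h : ∀ i, A.HasValue (t i) 0) (hz : (origin ht).HasValue z c) :
    A.HasValue z c := by
  obtain ⟨f, g, hg, rfl⟩ := (mem_origin ht).1 hz.mem
  have h1 := (hasValue_aeval (p := 0) (origin_hasValue ht) f).div
    (hasValue_aeval (p := 0) (origin_hasValue ht) g) hg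
  rw [hz.unique h1]
  exact (hasValue_aeval (p := 0) h f).div (hasValue_aeval (p := 0) h g) hg

/-- A localization that dominates the local ring at the origin and comes from a smaller chart is
equal to it. -/
theorem eq_origin (h : ∀ i, A.HasValue (t i) 0) {C : Subalgebra K F} (hC : C ≤ (origin ht).ring)
    {𝔭 : Ideal C} [𝔭.IsPrime] (hA : A.ring = localizationAt C 𝔭) : A.ring = (origin ht).ring := by
  apply le_antisymm
  · intro z hz
    rw [hA] at hz
    obtain ⟨a, s, hs, rfl⟩ := hz
    obtain ⟨c, hc⟩ := exists_hasValue (hC s.2)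
    have hs0 : (s : F) ≠ 0 := by
      intro h0
      apply hs
      rw [show s = 0 from Subtype.ext h0]
      exact 𝔭.zero_mem
    have hinv : (s : F)⁻¹ ∈ A.ring := by
      rw [hA]
      exact ⟨1, s, hs, by simp⟩
    -- The value of s at the origin is also its value in A, where s is a unit; hence s is invertible
    -- at the origin too.
    have hc0 : c ≠ 0 := (hc.of_origin ht h).ne_zero_of_inv_mem hs0 hinv
    rw [div_eq_mul_inv]
    exact (origin ht).ring.mul_mem (hC a.2) (hc.inv hc0).mem
  · intro z hz
    obtain ⟨c, hc⟩ := exists_hasValue hz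
    exact (hc.of_origin ht h).mem

/-- A chart contained in the local ring at the origin has it as a local ring if the coordinates are
fractions of the chart. -/
theorem exists_origin_eq {C : Subalgebra K F} (hC : C ≤ (origin ht).ring)
    (h : ∀ i, ∃ a ∈ C, ∃ s ∈ C, ∃ c ≠ 0, (origin ht).HasValue s c ∧ t i = a / s) :
    ∃ (𝔭 : Ideal C) (_ : 𝔭.IsPrime), (origin ht).ring = localizationAt C 𝔭 := by
  -- The prime is the contraction to C of the maximal ideal at the origin.
  set 𝔭 : Ideal C := RingHom.ker ((origin ht).res.comp (Subalgebra.inclusion hC)) with h𝔭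
  have hp : 𝔭.IsPrime := RingHom.ker_isPrime _
  have hmem : ∀ s : C, ∀ c, (origin ht).HasValue (s : F) c → c ≠ 0 → s ∉ 𝔭 := by
    rintro s c ⟨hs, rfl⟩ hc
    rw [h𝔭, RingHom.mem_ker]
    exact hc
  refine ⟨𝔭, hp, le_antisymm ?_ ?_⟩
  · refine origin_le ht ?_ ?_
    · intro i
      obtain ⟨a, ha, s, hs, c, hc, hv, he⟩ := h i
      exact ⟨⟨a, ha⟩, ⟨s, hs⟩, hmem _ c hv hc, he⟩
    · rintro _ ⟨a, s, hs, rfl⟩ c hc hv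
      have hs' : (origin ht).HasValue (s : F) ((origin ht).res ⟨s, hC s.2⟩) := ⟨hC s.2, rfl⟩
      have hs0 : (origin ht).res ⟨s, hC s.2⟩ ≠ 0 := hs
      have ha := hv.mul hs'
      rw [div_mul_cancel₀ _ (hs'.ne_zero hs0)] at ha
      exact ⟨s, a, hmem a _ ha (mul_ne_zero hc hs0), inv_div _ _⟩
  · rintro _ ⟨a, s, hs, rfl⟩
    have hs0 : (origin ht).res ⟨s, hC s.2⟩ ≠ 0 := hs
    rw [div_eq_mul_inv]
    exact (origin ht).ring.mul_mem (hC a.2) ((origin ht).inv_mem ⟨s, hC s.2⟩ hs0)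

end Origin

end PointRing

/-! ### Fibres of free modules of rank one -/

section Fibre

variable {K F : Type*} [Field K] [Field F] [Algebra K F] {O : Subalgebra K F} [IsLocalRing O]
  {L : Submodule O F} {G : F}

/-- A generator of a module of rank one over a rational local ring is a basis of the fibre. -/
theorem exists_fibre_equiv (A : PointRing K F) (hA : A.ring = O) (hG : G ≠ 0)
    (hL : L = Submodule.span O {G}) :
    ∃ e : FibreOf O L ≃ₗ[K] K, ∀ f : L.restrictScalars K,
      A.HasValue ((f : F) / G) (e (toFibreOf O L f)) := by
  subst hA
  subst hL
  have hmem : ∀ f : Submodule.span A.ring {G}, (f : F) / G ∈ A.ring := by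
    rintro ⟨f, hf⟩
    obtain ⟨a, rfl⟩ := Submodule.mem_span_singleton.1 hf
    have : (a • G) / G = a := by
      rw [Algebra.smul_def]
      exact mul_div_cancel_right₀ _ hG
    change (a • G) / G ∈ A.ring
    rw [this]
    exact a.2
  -- Dividing by the generator and taking the residue induces the coordinate on the fibre, since its
  -- kernel is 𝔪L.
  let κ : Submodule.span A.ring {G} →ₗ[K] K :=
    { toFun := fun f => A.res ⟨(f : F) / G, hmem f⟩
      map_add' := fun f g => by
        rw [← map_add]
        congr 1
        exact Subtype.ext (add_div _ _ _)
      map_smul' := fun c f => by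
        rw [RingHom.id_apply, ← map_smul]
        congr 1
        exact Subtype.ext (smul_div_assoc c (f : F) G) }
  have hsurj : Function.Surjective κ := by
    intro c
    refine ⟨⟨algebraMap K A.ring c • G, Submodule.mem_span_singleton.2 ⟨_, rfl⟩⟩, ?_⟩
    have : (⟨(algebraMap K A.ring c • G) / G, hmem ⟨algebraMap K A.ring c • G,
        Submodule.mem_span_singleton.2 ⟨_, rfl⟩⟩⟩ : A.ring) = algebraMap K A.ring c := by
      apply Subtype.ext
      change (algebraMap K A.ring c • G) / G = _
      rw [Algebra.smul_def]
      exact mul_div_cancel_right₀ _ hG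
    change A.res _ = c
    rw [this]
    exact A.res.commutes c
  have hker : LinearMap.ker κ = (IsLocalRing.maximalIdeal A.ring •
      (⊤ : Submodule A.ring (Submodule.span A.ring {G}))).restrictScalars K := by
    ext f
    rw [LinearMap.mem_ker, Submodule.restrictScalars_mem]
    constructor
    · intro h
      have hm : (⟨(f : F) / G, hmem f⟩ : A.ring) ∈ IsLocalRing.maximalIdeal A.ring := by
        rw [IsLocalRing.mem_maximalIdeal, mem_nonunits_iff, A.isUnit_iff, not_not]
        exact h
      have hf : f = (⟨(f : F) / G, hmem f⟩ : A.ring) •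
          (⟨G, Submodule.mem_span_singleton_self G⟩ : Submodule.span A.ring {G}) := by
        apply Subtype.ext
        change (f : F) = (⟨(f : F) / G, hmem f⟩ : A.ring) • G
        rw [Algebra.smul_def]
        exact (div_mul_cancel₀ _ hG).symm
      rw [hf]
      exact Submodule.smul_mem_smul hm Submodule.mem_top
    · intro h
      refine Submodule.smul_induction_on h ?_ ?_
      · intro r hr n _
        have hr' : A.res r = 0 := by
          by_contra h0
          exact hr ((A.isUnit_iff r).2 h0)
        have : (⟨((r • n : Submodule.span A.ring {G}) : F) / G, hmem (r • n)⟩ : A.ring) =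
            r * ⟨(n : F) / G, hmem n⟩ := by
          apply Subtype.ext
          change (r • (n : F)) / G = r * ((n : F) / G)
          rw [Algebra.smul_def, mul_div_assoc]
          rfl
        change A.res _ = 0
        rw [this, map_mul, hr', zero_mul]
      · intro x y hx hy
        rw [map_add, hx, hy, add_zero]
  let e := (Submodule.Quotient.restrictScalarsEquiv K (IsLocalRing.maximalIdeal A.ring •
      (⊤ : Submodule A.ring (Submodule.span A.ring {G})))).symm.trans
    ((Submodule.quotEquivOfEq _ _ hker.symm).trans (κ.quotKerEquivOfSurjective hsurj))
  refine ⟨e, fun f => ⟨hmem f, ?_⟩⟩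
  rfl

end Fibre

/-! ### Coordinates at the rational points of the blow-up -/

section Coordinates

open MvPolynomial

variable {K : Type*} [Field K]

/-- The coordinate field in the coordinates given by `T`. -/
def coordHom (T : MvPolynomial (Fin 3) K ≃ₐ[K] MvPolynomial (Fin 3) K) :
    MvPolynomial (Fin 3) K →ₐ[K] CoordField K :=
  (IsScalarTower.toAlgHom K (MvPolynomial (Fin 3) K) (CoordField K)).comp T.toAlgHom

theorem coordHom_apply (T : MvPolynomial (Fin 3) K ≃ₐ[K] MvPolynomial (Fin 3) K)
    (f : MvPolynomial (Fin 3) K) : coordHom T f = toField (T f) := rfl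

theorem coordHom_injective (T : MvPolynomial (Fin 3) K ≃ₐ[K] MvPolynomial (Fin 3) K) :
    Function.Injective (coordHom T) :=
  (IsFractionRing.injective (MvPolynomial (Fin 3) K) (CoordField K)).comp T.injective

theorem aeval_div_of_isHomogeneous {σ F : Type*} [Field F] [Algebra K F] {f : MvPolynomial σ K}
    {n : ℕ} (hf : f.IsHomogeneous n) (z : σ → F) (e : F) :
    aeval (fun i => z i / e) f = aeval z f / e ^ n := by
  rw [aeval_def, aeval_def, eval₂_eq, eval₂_eq, Finset.sum_div]
  refine Finset.sum_congr rfl fun d hd => ?_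
  have hdeg : ∑ i ∈ d.support, d i = n := by
    have := hf.degree_eq_sum_deg_support hd
    rw [this]
  simp only [div_pow]
  rw [Finset.prod_div_distrib, Finset.prod_pow_eq_pow_sum, hdeg, mul_div_assoc]

theorem aeval_coordHom (T : MvPolynomial (Fin 3) K ≃ₐ[K] MvPolynomial (Fin 3) K)
    (f : MvPolynomial (Fin 3) K) : aeval (fun i => coordHom T (X i)) f = coordHom T f := by
  rw [← comp_aeval_apply, aeval_X_left_apply]

theorem PointRing.HasValue.of_isHomogeneous {A : PointRing K (CoordField K)}
    {T : MvPolynomial (Fin 3) K ≃ₐ[K] MvPolynomial (Fin 3) K} {e : CoordField K} {q : Fin 3 → K}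
    (h : ∀ i, A.HasValue (coordHom T (X i) / e) (q i)) {f : MvPolynomial (Fin 3) K} {n : ℕ}
    (hf : f.IsHomogeneous n) : A.HasValue (coordHom T f / e ^ n) (aeval q f) := by
  rw [← aeval_coordHom, ← aeval_div_of_isHomogeneous hf]
  exact hasValue_aeval h f

/-- A family of fractions is algebraically independent if a specialization of the numerators and
the denominator shows it. -/
theorem algebraicIndependent_div (T : MvPolynomial (Fin 3) K ≃ₐ[K] MvPolynomial (Fin 3) K)
    (χ : MvPolynomial (Fin 3) K →ₐ[K] MvPolynomial (Fin 2) K) (E : MvPolynomial (Fin 3) K)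
    (Y : Fin 2 → MvPolynomial (Fin 3) K) (hE : χ E ≠ 0) (hY : ∀ i, χ (Y i) = χ E * X i) :
    AlgebraicIndependent K fun i => coordHom T (Y i) / coordHom T E := by
  have hE0 : coordHom T E ≠ 0 := by
    rw [map_ne_zero_iff _ (coordHom_injective T)]
    rintro rfl
    exact hE (map_zero χ)
  rw [algebraicIndependent_iff]
  intro G hG
  -- Clearing denominators in G of the fractions gives a polynomial H whose specialization under χ
  -- is G times a power of χ E; H = 0 then forces G = 0.
  have key : ∀ G : MvPolynomial (Fin 2) K, ∃ (N : ℕ) (H : MvPolynomial (Fin 3) K),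
      coordHom T H = coordHom T E ^ N * aeval (fun i => coordHom T (Y i) / coordHom T E) G ∧
      χ H = χ E ^ N * G := by
    intro G
    induction G using MvPolynomial.induction_on with
    | C a => exact ⟨0, C a, by simp [← algebraMap_eq], by simp [← algebraMap_eq]⟩
    | add f g hf hg =>
      obtain ⟨N, H, h1, h2⟩ := hf
      obtain ⟨N', H', h1', h2'⟩ := hg
      refine ⟨N + N', E ^ N' * H + E ^ N * H', ?_, ?_⟩
      · simp only [map_add, map_mul, map_pow, h1, h1']; ring
      · simp only [map_add, map_mul, map_pow, h2, h2']; ring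
    | mul_X f i hf =>
      obtain ⟨N, H, h1, h2⟩ := hf
      refine ⟨N + 1, H * Y i, ?_, ?_⟩
      · rw [map_mul, h1, map_mul, aeval_X]; field_simp; ring
      · rw [map_mul, h2, hY]; ring
  obtain ⟨N, H, h1, h2⟩ := key G
  rw [hG, mul_zero, map_eq_zero_iff _ (coordHom_injective T)] at h1
  rw [h1, map_zero] at h2
  exact (mul_eq_zero.1 h2.symm).resolve_left (pow_ne_zero _ hE)

/-- A binary linear form that does not vanish at the point with index `d`. -/
def xForm : Option K → MvPolynomial (Fin 3) K
  | none => X 1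
  | some _ => X 0

/-- The binary linear form that vanishes at the point with index `d`. -/
def yForm : Option K → MvPolynomial (Fin 3) K
  | none => X 0
  | some c => X 1 - C c * X 0

/-- Denominator of the local coordinates at the rational point with the given index. -/
def localDen : Option K × Option K → MvPolynomial (Fin 3) K
  | (d, some _) => xForm d
  | (d, none) => xForm d * X 2

/-- Numerators of the local coordinates at the rational point with the given index. -/
def localNum : Option K × Option K → Fin 2 → MvPolynomial (Fin 3) K
  | (d, some z), i => ![yForm d, X 2 - C z * xForm d] i
  | (d, none), i => ![yForm d * X 2, xForm d ^ 2] i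

/-- A linear form that does not vanish at the image in the plane of a rational point. -/
def unitForm : Option K × Option K → MvPolynomial (Fin 3) K
  | (d, some _) => xForm d
  | (_, none) => X 2

/-- The image in the plane of a rational point. -/
def image : Option K × Option K → Fin 3 → K
  | (d, some z) => ![dirX d, dirY d, z]
  | (_, none) => ![0, 0, 1]

/-- The local coordinates at the rational point with the given index. -/
def localCoord (T : MvPolynomial (Fin 3) K ≃ₐ[K] MvPolynomial (Fin 3) K) (p : Option K × Option K)
    (i : Fin 2) : CoordField K :=
  coordHom T (localNum p i) / coordHom T (localDen p)

/-- An equation of the exceptional divisor at a rational point. -/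
def excEq (T : MvPolynomial (Fin 3) K ≃ₐ[K] MvPolynomial (Fin 3) K) :
    Option K × Option K → CoordField K
  | (_, some _) => 1
  | (d, none) => coordHom T (xForm d) / coordHom T (X 2)

theorem algebraicIndependent_localCoord (T : MvPolynomial (Fin 3) K ≃ₐ[K] MvPolynomial (Fin 3) K)
    (p : Option K × Option K) : AlgebraicIndependent K (localCoord T p) := by
  obtain ⟨d, s⟩ := p
  cases s with
  | some z =>
    cases d with
    | none =>
      -- Off E the specialization sets `xForm` to 1; on E it sets the third coordinate to 1, `xForm`
      -- to the second local coordinate and `yForm` to the product of both.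
      refine algebraicIndependent_div T (aeval ![X 0, 1, X 1 + C z]) _ _ ?_ ?_
      · simp [localDen, xForm]
      · intro i; fin_cases i <;> simp [localNum, localDen, xForm, yForm, algebraMap_eq]
    | some c =>
      refine algebraicIndependent_div T (aeval ![1, X 0 + C c, X 1 + C z]) _ _ ?_ ?_
      · simp [localDen, xForm]
      · intro i; fin_cases i <;> simp [localNum, localDen, xForm, yForm, algebraMap_eq]
  | none =>
    cases d with
    | none =>
      refine algebraicIndependent_div T (aeval ![X 0 * X 1, X 1, 1]) _ _ ?_ ?_
      · simp [localDen, xForm]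
      · intro i; fin_cases i <;> simp [localNum, localDen, xForm, yForm] <;> ring
    | some c =>
      refine algebraicIndependent_div T (aeval ![X 1, X 0 * X 1 + C c * X 1, 1]) _ _ ?_ ?_
      · simp [localDen, xForm]
      · intro i; fin_cases i <;> simp [localNum, localDen, xForm, yForm] <;> ring

/-- The local ring of the blow-up at the rational point with the given index. -/
def pointAt (T : MvPolynomial (Fin 3) K ≃ₐ[K] MvPolynomial (Fin 3) K) (p : Option K × Option K) :
    PointRing K (CoordField K) :=
  PointRing.origin (algebraicIndependent_localCoord T p)

variable {T : MvPolynomial (Fin 3) K ≃ₐ[K] MvPolynomial (Fin 3) K}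

theorem coordHom_X_ne_zero (i : Fin 3) : coordHom T (X i) ≠ 0 := by
  rw [map_ne_zero_iff _ (coordHom_injective T)]
  exact X_ne_zero i

theorem coordHom_xForm_ne_zero (d : Option K) : coordHom T (xForm d) ≠ 0 := by
  cases d <;> exact coordHom_X_ne_zero _

theorem coordHom_unitForm_ne_zero (p : Option K × Option K) : coordHom T (unitForm p) ≠ 0 := by
  obtain ⟨d, _ | z⟩ := p
  · exact coordHom_X_ne_zero _
  · exact coordHom_xForm_ne_zero _

theorem excEq_ne_zero (p : Option K × Option K) : excEq T p ≠ 0 := by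
  obtain ⟨d, _ | z⟩ := p
  · exact div_ne_zero (coordHom_xForm_ne_zero _) (coordHom_X_ne_zero _)
  · exact one_ne_zero

variable (T) in
theorem localCoord_zero (p : Option K × Option K) :
    localCoord T p 0 = coordHom T (yForm p.1) / coordHom T (xForm p.1) := by
  obtain ⟨d, _ | z⟩ := p
  · simp only [localCoord, localNum, localDen, Matrix.cons_val, map_mul]
    exact mul_div_mul_right _ _ (coordHom_X_ne_zero 2)
  · rfl

variable (T) in
theorem localCoord_none (d : Option K) :
    localCoord T (d, none) 1 = coordHom T (xForm d) / coordHom T (X 2) := by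
  have hx := coordHom_xForm_ne_zero (T := T) d
  simp only [localCoord, localNum, localDen, Matrix.cons_val, map_mul, sq]
  exact mul_div_mul_left _ _ hx

variable (T) in
theorem localCoord_some (d : Option K) (z : K) : localCoord T (d, some z) 1 =
    coordHom T (X 2) / coordHom T (xForm d) - algebraMap K (CoordField K) z := by
  have hx := coordHom_xForm_ne_zero (T := T) d
  simp only [localCoord, localNum, localDen, Matrix.cons_val, map_mul, map_sub,
    ← algebraMap_eq, AlgHom.commutes]
  field_simp

variable (T) in
theorem coordHom_yForm_some (c : K) : coordHom T (yForm (some c)) / coordHom T (xForm (some c)) =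
    coordHom T (X 1) / coordHom T (X 0) - algebraMap K (CoordField K) c := by
  have hx := coordHom_X_ne_zero (T := T) 0
  simp only [xForm, yForm, map_mul, map_sub, ← algebraMap_eq, AlgHom.commutes]
  field_simp

theorem pointAt_yForm (p : Option K × Option K) :
    (pointAt T p).HasValue (coordHom T (yForm p.1) / coordHom T (xForm p.1)) 0 := by
  have h := PointRing.origin_hasValue (algebraicIndependent_localCoord T p) 0
  rwa [localCoord_zero] at h

theorem pointAt_none (d : Option K) :
    (pointAt T (d, none)).HasValue (coordHom T (xForm d) / coordHom T (X 2)) 0 := by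
  have h := PointRing.origin_hasValue (algebraicIndependent_localCoord T (d, none)) 1
  rwa [localCoord_none] at h

theorem pointAt_some (d : Option K) (z : K) :
    (pointAt T (d, some z)).HasValue (coordHom T (X 2) / coordHom T (xForm d)) z := by
  have h := PointRing.origin_hasValue (algebraicIndependent_localCoord T (d, some z)) 1
  have h' := PointRing.HasValue.add h (PointRing.hasValue_algebraMap z)
  rwa [localCoord_some, sub_add_cancel, zero_add] at h'

theorem pointAt_dirX (p : Option K × Option K) :
    (pointAt T p).HasValue (coordHom T (X 0) / coordHom T (xForm p.1)) (dirX p.1) := by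
  have h := pointAt_yForm (T := T) p
  obtain ⟨_ | c, s⟩ := p
  · exact h
  · simp only [xForm, dirX]
    rw [div_self (coordHom_X_ne_zero _)]
    exact PointRing.hasValue_one

theorem pointAt_dirY (p : Option K × Option K) :
    (pointAt T p).HasValue (coordHom T (X 1) / coordHom T (xForm p.1)) (dirY p.1) := by
  have h := pointAt_yForm (T := T) p
  obtain ⟨_ | c, s⟩ := p
  · simp only [xForm, dirY]
    rw [div_self (coordHom_X_ne_zero _)]
    exact PointRing.hasValue_one
  · have h' := PointRing.HasValue.add h (PointRing.hasValue_algebraMap c)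
    rwa [coordHom_yForm_some, sub_add_cancel, zero_add] at h'

theorem pointAt_image (p : Option K × Option K) (i : Fin 3) :
    (pointAt T p).HasValue (coordHom T (X i) / coordHom T (unitForm p)) (image p i) := by
  have hX := pointAt_dirX (T := T) p
  have hY := pointAt_dirY (T := T) p
  obtain ⟨d, _ | z⟩ := p
  · have h := pointAt_none (T := T) d
    have hx := coordHom_xForm_ne_zero (T := T) d
    fin_cases i
    · have := hX.mul h
      rw [div_mul_div_cancel₀ hx, mul_zero] at this
      exact this
    · have := hY.mul h
      rw [div_mul_div_cancel₀ hx, mul_zero] at this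
      exact this
    · simp only [unitForm]
      change PointRing.HasValue _ (coordHom T (X 2) / coordHom T (X 2)) 1
      rw [div_self (coordHom_X_ne_zero _)]
      exact PointRing.hasValue_one
  · fin_cases i
    · exact hX
    · exact hY
    · exact pointAt_some d z

theorem image_ne_zero (p : Option K × Option K) : image p ≠ 0 := by
  obtain ⟨d, _ | z⟩ := p
  · intro h
    exact one_ne_zero (congrFun h 2)
  · intro h
    exact dir_ne_zero d ⟨congrFun h 0, congrFun h 1⟩

theorem unitForm_homog (p : Option K × Option K) : (unitForm p).IsHomogeneous 1 := by
  obtain ⟨_ | c, _ | z⟩ := p <;> exact isHomogeneous_X _ _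

theorem xForm_homog (d : Option K) : (xForm d).IsHomogeneous 1 := by
  cases d <;> exact isHomogeneous_X _ _

theorem yForm_homog (d : Option K) : (yForm d).IsHomogeneous 1 := by
  cases d
  · exact isHomogeneous_X _ _
  · exact (isHomogeneous_X _ _).sub (isHomogeneous_C_mul_X _ _)

end Coordinates

/-! ### Forms of the pencil as polynomials -/

section Forms

open MvPolynomial

variable {K : Type*} [Field K] (c : ConicPencil K) {S S' : Type*} [CommRing S] [Algebra K S]
  [CommRing S'] [Algebra K S']

theorem map_linForm (φ : S →ₐ[K] S') (b : Fin 2 → K) (x y : S) :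
    φ (linForm b x y) = linForm b (φ x) (φ y) := by
  simp [linForm]

theorem map_quadForm (φ : S →ₐ[K] S') (a : Fin 3 → K) (x y : S) :
    φ (quadForm a x y) = quadForm a (φ x) (φ y) := by
  simp [quadForm]

theorem ConicPencil.map_normForm (φ : S →ₐ[K] S') (x y : S) :
    φ (c.normForm x y) = c.normForm (φ x) (φ y) := by
  simp [normForm]

theorem ConicPencil.map_conic (φ : S →ₐ[K] S') (x y z : S) :
    φ (c.conic x y z) = c.conic (φ x) (φ y) (φ z) := by
  simp [conic]

theorem ConicPencil.map_quartic (φ : S →ₐ[K] S')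
    (v : (Fin 3 → K) × (Fin 2 → K) × (Fin 3 → K)) (x y z : S) :
    φ (c.quartic v x y z) = c.quartic v (φ x) (φ y) (φ z) := by
  simp [quartic, map_quadForm, map_linForm, map_normForm, map_conic]

theorem isHomogeneous_linForm {σ : Type*} (b : Fin 2 → K) {x y : MvPolynomial σ K}
    (hx : x.IsHomogeneous 1) (hy : y.IsHomogeneous 1) : (linForm b x y).IsHomogeneous 1 := by
  simp only [linForm, algebraMap_eq]
  exact (hx.C_mul _).add (hy.C_mul _)

theorem isHomogeneous_quadForm {σ : Type*} (a : Fin 3 → K) {x y : MvPolynomial σ K}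
    (hx : x.IsHomogeneous 1) (hy : y.IsHomogeneous 1) : (quadForm a x y).IsHomogeneous 2 := by
  simp only [quadForm, algebraMap_eq]
  exact (((hx.pow 2).C_mul _).add ((hx.mul hy).C_mul _)).add ((hy.pow 2).C_mul _)

theorem ConicPencil.isHomogeneous_normForm {σ : Type*} {x y : MvPolynomial σ K}
    (hx : x.IsHomogeneous 1) (hy : y.IsHomogeneous 1) : (c.normForm x y).IsHomogeneous 2 := by
  simp only [normForm, algebraMap_eq]
  exact ((hy.pow 2).sub ((hx.mul hy).C_mul _)).add ((hx.pow 2).C_mul _)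

theorem ConicPencil.isHomogeneous_conic {σ : Type*} {x y z : MvPolynomial σ K}
    (hx : x.IsHomogeneous 1) (hy : y.IsHomogeneous 1) (hz : z.IsHomogeneous 1) :
    (c.conic x y z).IsHomogeneous 2 := by
  simp only [conic, algebraMap_eq]
  exact ((hz.pow 2).add (((hx.C_mul _).add (hy.C_mul _)).mul hz)).add
    (hx.mul ((hx.C_mul _).add (hy.C_mul _)))

theorem ConicPencil.isHomogeneous_quartic {σ : Type*} {x y z : MvPolynomial σ K}
    (v : (Fin 3 → K) × (Fin 2 → K) × (Fin 3 → K))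
    (hx : x.IsHomogeneous 1) (hy : y.IsHomogeneous 1) (hz : z.IsHomogeneous 1) :
    (c.quartic v x y z).IsHomogeneous 4 :=
  ((isHomogeneous_quadForm _ hx hy).mul (c.isHomogeneous_conic hx hy hz)).add
    ((c.isHomogeneous_normForm hx hy).mul
      (((isHomogeneous_linForm _ hx hy).mul hz).add (isHomogeneous_quadForm _ hx hy)))

end Forms

/-! ### Rational points of the blow-up -/

section RationalPoints

open MvPolynomial

variable {K : Type*} [Field K]

/-- The ideals `IP` and `IR` are those of `(0 : 0 : 1)` and, partially, of the base locus of the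
pencil `c`, in the coordinates given by `T`. -/
structure IsCentre (T : MvPolynomial (Fin 3) K ≃ₐ[K] MvPolynomial (Fin 3) K) (c : ConicPencil K)
    (IP IR : Ideal (MvPolynomial (Fin 3) K)) : Prop where
  homog : ∀ i, (T (X i)).IsHomogeneous 1
  homog_symm : ∀ i, (T.symm (X i)).IsHomogeneous 1
  general : c.IsGeneral
  ideal_P : IP = Ideal.span {T (X 0), T (X 1)}
  normForm_mem : T (c.normForm (X 0) (X 1)) ∈ IR
  conic_mem : T (c.conic (X 0) (X 1) (X 2)) ∈ IR

/-- Dehomogenization with respect to `e`. -/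
def dehom (e : CoordField K) : MvPolynomial (Fin 3) K →ₐ[K] CoordField K :=
  aeval fun j => coord j / e

theorem toField_eq_aeval (f : MvPolynomial (Fin 3) K) : aeval coord f = toField f :=
  aeval_coordHom AlgEquiv.refl f

theorem dehom_apply {f : MvPolynomial (Fin 3) K} {n : ℕ} (hf : f.IsHomogeneous n)
    (e : CoordField K) : dehom e f = toField f / e ^ n := by
  rw [dehom, aeval_div_of_isHomogeneous hf, toField_eq_aeval]

theorem isHomogeneous_map {φ : MvPolynomial (Fin 3) K →ₐ[K] MvPolynomial (Fin 3) K}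
    (hφ : ∀ i, (φ (X i)).IsHomogeneous 1) {f : MvPolynomial (Fin 3) K} {n : ℕ}
    (hf : f.IsHomogeneous n) : (φ f).IsHomogeneous n := by
  have h1 := hf.aeval (fun i => φ (X i)) hφ
  rwa [← comp_aeval_apply, aeval_X_left_apply, one_mul] at h1

theorem coord_ne_zero (i : Fin 3) : (coord i : CoordField K) ≠ 0 :=
  coordHom_X_ne_zero (T := AlgEquiv.refl) i

theorem coord_eq_coordHom (T : MvPolynomial (Fin 3) K ≃ₐ[K] MvPolynomial (Fin 3) K) (j : Fin 3) :
    coord j = coordHom T (T.symm (X j)) := by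
  rw [coordHom_apply, AlgEquiv.apply_symm_apply]; rfl

theorem aeval_zero_of_isHomogeneous {σ : Type*} {f : MvPolynomial σ K} {n : ℕ}
    (hf : f.IsHomogeneous n) (hn : n ≠ 0) : aeval (0 : σ → K) f = 0 := by
  rw [aeval_zero]
  have : constantCoeff f = 0 := hf.coeff_eq_zero (by simpa using hn.symm)
  rw [this, map_zero]

section Values

variable {T : MvPolynomial (Fin 3) K ≃ₐ[K] MvPolynomial (Fin 3) K} {A : PointRing K (CoordField K)}
  {e : CoordField K} {q : Fin 3 → K}

theorem PointRing.HasValue.coord_div (hT : ∀ i, (T.symm (X i)).IsHomogeneous 1)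
    (h : ∀ i, A.HasValue (coordHom T (X i) / e) (q i)) (j : Fin 3) :
    A.HasValue (coord j / e) (aeval q (T.symm (X j))) := by
  have := PointRing.HasValue.of_isHomogeneous h (hT j)
  rwa [pow_one, ← coord_eq_coordHom] at this

theorem exists_aeval_symm_ne_zero (hT : ∀ i, (T (X i)).IsHomogeneous 1) (hq : q ≠ 0) :
    ∃ j, aeval q (T.symm (X j)) ≠ 0 := by
  by_contra h
  push Not at h
  apply hq
  funext i
  have h1 : aeval (fun j => aeval q (T.symm (X j))) (T (X i)) = q i := by
    have h2 := comp_aeval_apply (fun j => T.symm (X j)) (aeval q) (T (X i))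
    have h3 := comp_aeval_apply (X : Fin 3 → MvPolynomial (Fin 3) K) T.symm.toAlgHom (T (X i))
    rw [aeval_X_left_apply] at h3
    change T.symm (T (X i)) = aeval (fun j => T.symm (X j)) (T (X i)) at h3
    rw [← h2, ← h3, AlgEquiv.symm_apply_apply, aeval_X]
  rw [← h1, funext h]
  exact aeval_zero_of_isHomogeneous (hT i) one_ne_zero

theorem dehom_mem (h : ∀ j, coord j / e ∈ A.ring) (f : MvPolynomial (Fin 3) K) :
    dehom e f ∈ A.ring := by
  choose q hq using fun j => PointRing.exists_hasValue (h j)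
  exact (PointRing.hasValue_aeval hq f).mem

end Values

theorem coordHom_xForm_eq (T : MvPolynomial (Fin 3) K ≃ₐ[K] MvPolynomial (Fin 3) K)
    (p : Option K × Option K) :
    coordHom T (xForm p.1) = coordHom T (unitForm p) * excEq T p := by
  obtain ⟨d, _ | z⟩ := p
  · exact (mul_div_cancel₀ _ (coordHom_X_ne_zero 2)).symm
  · exact (mul_one _).symm

/-- A conic of the pencil that does not contain the image of a rational point. -/
def auxForm (c : ConicPencil K) : Option K × Option K → MvPolynomial (Fin 3) K
  | (_, some _) => c.normForm (X 0) (X 1)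
  | (_, none) => c.conic (X 0) (X 1) (X 2)

theorem auxForm_homog (c : ConicPencil K) (p : Option K × Option K) :
    (auxForm c p).IsHomogeneous 2 := by
  obtain ⟨d, _ | z⟩ := p
  · exact c.isHomogeneous_conic (isHomogeneous_X _ _) (isHomogeneous_X _ _) (isHomogeneous_X _ _)
  · exact c.isHomogeneous_normForm (isHomogeneous_X _ _) (isHomogeneous_X _ _)

namespace IsCentre

variable {T : MvPolynomial (Fin 3) K ≃ₐ[K] MvPolynomial (Fin 3) K} {c : ConicPencil K}
  {IP IR : Ideal (MvPolynomial (Fin 3) K)} (h : IsCentre T c IP IR) (p : Option K × Option K)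

include h

theorem coordHom_homog {f : MvPolynomial (Fin 3) K} {n : ℕ} (hf : f.IsHomogeneous n) :
    (T f).IsHomogeneous n :=
  isHomogeneous_map (φ := T.toAlgHom) h.homog hf

/-- Together with `auxForm_mem` this says that `IR` is trivial near a rational point: off P the form
N has no rational zero, and Q does not vanish at P. -/
theorem auxForm_value :
    ∃ a ≠ 0, (pointAt T p).HasValue (coordHom T (auxForm c p) / coordHom T (unitForm p) ^ 2) a := by
  refine ⟨_, ?_, PointRing.HasValue.of_isHomogeneous (pointAt_image p) (auxForm_homog c p)⟩
  obtain ⟨d, _ | z⟩ := p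
  · simp [auxForm, image, ConicPencil.conic]
  · simp only [auxForm, c.map_normForm, aeval_X]
    exact ConicPencil.normForm_dir_ne_zero h.general d

theorem auxForm_mem : T (auxForm c p) ∈ IR := by
  obtain ⟨d, _ | z⟩ := p
  · exact h.conic_mem
  · exact h.normForm_mem

theorem X_mem_zero : T (X 0) ∈ IP := by
  rw [h.ideal_P]; exact Ideal.subset_span (Set.mem_insert _ _)

theorem X_mem_one : T (X 1) ∈ IP := by
  rw [h.ideal_P]; exact Ideal.subset_span (Set.mem_insert_of_mem _ rfl)

theorem xForm_mem (d : Option K) : T (xForm d) ∈ IP := by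
  cases d
  · exact h.X_mem_one
  · exact h.X_mem_zero

omit h in
theorem mul_mem_inf {f g : MvPolynomial (Fin 3) K} (hf : T f ∈ IP) (hg : T g ∈ IR) :
    T (f * g) ∈ IP ⊓ IR := by
  rw [map_mul]
  exact ⟨IP.mul_mem_right _ hf, IR.mul_mem_left _ hg⟩

theorem exists_coord : ∃ i, ∃ a ≠ 0,
    (pointAt T p).HasValue (coord i / coordHom T (unitForm p)) a := by
  obtain ⟨i, hi⟩ := exists_aeval_symm_ne_zero h.homog (image_ne_zero p)
  exact ⟨i, _, hi, PointRing.HasValue.coord_div h.homog_symm (pointAt_image p) i⟩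

theorem coord_div_mem (j : Fin 3) : coord j / coordHom T (unitForm p) ∈ (pointAt T p).ring :=
  (PointRing.HasValue.coord_div h.homog_symm (pointAt_image p) j).mem

/-- The inverse image of `IP` is generated by the equation of the exceptional divisor. -/
theorem dehom_div_mem {f : MvPolynomial (Fin 3) K} (hf : f ∈ IP) :
    dehom (coordHom T (unitForm p)) f / excEq T p ∈ (pointAt T p).ring := by
  have hgen : ∀ i : Fin 3, coordHom T (X i) / coordHom T (xForm p.1) ∈ (pointAt T p).ring →
      dehom (coordHom T (unitForm p)) (T (X i)) / excEq T p ∈ (pointAt T p).ring := by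
    intro i hi
    rw [dehom_apply (h.homog i), pow_one, div_div, ← coordHom_xForm_eq]
    exact hi
  rw [h.ideal_P] at hf
  induction hf using Submodule.span_induction with
  | mem x hx =>
    rcases hx with rfl | hx
    · exact hgen 0 (pointAt_dirX p).mem
    · rw [Set.mem_singleton_iff.1 hx]
      exact hgen 1 (pointAt_dirY p).mem
  | zero => rw [map_zero, zero_div]; exact Subalgebra.zero_mem _
  | add x y _ _ hx hy => rw [map_add, add_div]; exact Subalgebra.add_mem _ hx hy
  | smul a x _ hx =>
    rw [smul_eq_mul, map_mul, mul_div_assoc]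
    exact Subalgebra.mul_mem _ (dehom_mem (h.coord_div_mem p) a) hx

theorem dehom_div_sq_mem {f : MvPolynomial (Fin 3) K} (hf : f ∈ IP ^ 2 * IR) :
    dehom (coordHom T (unitForm p)) f / excEq T p ^ 2 ∈ (pointAt T p).ring := by
  replace hf : f ∈ IP * IP := by
    rw [← sq]
    exact Ideal.mul_le_left hf
  induction hf using Submodule.mul_induction_on' with
  | mem_mul_mem x hx y hy =>
    rw [map_mul (dehom _) x y, sq (excEq T p), mul_div_mul_comm]
    exact Subalgebra.mul_mem _ (h.dehom_div_mem p hx) (h.dehom_div_mem p hy)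
  | add x _ y _ hx hy => rw [map_add (dehom _) x y, add_div]; exact Subalgebra.add_mem _ hx hy

/-- At the point, every element of `IP ⊓ IR` is a multiple of `excEq`; when g is a unit times
`excEq`, all quotients f/g are therefore regular. -/
theorem blowupChart_le {i : Fin 3} {a : K} (ha : a ≠ 0)
    (hi : (pointAt T p).HasValue (coord i / coordHom T (unitForm p)) a) {d : ℕ}
    {g : MvPolynomial (Fin 3) K} (hg : g.IsHomogeneous d) {b : K} (hb : b ≠ 0)
    (hgv : (pointAt T p).HasValue (dehom (coordHom T (unitForm p)) g / excEq T p) b) :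
    blowupChart (IP ⊓ IR) i d g ≤ (pointAt T p).ring := by
  have hu := coordHom_unitForm_ne_zero (T := T) p
  have hγ := excEq_ne_zero (T := T) p
  have hc := coord_ne_zero (K := K) i
  refine Algebra.adjoin_le ?_
  rintro z (⟨j, rfl⟩ | ⟨n, f, hf, hfn, rfl⟩)
  · have := Subalgebra.mul_mem _ (h.coord_div_mem p j) (hi.inv ha).mem
    rw [inv_div, div_mul_div_cancel₀ hu] at this
    exact this
  · have h1 := Subalgebra.mul_mem _ (h.dehom_div_mem p hf.1) (hgv.inv hb).mem
    have h2 := Subalgebra.mul_mem _ h1 (Subalgebra.mul_mem _ (Subalgebra.pow_mem _ (hi.inv ha).mem n)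
      (Subalgebra.pow_mem _ hi.mem d))
    rw [dehom_apply hfn, dehom_apply hg] at h2
    have hg0 : toField g ≠ 0 := by
      intro h0
      rw [dehom_apply hg, h0, zero_div, zero_div] at hgv
      exact hgv.ne_zero hb rfl
    refine (congrArg (· ∈ (pointAt T p).ring) ?_).mpr h2
    simp only [div_pow, inv_div]
    field_simp

/-- The form of degree three used as the denominator of a chart around a rational point. -/
theorem chartForm_value : ∃ a ≠ 0, (pointAt T p).HasValue
    (dehom (coordHom T (unitForm p)) (T (xForm p.1 * auxForm c p)) / excEq T p) a := by
  obtain ⟨a, ha, hv⟩ := h.auxForm_value p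
  refine ⟨a, ha, ?_⟩
  convert hv using 1
  rw [dehom_apply (h.coordHom_homog ((xForm_homog p.1).mul (auxForm_homog c p))), ← coordHom_apply,
    map_mul, coordHom_xForm_eq]
  have hu := coordHom_unitForm_ne_zero (T := T) p
  have hγ := excEq_ne_zero (T := T) p
  field_simp
  ring

/-- The form `xForm * auxForm` lies in `IP ⊓ IR` and equals a unit times `excEq`, so the chart it
defines lies in the local ring. It remains to write the local coordinates as fractions of that
chart. -/
theorem isBlowupPoint : IsBlowupPoint (IP ⊓ IR) (pointAt T p).ring := by
  obtain ⟨i, a, ha, hi⟩ := h.exists_coord p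
  obtain ⟨b, hb, hgv⟩ := h.chartForm_value p
  have hhom : (T (xForm p.1 * auxForm c p)).IsHomogeneous 3 :=
    h.coordHom_homog ((xForm_homog p.1).mul (auxForm_homog c p))
  have hmem := mul_mem_inf (h.xForm_mem p.1) (h.auxForm_mem p)
  have hu := coordHom_unitForm_ne_zero (T := T) p
  have hci := coord_ne_zero (K := K) i
  have hC := h.blowupChart_le p ha hi hhom hb hgv
  refine ⟨i, 3, T (xForm p.1 * auxForm c p), hmem, hhom, ?_, ?_⟩
  · intro h0
    rw [h0, map_zero, zero_div] at hgv
    exact hgv.ne_zero hb rfl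
  refine PointRing.exists_origin_eq _ hC ?_
  have hlin : ∀ f : MvPolynomial (Fin 3) K, f.IsHomogeneous 1 →
      coordHom T f / coord i ∈ blowupChart (IP ⊓ IR) i 3 (T (xForm p.1 * auxForm c p)) := by
    intro f hf
    have := dehom_apply (h.coordHom_homog hf) (coord i)
    rw [pow_one, ← coordHom_apply] at this
    rw [← this, dehom]
    have hall : ∀ g : MvPolynomial (Fin 3) K, aeval (fun j => coord j / coord i) g ∈
        blowupChart (IP ⊓ IR) i 3 (T (xForm p.1 * auxForm c p)) := by
      intro g
      induction g using MvPolynomial.induction_on with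
      | C a => rw [aeval_C]; exact Subalgebra.algebraMap_mem _ a
      | add f g hf hg => rw [map_add]; exact Subalgebra.add_mem _ hf hg
      | mul_X f k hf =>
        rw [map_mul (aeval _) f (X k), aeval_X]
        exact Subalgebra.mul_mem _ hf (Algebra.subset_adjoin (Or.inl ⟨k, rfl⟩))
    exact hall _
  have hunit : (pointAt T p).HasValue (coordHom T (unitForm p) / coord i) a⁻¹ := by
    have := hi.inv ha
    rwa [inv_div] at this
  have hfrac : ∀ f : MvPolynomial (Fin 3) K, f.IsHomogeneous 1 →
      ∃ a ∈ blowupChart (IP ⊓ IR) i 3 (T (xForm p.1 * auxForm c p)),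
      ∃ s ∈ blowupChart (IP ⊓ IR) i 3 (T (xForm p.1 * auxForm c p)), ∃ b ≠ 0,
      (pointAt T p).HasValue s b ∧ coordHom T f / coordHom T (unitForm p) = a / s :=
    fun f hf => ⟨_, hlin f hf, _, hlin _ (unitForm_homog p), _, inv_ne_zero ha, hunit,
      (div_div_div_cancel_right₀ hci _ _).symm⟩
  obtain ⟨d, _ | z⟩ := p
  · intro k
    have hx := coordHom_xForm_ne_zero (T := T) d
    have hz := coordHom_X_ne_zero (T := T) 2
    fin_cases k
    -- The slope `yForm / xForm` is not a function on the plane near P; multiplying both by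
    -- `auxForm` exhibits it as a quotient of elements of `IP ⊓ IR`, hence as an element of the
    -- chart.
    · obtain ⟨b', hb', hQ⟩ := h.auxForm_value (d, none)
      refine ⟨_, Algebra.subset_adjoin (Or.inr ⟨3, T (yForm d * auxForm c (d, none)), ?_, ?_, rfl⟩),
        1, Subalgebra.one_mem _, 1, one_ne_zero, PointRing.hasValue_one, ?_⟩
      · refine mul_mem_inf ?_ (h.auxForm_mem (d, none))
        cases d
        · exact h.X_mem_zero
        · rw [yForm, map_sub, map_mul]
          exact IP.sub_mem h.X_mem_one (IP.mul_mem_left _ h.X_mem_zero)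
      · exact h.coordHom_homog ((yForm_homog d).mul (auxForm_homog c _))
      · have hQ0 : coordHom T (auxForm c (d, none)) ≠ 0 := by
          intro h0
          rw [h0, zero_div] at hQ
          exact hQ.ne_zero hb' rfl
        change coordHom T (yForm d * X 2) / coordHom T (xForm d * X 2) = coordHom T _ / _ /
          (coordHom T _ / _) / 1
        simp only [map_mul]
        field_simp
    · have hk : localCoord T (d, none) 1 = coordHom T (xForm d) / coordHom T (unitForm (d, none)) := by
        simp only [localCoord, localNum, localDen, Matrix.cons_val, map_mul, map_pow, unitForm]
        field_simp
      have := hfrac (xForm d) (xForm_homog d)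
      rw [← hk] at this
      exact this
  · intro k
    fin_cases k
    · exact hfrac (yForm d) (yForm_homog d)
    · refine hfrac (X 2 - C z * xForm d) ((isHomogeneous_X _ _).sub ((xForm_homog d).C_mul z))

/-- The rational point of the blow-up with the given index. -/
def rationalPoint : RationalPoint (IP ⊓ IR) :=
  ⟨⟨(pointAt T p).ring, h.isBlowupPoint p⟩,
    PointRing.surjective_residue_origin (algebraicIndependent_localCoord T p)⟩

omit h in
-- The residue map is determined by the ring alone: a is the only constant for which z - a is not a
-- unit.
theorem hasValue_of_ring_eq {A B : PointRing K (CoordField K)} (hAB : A.ring = B.ring)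
    {z : CoordField K} {a : K} (hz : A.HasValue z a) : B.HasValue z a := by
  have hm : z ∈ B.ring := hAB ▸ hz.mem
  obtain ⟨b, hb⟩ := PointRing.exists_hasValue hm
  by_cases hab : b - a = 0
  · rwa [sub_eq_zero.1 hab] at hb
  · exfalso
    have h1 := hb.sub (PointRing.hasValue_algebraMap a)
    have h2 := hz.sub (PointRing.hasValue_algebraMap a)
    have h3 := (h1.inv hab).mem
    rw [← hAB] at h3
    exact h2.ne_zero_of_inv_mem (h1.ne_zero hab) h3 (sub_self a)

omit h in
-- The ratios of the coordinates separate the points: for unequal finite indices their values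
-- differ, and for a finite and an infinite one a ratio vanishes at one point while its inverse is
-- regular at the other.
theorem pointAt_ring_injective {p p' : Option K × Option K}
    (hpp : (pointAt T p).ring = (pointAt T p').ring) : p = p' := by
  have h1 := pointAt_yForm (T := T) p'
  have h0 : ∀ i : Fin 3, coordHom T (X i) ≠ 0 := coordHom_X_ne_zero
  have hd : p.1 = p'.1 := by
    have hX := pointAt_dirX (T := T) p'
    have hY := pointAt_dirY (T := T) p'
    have hX' := hasValue_of_ring_eq hpp (pointAt_dirX (T := T) p)
    have hY' := hasValue_of_ring_eq hpp (pointAt_dirY (T := T) p)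
    obtain ⟨d, s⟩ := p
    obtain ⟨d', s'⟩ := p'
    simp only at hX hY hX' hY' ⊢
    cases d with
    | none =>
      cases d' with
      | none => rfl
      | some c' =>
        exfalso
        have := hX'.mul hY
        simp only [xForm, dirX, dirY, zero_mul] at this
        rw [div_mul_div_cancel₀ (h0 1), div_self (h0 0)] at this
        exact one_ne_zero (PointRing.hasValue_one.unique this)
    | some c =>
      cases d' with
      | none =>
        exfalso
        have := hX.mul hY'
        simp only [xForm, dirX, dirY, zero_mul] at this
        rw [div_mul_div_cancel₀ (h0 1), div_self (h0 0)] at this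
        exact one_ne_zero (PointRing.hasValue_one.unique this)
      | some c' => exact congrArg some (hY'.unique hY)
  obtain ⟨d, s⟩ := p
  obtain ⟨d', s'⟩ := p'
  simp only at hd
  subst hd
  have hx := coordHom_xForm_ne_zero (T := T) d
  cases s with
  | none =>
    cases s' with
    | none => rfl
    | some z' =>
      exfalso
      have := (hasValue_of_ring_eq hpp (pointAt_none (T := T) d)).mul (pointAt_some (T := T) d z')
      rw [zero_mul, div_mul_div_cancel₀ (h0 2), div_self hx] at this
      exact one_ne_zero (PointRing.hasValue_one.unique this)
  | some z =>
    cases s' with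
    | none =>
      exfalso
      have := (pointAt_none (T := T) d).mul (hasValue_of_ring_eq hpp (pointAt_some (T := T) d z))
      rw [zero_mul, div_mul_div_cancel₀ (h0 2), div_self hx] at this
      exact one_ne_zero (PointRing.hasValue_one.unique this)
    | some z' =>
      rw [(hasValue_of_ring_eq hpp (pointAt_some (T := T) d z)).unique (pointAt_some d z')]

end IsCentre

end RationalPoints

/-! ### Classification of the rational points, generators of the stalks, values of sections -/

section RationalPoints

open MvPolynomial

variable {K : Type*} [Field K]

namespace IsCentre

variable {T : MvPolynomial (Fin 3) K ≃ₐ[K] MvPolynomial (Fin 3) K} {c : ConicPencil K}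
  {IP IR : Ideal (MvPolynomial (Fin 3) K)} (h : IsCentre T c IP IR)

include h

theorem coordHom_div_mem {A : PointRing K (CoordField K)} {i : Fin 3}
    (hA : ∀ j, coord j / coord i ∈ A.ring) {f : MvPolynomial (Fin 3) K} {n : ℕ}
    (hf : f.IsHomogeneous n) : coordHom T f / coord i ^ n ∈ A.ring := by
  have := dehom_mem hA (T f)
  rwa [dehom_apply (h.coordHom_homog hf)] at this

/-- A local ring of the blow-up in which the local coordinates at a rational point vanish is the
local ring at this point. -/
theorem ring_eq_pointAt {A : PointRing K (CoordField K)} {p : Option K × Option K}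
    (hp : ∀ k, A.HasValue (localCoord T p k) 0) {i : Fin 3} {d : ℕ} {g : MvPolynomial (Fin 3) K}
    (hgJ : g ∈ IP ⊓ IR) (hg : g.IsHomogeneous d) (hg0 : g ≠ 0)
    {𝔭 : Ideal (blowupChart (IP ⊓ IR) i d g)} [𝔭.IsPrime] (hA : A.ring = localizationAt _ 𝔭) :
    A.ring = (pointAt T p).ring := by
  have hof : ∀ {z a}, (pointAt T p).HasValue z a → A.HasValue z a := fun hz =>
    PointRing.HasValue.of_origin _ hp hz
  have hchart : ∀ z ∈ blowupChart (IP ⊓ IR) i d g, z ∈ A.ring := by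
    intro z hz
    rw [hA]
    exact ⟨⟨z, hz⟩, 1, fun h1 => Ideal.IsPrime.ne_top ‹_› ((Ideal.eq_top_iff_one 𝔭).2 h1), by simp⟩
  have hcoord : ∀ j, coord j / coord i ∈ A.ring := fun j =>
    hchart _ (Algebra.subset_adjoin (Or.inl ⟨j, rfl⟩))
  have hu := coordHom_unitForm_ne_zero (T := T) p
  have hγ := excEq_ne_zero (T := T) p
  have hc := coord_ne_zero (K := K) i
  have hgf : toField g ≠ 0 := by
    rwa [toField, map_ne_zero_iff _ (IsFractionRing.injective (MvPolynomial (Fin 3) K) (CoordField K))]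
  have hunit : coordHom T (unitForm p) / coord i ∈ A.ring := by
    have := h.coordHom_div_mem hcoord (unitForm_homog p)
    rwa [pow_one] at this
  obtain ⟨a, ha⟩ := PointRing.exists_hasValue (h.coord_div_mem p i)
  -- An arbitrary chart (i, d, g) producing A must fit inside the ring at p. For this `coord i` has
  -- to be a unit multiple of `unitForm`, and g of `excEq`; the inverse quotients lie in A, so the
  -- values a and b cannot be 0.
  have ha0 : a ≠ 0 := (hof ha).ne_zero_of_inv_mem (div_ne_zero hc hu) (by rwa [inv_div])
  obtain ⟨b, hb⟩ := PointRing.exists_hasValue (h.dehom_div_mem p hgJ.1)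
  have hb0 : b ≠ 0 := by
    refine (hof hb).ne_zero_of_inv_mem ?_ ?_
    · rw [dehom_apply hg]
      exact div_ne_zero (div_ne_zero hgf (pow_ne_zero _ hu)) hγ
    · obtain ⟨b', hb', hv⟩ := h.chartForm_value p
      have hhom : (T (xForm p.1 * auxForm c p)).IsHomogeneous 3 :=
        h.coordHom_homog ((xForm_homog p.1).mul (auxForm_homog c p))
      have hF : toField (T (xForm p.1 * auxForm c p)) ≠ 0 := by
        intro h0
        rw [dehom_apply hhom, h0, zero_div, zero_div] at hv
        exact hv.ne_zero hb' rfl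
      have h1 : (toField (T (xForm p.1 * auxForm c p)) / coord i ^ 3) / (toField g / coord i ^ d) ∈
          A.ring := hchart _ (Algebra.subset_adjoin (Or.inr ⟨3, _,
            mul_mem_inf (h.xForm_mem p.1) (h.auxForm_mem p), hhom, rfl⟩))
      have h2 := A.ring.mul_mem (A.ring.mul_mem h1 (((hof hv).inv hb').mem))
        (A.ring.mul_mem (A.ring.pow_mem (hof ha).mem 3) (A.ring.pow_mem hunit d))
      refine (congrArg (· ∈ A.ring) ?_).mpr h2
      rw [dehom_apply hg, dehom_apply hhom]
      simp only [div_pow, inv_div]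
      field_simp
  exact PointRing.eq_origin _ hp (h.blowupChart_le p ha0 ha hg hb0 hb) hA

theorem exists_index (y : RationalPoint (IP ⊓ IR)) :
    ∃ p, y.1.localRing = (pointAt T p).ring := by
  have hAr : (PointRing.ofLocal y.1.localRing y.2).ring = y.1.localRing := rfl
  obtain ⟨A, hA⟩ : ∃ A, A = PointRing.ofLocal y.1.localRing y.2 := ⟨_, rfl⟩
  rw [← hA] at hAr
  suffices H : ∃ p, ∀ k, A.HasValue (localCoord T p k) 0 by
    obtain ⟨p, hp⟩ := H
    obtain ⟨i, d, g, hgJ, hg, hg0, 𝔭, h𝔭, hloc⟩ := y.1.2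
    exact ⟨p, hAr.symm.trans (h.ring_eq_pointAt hp hgJ hg hg0 (hAr.trans hloc))⟩
  obtain ⟨i, d, g, hgJ, hg, hg0, 𝔭, h𝔭, hloc⟩ := y.1.2
  have hchart : ∀ z ∈ blowupChart (IP ⊓ IR) i d g, z ∈ A.ring := by
    intro z hz
    rw [hAr, Blowup.localRing, hloc]
    exact ⟨⟨z, hz⟩, 1, fun h1 => Ideal.IsPrime.ne_top ‹_› ((Ideal.eq_top_iff_one 𝔭).2 h1), by simp⟩
  have hcoord : ∀ j, coord j / coord i ∈ A.ring := fun j =>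
    hchart _ (Algebra.subset_adjoin (Or.inl ⟨j, rfl⟩))
  have hc := coord_ne_zero (K := K) i
  choose q hq using fun j => PointRing.exists_hasValue (hcoord j)
  have hq0 : q ≠ 0 := by
    intro h0
    have := hq i
    rw [div_self hc, h0] at this
    exact one_ne_zero (PointRing.hasValue_one.unique this)
  have hval : ∀ {f : MvPolynomial (Fin 3) K} {n : ℕ}, f.IsHomogeneous n →
      A.HasValue (coordHom T f / coord i ^ n) (aeval q (T f)) := by
    intro f n hf
    exact PointRing.HasValue.of_isHomogeneous (T := AlgEquiv.refl) hq (h.coordHom_homog hf)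
  obtain ⟨w, hw⟩ : ∃ w : Fin 3 → K, ∀ k, A.HasValue (coordHom T (X k) / coord i) (w k) :=
    ⟨fun k => aeval q (T (X k)), fun k => by
      have := hval (isHomogeneous_X K k)
      rwa [pow_one] at this⟩
  have hw0 : w 0 ≠ 0 ∨ w 1 ≠ 0 ∨ w 2 ≠ 0 := by
    obtain ⟨j, hj⟩ := exists_aeval_symm_ne_zero (T := T.symm) h.homog_symm hq0
    have hwj : w j ≠ 0 := by
      rw [(hw j).unique (by have := hval (isHomogeneous_X K j); rwa [pow_one] at this)]
      exact hj
    fin_cases j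
    · exact Or.inl hwj
    · exact Or.inr (Or.inl hwj)
    · exact Or.inr (Or.inr hwj)
  have hdiv : ∀ {u v : CoordField K} {a b : K}, A.HasValue (u / coord i) a →
      A.HasValue (v / coord i) b → b ≠ 0 → A.HasValue (u / v) (a / b) := by
    intro u v a b hu hv hb
    have := hu.div hv hb
    rwa [div_div_div_cancel_right₀ hc] at this
  have hsub : ∀ {u : CoordField K} {a : K}, A.HasValue u a →
      A.HasValue (u - algebraMap K (CoordField K) a) 0 := by
    intro u a hu
    have := hu.sub (PointRing.hasValue_algebraMap a)
    rwa [sub_self] at this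
  -- w represents the image in the plane, in the coordinates of T. Unless it is (0:0:1), it
  -- determines the index.
  by_cases h0 : w 0 ≠ 0
  · refine ⟨(some (w 1 / w 0), some (w 2 / w 0)), fun k => ?_⟩
    fin_cases k
    · change A.HasValue (localCoord T _ 0) 0
      rw [localCoord_zero, coordHom_yForm_some]
      exact hsub (hdiv (hw 1) (hw 0) h0)
    · change A.HasValue (localCoord T _ 1) 0
      rw [localCoord_some]
      exact hsub (hdiv (hw 2) (hw 0) h0)
  rw [not_not] at h0
  by_cases h1 : w 1 ≠ 0
  · refine ⟨(none, some (w 2 / w 1)), fun k => ?_⟩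
    fin_cases k
    · change A.HasValue (localCoord T _ 0) 0
      rw [localCoord_zero]
      have := hdiv (hw 0) (hw 1) h1
      rwa [h0, zero_div] at this
    · change A.HasValue (localCoord T _ 1) 0
      rw [localCoord_some]
      exact hsub (hdiv (hw 2) (hw 1) h1)
  rw [not_not] at h1
  have h2 : w 2 ≠ 0 := by tauto
  set Q : MvPolynomial (Fin 3) K := c.conic (X 0) (X 1) (X 2) with hQ
  have hQhom : Q.IsHomogeneous 2 :=
    c.isHomogeneous_conic (isHomogeneous_X _ _) (isHomogeneous_X _ _) (isHomogeneous_X _ _)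
  -- Over P the form Q is a unit, so it can be cancelled from X_k·Q/g to make X_0/g and X_1/g
  -- regular.
  have hQv : ∃ b ≠ 0, A.HasValue (coordHom T Q / coord i ^ 2) b := by
    refine ⟨_, ?_, hval hQhom⟩
    have hwk : ∀ k, aeval q (T (X k)) = w k := fun k =>
      PointRing.HasValue.unique (by have := hval (isHomogeneous_X K k); rwa [pow_one] at this) (hw k)
    have : aeval q (T Q) = c.conic (aeval q (T (X 0))) (aeval q (T (X 1))) (aeval q (T (X 2))) :=
      c.map_conic ((aeval q).comp T.toAlgHom) _ _ _
    rw [this, hwk, hwk, hwk, h0, h1]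
    simpa [ConicPencil.conic] using h2
  obtain ⟨b, hb0, hb⟩ := hQv
  have hmem : ∀ k : Fin 3, T (X k) ∈ IP →
      (coordHom T (X k * Q) / coord i ^ 3) / (toField g / coord i ^ d) ∈ A.ring := fun k hk =>
    hchart _ (Algebra.subset_adjoin (Or.inr ⟨3, T (X k * Q), mul_mem_inf hk h.conic_mem,
      h.coordHom_homog ((isHomogeneous_X K k).mul hQhom), rfl⟩))
  have hgf : toField g ≠ 0 := by
    rwa [toField, map_ne_zero_iff _ (IsFractionRing.injective (MvPolynomial (Fin 3) K) (CoordField K))]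
  have hg' : toField g / coord i ^ d ≠ 0 := div_ne_zero hgf (pow_ne_zero _ hc)
  have hquot : ∀ k : Fin 3, T (X k) ∈ IP →
      (coordHom T (X k) / coord i) / (toField g / coord i ^ d) ∈ A.ring := by
    intro k hk
    have := A.ring.mul_mem (hmem k hk) (hb.inv hb0).mem
    refine (congrArg (· ∈ A.ring) ?_).mpr this
    have hQ0 : coordHom T Q ≠ 0 := by
      intro hz
      rw [hz, zero_div] at hb
      exact hb.ne_zero hb0 rfl
    rw [map_mul]
    field_simp
  obtain ⟨a₀, ha₀⟩ := PointRing.exists_hasValue (hquot 0 h.X_mem_zero)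
  obtain ⟨a₁, ha₁⟩ := PointRing.exists_hasValue (hquot 1 h.X_mem_one)
  -- Since g lies in the ideal of P, 1 is a combination of X_0/g and X_1/g with regular
  -- coefficients. Their values are the homogeneous coordinates of the direction.
  have hne : a₀ ≠ 0 ∨ a₁ ≠ 0 := by
    have hspan : ∀ f ∈ IP, ∃ u ∈ A.ring, ∃ v ∈ A.ring, dehom (coord i) f =
        u * (coordHom T (X 0) / coord i) + v * (coordHom T (X 1) / coord i) := by
      intro f hf
      rw [h.ideal_P, Ideal.mem_span_pair] at hf
      obtain ⟨u, v, rfl⟩ := hf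
      refine ⟨dehom (coord i) u, dehom_mem hcoord u, dehom (coord i) v, dehom_mem hcoord v, ?_⟩
      rw [map_add, map_mul, map_mul, dehom_apply (h.homog 0), dehom_apply (h.homog 1), pow_one]
      rfl
    obtain ⟨u, hu, v, hv, huv⟩ := hspan g hgJ.1
    rw [dehom_apply hg] at huv
    obtain ⟨u', hu'⟩ := PointRing.exists_hasValue hu
    obtain ⟨v', hv'⟩ := PointRing.exists_hasValue hv
    have h3 := (hu'.mul ha₀).add (hv'.mul ha₁)
    have h4 : u * (coordHom T (X 0) / coord i / (toField g / coord i ^ d)) +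
        v * (coordHom T (X 1) / coord i / (toField g / coord i ^ d)) = 1 := by
      rw [← mul_div_assoc u (coordHom T (X 0) / coord i),
        ← mul_div_assoc v (coordHom T (X 1) / coord i), ← add_div, ← huv, div_self hg']
    rw [h4] at h3
    have h5 := h3.unique PointRing.hasValue_one
    by_contra hcon
    push Not at hcon
    rw [hcon.1, hcon.2] at h5
    simp at h5
  have hdiv' : ∀ {u v : CoordField K} {a b : K}, A.HasValue (u / coord i / (toField g / coord i ^ d)) a →
      A.HasValue (v / coord i / (toField g / coord i ^ d)) b → b ≠ 0 → A.HasValue (u / v) (a / b) := by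
    intro u v a b hu hv hb
    have := hu.div hv hb
    rwa [div_div_div_cancel_right₀ hg', div_div_div_cancel_right₀ hc] at this
  by_cases ha : a₀ ≠ 0
  · refine ⟨(some (a₁ / a₀), none), fun k => ?_⟩
    fin_cases k
    · change A.HasValue (localCoord T _ 0) 0
      rw [localCoord_zero, coordHom_yForm_some]
      exact hsub (hdiv' ha₁ ha₀ ha)
    · change A.HasValue (localCoord T _ 1) 0
      rw [localCoord_none]
      have := hdiv (hw 0) (hw 2) h2
      rwa [h0, zero_div] at this
  · rw [not_not] at ha
    have ha1 : a₁ ≠ 0 := hne.resolve_left (not_not.2 ha)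
    refine ⟨(none, none), fun k => ?_⟩
    fin_cases k
    · change A.HasValue (localCoord T _ 0) 0
      rw [localCoord_zero]
      have := hdiv' ha₀ ha₁ ha1
      rwa [ha, zero_div] at this
    · change A.HasValue (localCoord T _ 1) 0
      rw [localCoord_none]
      have := hdiv (hw 1) (hw 2) h2
      rwa [h1, zero_div] at this

/-- The rational points of the blow-up are indexed by two copies of the projective line. -/
def indexEquiv : Option K × Option K ≃ RationalPoint (IP ⊓ IR) :=
  Equiv.ofBijective h.rationalPoint
    ⟨fun _ _ hpp => pointAt_ring_injective (congrArg (fun y => y.1.1) hpp), fun y => by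
      obtain ⟨p, hp⟩ := h.exists_index y
      exact ⟨p, Subtype.ext (Subtype.ext hp.symm)⟩⟩

/-- A generator of the stalk at a rational point. -/
theorem twistedStalk_eq (p : Option K × Option K) :
    twistedStalk (IP ^ 2 * IR) 4 (h.rationalPoint p).1 =
      Submodule.span (h.rationalPoint p).1.localRing
        {coordHom T (unitForm p) ^ 4 * excEq T p ^ 2} := by
  have hu := coordHom_unitForm_ne_zero (T := T) p
  have hγ := excEq_ne_zero (T := T) p
  have hG : coordHom T (unitForm p) ^ 4 * excEq T p ^ 2 ≠ 0 :=
    mul_ne_zero (pow_ne_zero _ hu) (pow_ne_zero _ hγ)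
  have hspan : ∀ {z : CoordField K} {G : CoordField K}, G ≠ 0 → z / G ∈ (pointAt T p).ring →
      z ∈ Submodule.span (h.rationalPoint p).1.localRing {G} := by
    intro z G hG hz
    refine Submodule.mem_span_singleton.2 ⟨⟨z / G, hz⟩, ?_⟩
    rw [Algebra.smul_def]
    exact div_mul_cancel₀ z hG
  apply le_antisymm
  · refine Submodule.span_le.2 ?_
    rintro z ⟨i, n, hi, f, hf, hfn, rfl⟩
    refine hspan hG ?_
    have h1 := h.dehom_div_sq_mem p hf
    have h2 : coordHom T (unitForm p) / coord i ^ 1 ∈ (pointAt T p).ring :=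
      h.coordHom_div_mem hi (unitForm_homog p)
    rw [pow_one] at h2
    have h3 := Subalgebra.mul_mem _ h1 (Subalgebra.pow_mem _ h2 n)
    refine (congrArg (· ∈ (pointAt T p).ring) ?_).mpr h3
    have hc := coord_ne_zero (K := K) i
    rw [dehom_apply hfn, div_pow, pow_add]
    field_simp
  · rw [Submodule.span_singleton_le_iff_mem]
    obtain ⟨i, a, ha, hi⟩ := h.exists_coord p
    obtain ⟨b, hb, hv⟩ := h.auxForm_value p
    -- This quartic is the proposed generator times a unit, which shows that the generator lies in
    -- the stalk.
    have hmem : T (xForm p.1 ^ 2 * auxForm c p) ∈ IP ^ 2 * IR := by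
      rw [map_mul, map_pow]
      exact Ideal.mul_mem_mul (Ideal.pow_mem_pow (h.xForm_mem p.1) 2) (h.auxForm_mem p)
    have hhom : (xForm p.1 ^ 2 * auxForm c p).IsHomogeneous 4 :=
      ((xForm_homog p.1).pow 2).mul (auxForm_homog c p)
    have hF : coordHom T (auxForm c p) ≠ 0 := by
      intro h0
      rw [h0, zero_div] at hv
      exact hv.ne_zero hb rfl
    have hst : coordHom T (xForm p.1 ^ 2 * auxForm c p) ∈
        twistedStalk (IP ^ 2 * IR) 4 (h.rationalPoint p).1 := by
      refine Submodule.subset_span ⟨i, 0, fun j => ?_, T (xForm p.1 ^ 2 * auxForm c p), hmem,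
        h.coordHom_homog hhom, ?_⟩
      · have := Subalgebra.mul_mem _ (h.coord_div_mem p j) (hi.inv ha).mem
        rw [inv_div, div_mul_div_cancel₀ hu] at this
        exact this
      · rw [pow_zero, div_one]; rfl
    have h0 : coordHom T (xForm p.1 ^ 2 * auxForm c p) ≠ 0 := by
      rw [map_mul, map_pow]
      exact mul_ne_zero (pow_ne_zero _ (coordHom_xForm_ne_zero _)) hF
    refine (Submodule.span_singleton_le_iff_mem _ _).2 hst (hspan h0 ?_)
    refine (congrArg (· ∈ (pointAt T p).ring) ?_).mpr (hv.inv hb).mem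
    rw [map_mul, map_pow, coordHom_xForm_eq]
    field_simp

theorem exists_fibre_equiv (p : Option K × Option K) :
    ∃ e : Fibre (IP ^ 2 * IR) 4 (h.rationalPoint p).1 ≃ₗ[K] K,
      ∀ f : globalSections (IP ⊓ IR) (IP ^ 2 * IR) 4, (pointAt T p).HasValue
        ((f : CoordField K) / (coordHom T (unitForm p) ^ 4 * excEq T p ^ 2))
        (e (evalAt (IP ^ 2 * IR) 4 (h.rationalPoint p).1 f)) := by
  obtain ⟨e, he⟩ := RationalSurfaceCode.exists_fibre_equiv (pointAt T p)
    (O := (h.rationalPoint p).1.localRing) rfl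
    (mul_ne_zero (pow_ne_zero 4 (coordHom_unitForm_ne_zero (T := T) p))
      (pow_ne_zero 2 (excEq_ne_zero (T := T) p))) (h.twistedStalk_eq p)
  exact ⟨e, fun f => he (Submodule.inclusion (iInf_le _ (h.rationalPoint p).1) f)⟩

omit h in
/-- The value of a quartic at a rational point of the blow-up. -/
theorem quartic_hasValue (p : Option K × Option K)
    (v : (Fin 3 → K) × (Fin 2 → K) × (Fin 3 → K)) :
    (pointAt T p).HasValue (coordHom T (c.quartic v (X 0) (X 1) (X 2)) /
      (coordHom T (unitForm p) ^ 4 * excEq T p ^ 2)) (c.value v p) := by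
  obtain ⟨d, _ | z⟩ := p
  · have hx := coordHom_xForm_ne_zero (T := T) d
    have h2 := coordHom_X_ne_zero (T := T) 2
    have hX := pointAt_dirX (T := T) (d, none)
    have hY := pointAt_dirY (T := T) (d, none)
    have hs := pointAt_none (T := T) d
    -- With s = `xForm`/X_2, the quotient is aQ(xs, ys, 1) + N(bs + cs²) in the direction
    -- coordinates x, y; at s = 0 only a survives, because Q(0, 0, 1) = 1.
    have hval := PointRing.hasValue_aeval (A := pointAt T (d, none))
      (x := ![coordHom T (X 0) / coordHom T (xForm d), coordHom T (X 1) / coordHom T (xForm d),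
        coordHom T (xForm d) / coordHom T (X 2)]) (p := ![dirX d, dirY d, 0])
      (by intro i; fin_cases i; exacts [hX, hY, hs])
      (quadForm v.1 (X 0) (X 1) * c.conic (X 0 * X 2) (X 1 * X 2) 1 +
        c.normForm (X 0) (X 1) * (linForm v.2.1 (X 0) (X 1) * X 2 +
          quadForm v.2.2 (X 0) (X 1) * X 2 ^ 2))
    simp only [map_add, map_mul, map_pow, map_quadForm, map_linForm, c.map_conic, c.map_normForm,
      aeval_X, map_one, Matrix.cons_val] at hval
    convert hval using 1
    · rw [c.map_quartic]
      simp only [ConicPencil.quartic, ConicPencil.conic, ConicPencil.normForm, quadForm, linForm,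
        excEq, unitForm]
      field_simp
    · simp [ConicPencil.value, ConicPencil.conic]
  · have := PointRing.HasValue.of_isHomogeneous (pointAt_image (T := T) (d, some z))
      (c.isHomogeneous_quartic v (isHomogeneous_X K 0) (isHomogeneous_X K 1) (isHomogeneous_X K 2))
    rw [c.map_quartic (aeval _), aeval_X, aeval_X, aeval_X] at this
    simp only [excEq, one_pow, mul_one]
    exact this

end IsCentre

end RationalPoints

/-! ### Valuative criterion for sections of the blow-up -/

section Valuative

open MvPolynomial

variable {K : Type*} [Field K]

theorem toField_injective : Function.Injective (toField : MvPolynomial (Fin 3) K → CoordField K) :=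
  IsFractionRing.injective (MvPolynomial (Fin 3) K) (CoordField K)

theorem toField_ne_zero {f : MvPolynomial (Fin 3) K} (hf : f ≠ 0) : toField f ≠ 0 := by
  rwa [toField, map_ne_zero_iff _ toField_injective]

/-- Every prime ideal of the coordinate ring is dominated by a valuation ring. -/
theorem exists_valuationSubring (𝔮 : Ideal (MvPolynomial (Fin 3) K)) [h𝔮 : 𝔮.IsPrime] :
    ∃ V : ValuationSubring (CoordField K), (∀ f ∈ 𝔮, V.valuation (toField f) < 1) ∧
      ∀ f ∉ 𝔮, V.valuation (toField f) = 1 := by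
  have hle : 𝔮.primeCompl ≤ nonZeroDivisors (MvPolynomial (Fin 3) K) :=
    𝔮.primeCompl_le_nonZeroDivisors
  let φ : Localization.AtPrime 𝔮 →+* CoordField K :=
    IsLocalization.lift (M := 𝔮.primeCompl)
      (g := algebraMap (MvPolynomial (Fin 3) K) (CoordField K))
      (fun y => isUnit_iff_ne_zero.2 (toField_ne_zero (nonZeroDivisors.ne_zero (hle y.2))))
  have hφ : ∀ f, φ (algebraMap _ _ f) = toField f := fun f => IsLocalization.lift_eq _ f
  obtain ⟨V, hV, hloc⟩ := IsLocalRing.exists_factor_valuationRing φ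
  have hmem : ∀ f, toField f ∈ V := fun f => by rw [← hφ]; exact hV _
  have hunit : ∀ f, IsUnit (⟨toField f, hmem f⟩ : V) ↔ f ∉ 𝔮 := by
    intro f
    have h1 : (⟨toField f, hmem f⟩ : V) = φ.codRestrict V.toSubring hV (algebraMap _ _ f) :=
      Subtype.ext (hφ f).symm
    rw [h1]
    constructor
    · intro h
      exact (IsLocalization.AtPrime.isUnit_to_map_iff (Localization.AtPrime 𝔮) 𝔮 f).1
        (hloc.map_nonunit _ h)
    · intro h
      exact ((IsLocalization.AtPrime.isUnit_to_map_iff (Localization.AtPrime 𝔮) 𝔮 f).2 h).map _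
  refine ⟨V, fun f hf => ?_, fun f hf => ?_⟩
  · rw [← V.valuation_lt_one_iff ⟨toField f, hmem f⟩, IsLocalRing.mem_maximalIdeal,
      mem_nonunits_iff, hunit]
    exact not_not.2 hf
  · exact (V.valuation_eq_one_iff ⟨toField f, hmem f⟩).1 ((hunit f).2 hf)

/-- Every valuation ring containing the coordinate ring has a centre on the blow-up. -/
theorem exists_centre {J : Ideal (MvPolynomial (Fin 3) K)}
    (hJ : ∀ f ∈ J, ∀ n, homogeneousComponent n f ∈ J) (hJ0 : J ≠ ⊥)
    (V : ValuationSubring (CoordField K)) (hV : ∀ f : MvPolynomial (Fin 3) K, toField f ∈ V) :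
    ∃ y : Blowup J, ∀ z ∈ y.localRing, z ∈ V := by
  -- Properness: the coordinate, and below the homogeneous generator of J, with largest valuation
  -- give a chart contained in V. The centre is the contraction of the maximal ideal of V.
  obtain ⟨i, -, hi⟩ := Finset.exists_max_image Finset.univ
    (fun i : Fin 3 => V.valuation (coord i)) Finset.univ_nonempty
  have hc := coord_ne_zero (K := K) i
  have hcoord : ∀ j, coord j / coord i ∈ V := by
    intro j
    rw [← V.valuation_le_one_iff, map_div₀]
    exact div_le_one_of_le₀ (hi j (Finset.mem_univ _)) zero_le
  have halg : ∀ a : K, algebraMap K (CoordField K) a ∈ V := fun a => by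
    rw [IsScalarTower.algebraMap_apply K (MvPolynomial (Fin 3) K) (CoordField K)]
    exact hV _
  have hdehom : ∀ f, dehom (coord i) f ∈ V := by
    intro f
    induction f using MvPolynomial.induction_on with
    | C a => rw [dehom, aeval_C]; exact halg a
    | add f g hf hg => rw [map_add]; exact add_mem hf hg
    | mul_X f j hf =>
      rw [map_mul (dehom _) f (X j)]
      refine mul_mem hf ?_
      rw [dehom, aeval_X]
      exact hcoord j
  set S : Set (MvPolynomial (Fin 3) K) := {f | f ∈ J ∧ ∃ n, f.IsHomogeneous n} with hS
  have hspan : J = Ideal.span S := by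
    apply le_antisymm
    · intro f hf
      rw [← sum_homogeneousComponent f]
      exact Ideal.sum_mem _ fun n _ =>
        Ideal.subset_span ⟨hJ f hf n, n, homogeneousComponent_isHomogeneous n f⟩
    · exact Ideal.span_le.2 fun f hf => hf.1
  obtain ⟨G, hGS, hG⟩ := (Submodule.fg_span_iff_fg_span_finset_subset S).1
    (IsNoetherian.noetherian (Ideal.span S))
  change Ideal.span S = Ideal.span (G : Set (MvPolynomial (Fin 3) K)) at hG
  have hGne : ∃ g ∈ G, g ≠ 0 := by
    by_contra! h
    apply hJ0
    rw [hspan, hG, Ideal.span_eq_bot]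
    exact h
  obtain ⟨g₀, hg₀, hg₀0⟩ := hGne
  have hd0 : ∀ g ∈ G, g ≠ 0 → dehom (coord i) g ≠ 0 := by
    intro g hg hg0
    obtain ⟨n, hn⟩ := (hGS hg).2
    rw [dehom_apply hn]
    exact div_ne_zero (toField_ne_zero hg0) (pow_ne_zero _ hc)
  obtain ⟨g, hg, hmax⟩ := Finset.exists_max_image G
    (fun g => V.valuation (dehom (coord i) g)) ⟨g₀, hg₀⟩
  have hgd : dehom (coord i) g ≠ 0 := by
    intro h0
    have := hmax g₀ hg₀
    rw [h0, map_zero, le_zero_iff, map_eq_zero] at this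
    exact hd0 g₀ hg₀ hg₀0 this
  have hg0 : g ≠ 0 := by
    rintro rfl
    exact hgd (map_zero _)
  obtain ⟨hgJ, d, hgd'⟩ := hGS hg
  have hquot : ∀ f ∈ J, dehom (coord i) f / dehom (coord i) g ∈ V := by
    intro f hf
    rw [hspan, hG] at hf
    induction hf using Submodule.span_induction with
    | mem x hx =>
      rw [← V.valuation_le_one_iff, map_div₀]
      exact div_le_one_of_le₀ (hmax x hx) zero_le
    | zero => rw [map_zero, zero_div]; exact zero_mem V
    | add x y _ _ hx hy => rw [map_add, add_div]; exact add_mem hx hy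
    | smul a x _ hx =>
      rw [smul_eq_mul, map_mul, mul_div_assoc]
      exact mul_mem (hdehom a) hx
  have hchart : ∀ z ∈ blowupChart J i d g, z ∈ V := by
    intro z hz
    let W : Subalgebra K (CoordField K) := { V.toSubring with algebraMap_mem' := halg }
    have hW : blowupChart J i d g ≤ W := by
      refine Algebra.adjoin_le ?_
      rintro z (⟨j, rfl⟩ | ⟨n, f, hf, hfn, rfl⟩)
      · exact hcoord j
      · have := hquot f hf
        rwa [dehom_apply hfn, dehom_apply hgd'] at this
    exact hW hz
  let ψ : blowupChart J i d g →+* V :=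
    (blowupChart J i d g).subtype.codRestrict V.toSubring fun z => hchart z z.2
  let 𝔭 : Ideal (blowupChart J i d g) := (IsLocalRing.maximalIdeal V).comap ψ
  have h𝔭 : 𝔭.IsPrime := Ideal.comap_isPrime ψ _
  refine ⟨⟨localizationAt _ 𝔭, i, d, g, hgJ, hgd', hg0, 𝔭, h𝔭, rfl⟩, ?_⟩
  rintro z ⟨a, s, hs, rfl⟩
  have h1 : V.valuation (s : CoordField K) = 1 := by
    have hu : IsUnit (ψ s) := by
      by_contra h
      exact hs ((IsLocalRing.mem_maximalIdeal _).2 h)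
    exact (V.valuation_eq_one_iff (ψ s)).1 hu
  rw [← V.valuation_le_one_iff, map_div₀, h1, div_one, V.valuation_le_one_iff]
  exact hchart a a.2

variable {J : Ideal (MvPolynomial (Fin 3) K)}

/-- At the centre of V the generators of the stalk are f/X_i^e with X_i of valuation 1, since X_k is
a unit of V. Thus they have the valuations of elements of I, and their multiples by the local ring
cannot have larger ones. -/
theorem valuation_le_of_mem_globalSections (hJ : ∀ f ∈ J, ∀ n, homogeneousComponent n f ∈ J)
    (hJ0 : J ≠ ⊥) {I : Ideal (MvPolynomial (Fin 3) K)} {m : ℕ} {s : CoordField K}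
    (hs : s ∈ globalSections J I m) (V : ValuationSubring (CoordField K))
    (hV : ∀ f : MvPolynomial (Fin 3) K, toField f ∈ V) {k : Fin 3}
    (hk : V.valuation (coord k) = 1) :
    s ∈ V ∧ ((∀ f ∈ I, V.valuation (toField f) < 1) → V.valuation s < 1) := by
  obtain ⟨y, hy⟩ := exists_centre hJ hJ0 V hV
  have hs' : s ∈ twistedStalk I m y := (Submodule.mem_iInf _).1 hs y
  have hinv : ∀ i, (∀ j, coord j / coord i ∈ y.localRing) → V.valuation (coord i) = 1 := by
    intro i hi
    have h1 := (V.valuation_le_one_iff _).2 (hy _ (hi k))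
    have h2 := (V.valuation_le_one_iff _).2 (hV (X i))
    have hc : 0 < V.valuation (coord i) := by
      rw [Valuation.pos_iff]; exact coord_ne_zero i
    rw [map_div₀, hk, div_le_one₀ hc] at h1
    exact le_antisymm h2 h1
  have hgen : ∀ z ∈ {z : CoordField K | ∃ (i : Fin 3) (e : ℕ), (∀ j, coord j / coord i ∈ y.localRing) ∧
      ∃ f ∈ I, f.IsHomogeneous (m + e) ∧ z = toField f / coord i ^ e},
      ∃ f ∈ I, V.valuation z = V.valuation (toField f) := by
    rintro z ⟨i, e, hi, f, hf, -, rfl⟩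
    exact ⟨f, hf, by rw [map_div₀, map_pow, hinv i hi, one_pow, div_one]⟩
  constructor
  · refine Submodule.span_induction (p := fun z _ => z ∈ V) ?_ ?_ ?_ ?_ hs'
    · intro z hz
      obtain ⟨f, -, hf⟩ := hgen z hz
      rw [← V.valuation_le_one_iff, hf, V.valuation_le_one_iff]
      exact hV f
    · exact zero_mem V
    · intro a b _ _ ha hb
      exact add_mem ha hb
    · intro a z _ hz
      exact mul_mem (hy _ a.2) hz
  · intro hI
    refine Submodule.span_induction (p := fun z _ => V.valuation z < 1) ?_ ?_ ?_ ?_ hs'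
    · intro z hz
      obtain ⟨f, hfI, hf⟩ := hgen z hz
      rw [hf]
      exact hI f hfI
    · rw [map_zero]; exact zero_lt_one
    · intro a b _ _ ha hb
      exact V.valuation.map_add_lt ha hb
    · intro a z _ hz
      change V.valuation ((a : CoordField K) * z) < 1
      rw [map_mul]
      exact (mul_le_of_le_one_left' ((V.valuation_le_one_iff _).2 (hy _ a.2))).trans_lt hz

theorem mem_of_valuation {V : ValuationSubring (CoordField K)}
    {𝔮 : Ideal (MvPolynomial (Fin 3) K)} (h1 : ∀ f ∈ 𝔮, V.valuation (toField f) < 1)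
    (h2 : ∀ f ∉ 𝔮, V.valuation (toField f) = 1) (f : MvPolynomial (Fin 3) K) : toField f ∈ V := by
  rw [← V.valuation_le_one_iff]
  by_cases hf : f ∈ 𝔮
  · exact (h1 f hf).le
  · exact (h2 f hf).le

theorem homogeneousComponent_mem_span {S : Set (MvPolynomial (Fin 3) K)}
    (hS : ∀ f ∈ S, ∃ n, f.IsHomogeneous n) {f : MvPolynomial (Fin 3) K} (hf : f ∈ Ideal.span S)
    (n : ℕ) : homogeneousComponent n f ∈ Ideal.span S := by
  induction hf using Submodule.span_induction generalizing n with
  | mem x hx =>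
    obtain ⟨d, hd⟩ := hS x hx
    rw [homogeneousComponent_of_mem hd]
    split_ifs
    · exact Ideal.subset_span hx
    · exact Ideal.zero_mem _
  | zero => rw [map_zero]; exact Ideal.zero_mem _
  | add x y _ _ hx hy => rw [map_add]; exact Ideal.add_mem _ (hx n) (hy n)
  | smul a x _ hx =>
    rw [smul_eq_mul, ← sum_homogeneousComponent a, ← sum_homogeneousComponent x, Finset.sum_mul_sum,
      map_sum]
    refine Ideal.sum_mem _ fun i _ => ?_
    rw [map_sum]
    refine Ideal.sum_mem _ fun j _ => ?_
    rw [homogeneousComponent_of_mem ((homogeneousComponent_isHomogeneous i a).mul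
      (homogeneousComponent_isHomogeneous j x))]
    split_ifs
    · exact Ideal.mul_mem_left _ _ (hx j)
    · exact Ideal.zero_mem _

/-- The global sections are polynomials. -/
theorem exists_polynomial_of_mem_globalSections
    (hJ : ∀ f ∈ J, ∀ n, homogeneousComponent n f ∈ J)
    (hJ0 : J ≠ ⊥) {I : Ideal (MvPolynomial (Fin 3) K)} {m : ℕ} {s : CoordField K}
    (hs : s ∈ globalSections J I m) : ∃ f, s = toField f := by
  obtain ⟨a, b, hab, rfl⟩ := IsFractionRing.exists_reduced_fraction (A := MvPolynomial (Fin 3) K) s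
  rw [IsFractionRing.mk'_eq_div] at hs ⊢
  have hb0 : (b : MvPolynomial (Fin 3) K) ≠ 0 := nonZeroDivisors.ne_zero b.2
  by_cases hb : IsUnit (b : MvPolynomial (Fin 3) K)
  · obtain ⟨c, hc⟩ := hb.exists_right_inv
    refine ⟨a * c, ?_⟩
    change toField a / toField b = _
    rw [div_eq_iff (toField_ne_zero hb0), toField, toField, toField, ← map_mul, mul_assoc, mul_comm c, hc, mul_one]
  exfalso
  -- A prime factor of the reduced denominator would give a valuation ring in which the section has
  -- a pole.
  obtain ⟨π, hπ, hπb⟩ := WfDvdMonoid.exists_irreducible_factor hb hb0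
  have hπp : Prime π := hπ.prime
  have hprime : (Ideal.span {π}).IsPrime := (Ideal.span_singleton_prime hπ.ne_zero).2 hπp
  obtain ⟨V, hV1, hV2⟩ := exists_valuationSubring (Ideal.span {π})
  -- π cannot divide two distinct coordinates, so some coordinate is a unit for the valuation.
  have hk : ∃ k : Fin 3, X k ∉ Ideal.span {π} := by
    by_contra! h
    have h0 := Ideal.mem_span_singleton.1 (h 0)
    have h1 := Ideal.mem_span_singleton.1 (h 1)
    have hX : Prime (X 0 : MvPolynomial (Fin 3) K) := X_prime
    have := (hπ.associated_of_dvd hX.irreducible h0).symm.dvd.trans h1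
    rw [X_dvd_X] at this
    exact absurd this (by decide)
  obtain ⟨k, hk⟩ := hk
  have := (valuation_le_of_mem_globalSections hJ hJ0 hs V (mem_of_valuation hV1 hV2) (hV2 _ hk)).1
  have hvb := hV1 _ (Ideal.mem_span_singleton.2 hπb)
  have hva := hV2 a fun ha => hπ.not_isUnit (hab (Ideal.mem_span_singleton.1 ha) hπb)
  rw [← V.valuation_le_one_iff, map_div₀] at this
  change V.valuation (toField a) / V.valuation (toField b) ≤ 1 at this
  rw [hva, div_le_one₀ ((Valuation.pos_iff _).2 (toField_ne_zero hb0))] at this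
  exact absurd hvb (not_lt.2 this)

/-- The global sections vanish at the zeros of `I`. -/
theorem mem_of_mem_globalSections (hJ : ∀ f ∈ J, ∀ n, homogeneousComponent n f ∈ J)
    (hJ0 : J ≠ ⊥) {I : Ideal (MvPolynomial (Fin 3) K)} {m : ℕ} {f : MvPolynomial (Fin 3) K}
    (hs : toField f ∈ globalSections J I m) {𝔮 : Ideal (MvPolynomial (Fin 3) K)} [𝔮.IsPrime]
    (hI : I ≤ 𝔮) {k : Fin 3} (hk : X k ∉ 𝔮) : f ∈ 𝔮 := by
  obtain ⟨V, hV1, hV2⟩ := exists_valuationSubring 𝔮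
  have := (valuation_le_of_mem_globalSections hJ hJ0 hs V (mem_of_valuation hV1 hV2)
    (hV2 _ hk)).2 fun g hg => hV1 g (hI hg)
  by_contra hf
  exact this.ne (hV2 f hf)

end Valuative

/-! ### Ternary forms -/

section TernaryForms

open MvPolynomial

variable {K : Type*} [Field K]

theorem eq_C_of_isHomogeneous {f : MvPolynomial (Fin 3) K} (hf : f.IsHomogeneous 0) :
    f = C (coeff 0 f) := by
  rw [← homogeneousComponent_zero, homogeneousComponent_eq_self hf]

theorem exists_decomposition {f : MvPolynomial (Fin 3) K} {n : ℕ} (hf : f.IsHomogeneous (n + 1)) :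
    ∃ A B : MvPolynomial (Fin 3) K, ∃ k : K, A.IsHomogeneous n ∧ B.IsHomogeneous n ∧
      f = X 0 * A + X 1 * B + C k * X 2 ^ (n + 1) := by
  have hX : ∀ (i : Fin 3) (d : Fin 3 →₀ ℕ) (a : K), d i ≠ 0 → d.degree = n + 1 →
      ∃ A : MvPolynomial (Fin 3) K, A.IsHomogeneous n ∧ monomial d a = X i * A := by
    intro i d a hd hdeg
    have hle : Finsupp.single i 1 ≤ d := Finsupp.single_le_iff.2 (Nat.one_le_iff_ne_zero.2 hd)
    have hadd := add_tsub_cancel_of_le hle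
    refine ⟨monomial (d - Finsupp.single i 1) a, isHomogeneous_monomial a ?_, ?_⟩
    · have := congrArg Finsupp.degree hadd
      rw [map_add, Finsupp.degree_single, hdeg] at this
      omega
    · rw [X, monomial_mul, hadd, one_mul]
  rw [f.as_sum]
  refine Finset.sum_induction (fun d => monomial d (coeff d f)) (fun g => ∃ A B : MvPolynomial (Fin 3) K,
    ∃ k : K, A.IsHomogeneous n ∧ B.IsHomogeneous n ∧
      g = X 0 * A + X 1 * B + C k * X 2 ^ (n + 1)) ?_ ?_ ?_
  · rintro _ _ ⟨A, B, k, hA, hB, rfl⟩ ⟨A', B', k', hA', hB', rfl⟩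
    refine ⟨A + A', B + B', k + k', hA.add hA', hB.add hB', ?_⟩
    rw [C_add]
    ring
  · exact ⟨0, 0, 0, isHomogeneous_zero _ _ _, isHomogeneous_zero _ _ _, by simp⟩
  · intro d hd
    have hdeg : d.degree = n + 1 := by
      by_contra h
      exact mem_support_iff.1 hd (hf.coeff_eq_zero h)
    by_cases h0 : d 0 ≠ 0
    · obtain ⟨A, hA, h⟩ := hX 0 d (coeff d f) h0 hdeg
      exact ⟨A, 0, 0, hA, isHomogeneous_zero _ _ _, by rw [h]; simp⟩
    by_cases h1 : d 1 ≠ 0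
    · obtain ⟨B, hB, h⟩ := hX 1 d (coeff d f) h1 hdeg
      exact ⟨0, B, 0, isHomogeneous_zero _ _ _, hB, by rw [h]; simp⟩
    rw [not_not] at h0 h1
    have hd2 : d = Finsupp.single 2 (n + 1) := by
      rw [Finsupp.degree_eq_sum, Fin.sum_univ_three, h0, h1] at hdeg
      ext i
      fin_cases i
      · simpa using h0
      · simpa using h1
      · simpa using hdeg
    refine ⟨0, 0, coeff d f, isHomogeneous_zero _ _ _, isHomogeneous_zero _ _ _, ?_⟩
    rw [C_mul_X_pow_eq_monomial, ← hd2]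
    simp

theorem exists_eq_quadratic {f : MvPolynomial (Fin 3) K} (hf : f.IsHomogeneous 2) :
    ∃ a b k : K, ∃ q : Fin 3 → K, f = C k * X 2 ^ 2 + (C a * X 0 + C b * X 1) * X 2 +
      quadForm q (X 0) (X 1) := by
  obtain ⟨A, B, k, hA, hB, rfl⟩ := exists_decomposition hf
  obtain ⟨A', B', k', hA', hB', rfl⟩ := exists_decomposition hA
  obtain ⟨A'', B'', k'', hA'', hB'', rfl⟩ := exists_decomposition hB
  rw [eq_C_of_isHomogeneous hA', eq_C_of_isHomogeneous hB', eq_C_of_isHomogeneous hA'',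
    eq_C_of_isHomogeneous hB'']
  refine ⟨k', k'', k, ![coeff 0 A', coeff 0 B' + coeff 0 A'', coeff 0 B''], ?_⟩
  simp only [quadForm, Matrix.cons_val, algebraMap_eq, C_add]
  ring

/-- A quartic with a double point at `(0 : 0 : 1)` is reduced modulo the pencil `c`. -/
theorem ConicPencil.exists_remainder (c : ConicPencil K) {G₀ G₁ G₂ : MvPolynomial (Fin 3) K}
    (h₀ : G₀.IsHomogeneous 2) (h₁ : G₁.IsHomogeneous 2) (h₂ : G₂.IsHomogeneous 2) :
    ∃ (v : (Fin 3 → K) × (Fin 2 → K) × (Fin 3 → K)) (r₀ r₁ s₀ s₁ : K),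
      X 0 ^ 2 * G₀ + X 0 * X 1 * G₁ + X 1 ^ 2 * G₂ = c.quartic v (X 0) (X 1) (X 2) +
        X 0 ^ 2 * (C r₀ * X 0 + C r₁ * X 1) * X 2 + X 0 ^ 3 * (C s₀ * X 0 + C s₁ * X 1) := by
  obtain ⟨a₀, b₀, k₀, q₀, rfl⟩ := exists_eq_quadratic h₀
  obtain ⟨a₁, b₁, k₁, q₁, rfl⟩ := exists_eq_quadratic h₁
  obtain ⟨a₂, b₂, k₂, q₂, rfl⟩ := exists_eq_quadratic h₂
  -- Division first by Q, eliminating z², then by N, eliminating powers of y from the top: y³, xy²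
  -- in the coefficient of z (quotients c₃, e₀) and y⁴, xy³, x²y² in the constant term (quotients
  -- g₂, g₁, g₀).
  obtain ⟨c₃, hc₃⟩ : ∃ x, x = b₂ - k₂ * c.l₁ := ⟨_, rfl⟩
  obtain ⟨e₀, he₀⟩ : ∃ x, x = b₁ + a₂ - k₁ * c.l₁ - k₂ * c.l₀ + c.t * c₃ := ⟨_, rfl⟩
  obtain ⟨g₂, hg₂⟩ : ∃ x, x = q₂ 2 := ⟨_, rfl⟩
  obtain ⟨g₁, hg₁⟩ : ∃ x, x = q₁ 2 + q₂ 1 - k₂ * c.m₁ + c.t * g₂ := ⟨_, rfl⟩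
  obtain ⟨g₀, hg₀⟩ : ∃ x, x = q₀ 2 + q₁ 1 + q₂ 0 - k₁ * c.m₁ - k₂ * c.m₀ + c.t * g₁ - c.n * g₂ :=
    ⟨_, rfl⟩
  refine ⟨(![k₀, k₁, k₂], ![e₀, c₃], ![g₀, g₁, g₂]), a₀ - k₀ * c.l₀ - c.n * e₀,
    b₀ + a₁ - k₀ * c.l₁ - k₁ * c.l₀ - c.n * c₃ + c.t * e₀, q₀ 0 - k₀ * c.m₀ - c.n * g₀,
    q₀ 1 + q₁ 0 - k₀ * c.m₁ - k₁ * c.m₀ - c.n * g₁ + c.t * g₀, ?_⟩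
  simp only [quartic, conic, normForm, quadForm, linForm, Matrix.cons_val, algebraMap_eq, C_add,
    C_sub, C_mul, hg₀, hg₁, hg₂, he₀, hc₃]
  ring

theorem isHomogeneous_of_mul_eq {a b f : MvPolynomial (Fin 3) K} {n m : ℕ} (hb : b.IsHomogeneous n)
    (hb0 : b ≠ 0) (ha : a.IsHomogeneous (n + m)) (h : b * f = a) : f.IsHomogeneous m := by
  have hcomp : ∀ k, b * homogeneousComponent k f = homogeneousComponent (n + k) a := by
    intro k
    rw [← h]
    conv_rhs => rw [← sum_homogeneousComponent f, Finset.mul_sum, map_sum]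
    have : ∀ i, homogeneousComponent (n + k) (b * homogeneousComponent i f) =
        if k = i then b * homogeneousComponent i f else 0 := by
      intro i
      rw [homogeneousComponent_of_mem (hb.mul (homogeneousComponent_isHomogeneous i f))]
      simp
    simp only [this, Finset.sum_ite_eq, Finset.mem_range]
    split_ifs with hk
    · rfl
    · rw [homogeneousComponent_eq_zero _ _ (by omega), mul_zero]
  rw [← sum_homogeneousComponent f]
  refine IsHomogeneous.sum _ _ _ fun k _ => ?_
  by_cases hk : k = m
  · rw [hk]; exact homogeneousComponent_isHomogeneous m f
  · have h1 := hcomp k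
    rw [homogeneousComponent_of_mem ha, if_neg (by omega)] at h1
    rw [(mul_eq_zero.1 h1).resolve_left hb0]
    exact isHomogeneous_zero _ _ _

end TernaryForms

/-! ### Global sections -/

section GlobalSections

open MvPolynomial

variable {K : Type*} [Field K]

/-- The fractions of degree zero in the coordinates given by `T`. -/
def degreeZero (T : MvPolynomial (Fin 3) K ≃ₐ[K] MvPolynomial (Fin 3) K) :
    Subalgebra K (CoordField K) where
  carrier := {z | ∃ (n : ℕ) (a b : MvPolynomial (Fin 3) K), a.IsHomogeneous n ∧ b.IsHomogeneous n ∧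
    b ≠ 0 ∧ z = coordHom T a / coordHom T b}
  mul_mem' := by
    rintro _ _ ⟨n, a, b, ha, hb, hb0, rfl⟩ ⟨m, a', b', ha', hb', hb0', rfl⟩
    refine ⟨n + m, a * a', b * b', ha.mul ha', hb.mul hb', mul_ne_zero hb0 hb0', ?_⟩
    rw [map_mul, map_mul, div_mul_div_comm]
  add_mem' := by
    rintro _ _ ⟨n, a, b, ha, hb, hb0, rfl⟩ ⟨m, a', b', ha', hb', hb0', rfl⟩
    refine ⟨n + m, a * b' + b * a', b * b', (ha.mul hb').add (hb.mul ha'), hb.mul hb',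
      mul_ne_zero hb0 hb0', ?_⟩
    rw [div_add_div, map_add, map_mul, map_mul, map_mul]
    · rwa [map_ne_zero_iff _ (coordHom_injective T)]
    · rwa [map_ne_zero_iff _ (coordHom_injective T)]
  algebraMap_mem' a := ⟨0, C a, 1, isHomogeneous_C _ a, isHomogeneous_one _ _, one_ne_zero, by
    rw [map_one, div_one, ← algebraMap_eq, AlgHom.commutes]⟩

variable {T : MvPolynomial (Fin 3) K ≃ₐ[K] MvPolynomial (Fin 3) K}

theorem inv_mem_degreeZero {z : CoordField K} (hz : z ∈ degreeZero T) : z⁻¹ ∈ degreeZero T := by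
  obtain ⟨n, a, b, ha, hb, hb0, rfl⟩ := hz
  by_cases h0 : a = 0
  · rw [h0, map_zero, zero_div, inv_zero]
    exact Subalgebra.zero_mem _
  · exact ⟨n, b, a, hb, ha, h0, inv_div _ _⟩

/-- Global sections live in the full field of fractions, where no degree is prescribed; this
inclusion is what forces them to be homogeneous of degree 4. -/
theorem pointAt_le_degreeZero (d : Option K) (z : K) :
    (pointAt T (d, some z)).ring ≤ degreeZero T := by
  refine PointRing.origin_le _ (fun i => ?_) fun w hw _ _ _ => inv_mem_degreeZero hw
  refine ⟨1, localNum (d, some z) i, localDen (d, some z), ?_, xForm_homog d, ?_, rfl⟩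
  · fin_cases i
    · exact yForm_homog d
    · exact (isHomogeneous_X _ _).sub ((xForm_homog d).C_mul z)
  · cases d <;> exact X_ne_zero _

namespace IsCentre

variable {c : ConicPencil K} {IP IR : Ideal (MvPolynomial (Fin 3) K)} (h : IsCentre T c IP IR)

include h

theorem inf_ne_bot : IP ⊓ IR ≠ ⊥ := by
  intro h0
  have h1 := mul_mem_inf h.X_mem_one h.normForm_mem
  rw [h0, Ideal.mem_bot, ← map_zero T, T.injective.eq_iff] at h1
  have h2 := congrArg (aeval ![0, (1 : K), 0]) h1
  rw [map_mul (aeval _), c.map_normForm] at h2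
  simp [ConicPencil.normForm] at h2

theorem div_mem_of_mem_globalSections {s : CoordField K}
    (hs : s ∈ globalSections (IP ⊓ IR) (IP ^ 2 * IR) 4) (p : Option K × Option K) :
    s / (coordHom T (unitForm p) ^ 4 * excEq T p ^ 2) ∈ (pointAt T p).ring := by
  have hG : coordHom T (unitForm p) ^ 4 * excEq T p ^ 2 ≠ 0 :=
    mul_ne_zero (pow_ne_zero _ (coordHom_unitForm_ne_zero _)) (pow_ne_zero _ (excEq_ne_zero _))
  have h1 : s ∈ twistedStalk (IP ^ 2 * IR) 4 (h.rationalPoint p).1 :=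
    (Submodule.mem_iInf _).1 hs (h.rationalPoint p).1
  rw [h.twistedStalk_eq] at h1
  obtain ⟨r, rfl⟩ := Submodule.mem_span_singleton.1 h1
  rw [Algebra.smul_def]
  refine (congrArg (· ∈ (pointAt T p).ring) ?_).mpr r.2
  exact mul_div_cancel_right₀ _ hG

/-- A global section is a quartic with a double point at `(0 : 0 : 1)`. -/
theorem exists_double_point {F : MvPolynomial (Fin 3) K}
    (hs : coordHom T F ∈ globalSections (IP ⊓ IR) (IP ^ 2 * IR) 4) :
    ∃ G₀ G₁ G₂ : MvPolynomial (Fin 3) K, G₀.IsHomogeneous 2 ∧ G₁.IsHomogeneous 2 ∧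
      G₂.IsHomogeneous 2 ∧ F = X 0 ^ 2 * G₀ + X 0 * X 1 * G₁ + X 1 ^ 2 * G₂ := by
  have hF : F.IsHomogeneous 4 := by
    obtain ⟨n, a, b, ha, hb, hb0, hab⟩ := pointAt_le_degreeZero _ _
      (h.div_mem_of_mem_globalSections hs (none, some 0))
    have hu := coordHom_unitForm_ne_zero (T := T) (none, some 0)
    have hbT : coordHom T b ≠ 0 := by rwa [map_ne_zero_iff _ (coordHom_injective T)]
    refine isHomogeneous_of_mul_eq hb hb0 (ha.mul ((unitForm_homog (none, some 0)).pow 4)) ?_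
    apply coordHom_injective T
    simp only [excEq, one_pow, mul_one] at hab
    rw [div_eq_div_iff (pow_ne_zero _ hu) hbT] at hab
    rw [map_mul, map_mul, map_pow, mul_comm, hab]
  have hz := coordHom_X_ne_zero (T := T) 2
  have hρ : ∀ d : Option K, ∃ ρ, (pointAt T (d, none)).HasValue (coordHom T F /
      (coordHom T (X 2) ^ 4 * (coordHom T (xForm d) / coordHom T (X 2)) ^ 2)) ρ := fun d =>
    PointRing.exists_hasValue (h.div_mem_of_mem_globalSections hs (d, none))
  obtain ⟨A, B, k, hA, hB, rfl⟩ := exists_decomposition hF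
  -- Along E the quotient of F by X_2⁴·s², s being the equation of E, is regular. Multiplied by s²
  -- it vanishes on E, which removes the coefficient of X_2⁴.
  have hk : k = 0 := by
    obtain ⟨ρ, hρ⟩ := hρ none
    have hx := coordHom_xForm_ne_zero (T := T) none
    have h1 := hρ.mul ((pointAt_none (T := T) none).pow 2)
    have h2 := PointRing.HasValue.of_isHomogeneous (pointAt_image (T := T) (none, none)) hF
    have h3 : aeval (image ((none, none) : Option K × Option K))
        (X 0 * A + X 1 * B + C k * X 2 ^ (3 + 1)) = k := by
      simp [image]
    rw [h3] at h2
    rw [zero_pow two_ne_zero, mul_zero] at h1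
    refine h2.unique ((congrArg (fun w => PointRing.HasValue _ w 0) ?_).mp h1)
    simp only [unitForm]
    field_simp
  rw [hk, C_0, zero_mul, add_zero] at hF hs hρ ⊢
  -- Multiplied by s only, it vanishes on E too; in each direction this is a linear condition on the
  -- coefficients of X_0·X_2³ and X_1·X_2³, and two directions suffice.
  have hdir : ∀ d : Option K, dirX d * aeval ![0, 0, (1 : K)] A + dirY d * aeval ![0, 0, (1 : K)] B = 0 := by
    intro d
    obtain ⟨ρ, hρ⟩ := hρ d
    have hx := coordHom_xForm_ne_zero (T := T) d
    have h1 := hρ.mul (pointAt_none (T := T) d)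
    have h2 := ((pointAt_dirX (T := T) (d, none)).mul
      (PointRing.HasValue.of_isHomogeneous (pointAt_image (T := T) (d, none)) hA)).add
      ((pointAt_dirY (T := T) (d, none)).mul
      (PointRing.HasValue.of_isHomogeneous (pointAt_image (T := T) (d, none)) hB))
    rw [mul_zero] at h1
    refine h2.unique ((congrArg (fun w => PointRing.HasValue _ w 0) ?_).mp h1)
    simp only [unitForm, map_add, map_mul]
    field_simp
  obtain ⟨A₀, A₁, a, hA₀, hA₁, rfl⟩ := exists_decomposition hA
  obtain ⟨B₀, B₁, b, hB₀, hB₁, rfl⟩ := exists_decomposition hB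
  have ha : a = 0 := by simpa [dirX, dirY] using hdir (some 0)
  have hb : b = 0 := by simpa [dirX, dirY] using hdir none
  refine ⟨A₀, A₁ + B₀, B₁, hA₀, hA₁.add hB₀, hB₁, ?_⟩
  rw [ha, hb, C_0]
  ring

/-- The quartics of the linear system are global sections. -/
theorem quartic_mem_globalSections (v : (Fin 3 → K) × (Fin 2 → K) × (Fin 3 → K)) :
    coordHom T (c.quartic v (X 0) (X 1) (X 2)) ∈ globalSections (IP ⊓ IR) (IP ^ 2 * IR) 4 := by
  set I := IP ^ 2 * IR with hI
  set F : MvPolynomial (Fin 3) K := c.quartic v (X 0) (X 1) (X 2) with hF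
  have hFhom : F.IsHomogeneous 4 :=
    c.isHomogeneous_quartic v (isHomogeneous_X K 0) (isHomogeneous_X K 1) (isHomogeneous_X K 2)
  set x : MvPolynomial (Fin 3) K := T (X 0) with hx
  set y : MvPolynomial (Fin 3) K := T (X 1) with hy
  set z : MvPolynomial (Fin 3) K := T (X 2) with hz
  have hTF : T F = c.quartic v x y z := c.map_quartic T.toAlgHom v _ _ _
  have hN : c.normForm x y ∈ IR := by
    have := h.normForm_mem
    rwa [show T (c.normForm (X 0) (X 1)) = _ from c.map_normForm T.toAlgHom _ _] at this
  have hQ : c.conic x y z ∈ IR := by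
    have := h.conic_mem
    rwa [show T (c.conic (X 0) (X 1) (X 2)) = _ from c.map_conic T.toAlgHom _ _ _] at this
  have hxP : x ∈ IP := h.X_mem_zero
  have hyP : y ∈ IP := h.X_mem_one
  have hlin : ∀ a b : MvPolynomial (Fin 3) K, a * x + b * y ∈ IP := fun a b =>
    IP.add_mem (IP.mul_mem_left _ hxP) (IP.mul_mem_left _ hyP)
  have hmul : ∀ {a b : MvPolynomial (Fin 3) K}, a ∈ IP → b ∈ IP → a * b ∈ IP ^ 2 := fun ha hb => by
    rw [sq]; exact Ideal.mul_mem_mul ha hb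
  have hquad : ∀ a : Fin 3 → K, quadForm a x y ∈ IP ^ 2 := by
    intro a
    have : quadForm a x y = x * (C (a 0) * x + C (a 1) * y) + y * (0 * x + C (a 2) * y) := by
      simp only [quadForm, algebraMap_eq]; ring
    rw [this]
    exact Ideal.add_mem _ (hmul hxP (hlin _ _)) (hmul hyP (hlin _ _))
  have hNP : c.normForm x y ∈ IP ^ 2 := by
    have : c.normForm x y = quadForm ![c.n, - c.t, 1] x y := by
      simp only [ConicPencil.normForm, quadForm, algebraMap_eq, Matrix.cons_val, C_neg, C_1]; ring
    rw [this]; exact hquad _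
  have hlinF : linForm v.2.1 x y ∈ IP := hlin _ _
  have hrest : quadForm v.1 x y * c.conic x y z + c.normForm x y * quadForm v.2.2 x y ∈ I :=
    Ideal.add_mem _ (Ideal.mul_mem_mul (hquad _) hQ) (by
      rw [mul_comm]; exact Ideal.mul_mem_mul (hquad _) hN)
  -- The term bNz need not lie in the product ideal I, but its products with linear forms do, and
  -- that suffices for the stalks. For w in the ideal of P, bw supplies the square of `IP` and N the
  -- factor in `IR`.
  have hlinear : ∀ {w : MvPolynomial (Fin 3) K}, w ∈ IP → T F * w ∈ I := by
    intro w hw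
    have : T F * w = (quadForm v.1 x y * c.conic x y z + c.normForm x y * quadForm v.2.2 x y) * w +
        z * ((linForm v.2.1 x y * w) * c.normForm x y) := by
      rw [hTF, ConicPencil.quartic]; ring
    rw [this]
    exact Ideal.add_mem _ (Ideal.mul_mem_right _ _ hrest)
      (Ideal.mul_mem_left _ _ (Ideal.mul_mem_mul (hmul hlinF hw) hN))
  -- For w = z, substitute z² = Q - (l₀x + l₁y)z - x(m₀x + m₁y) in bNz²: bNQ uses N for `IP ^ 2` and
  -- Q for `IR`, and in the other terms b and a linear form supply `IP ^ 2`.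
  have hlast : T F * z ∈ I := by
    have : T F * z = (quadForm v.1 x y * c.conic x y z + c.normForm x y * quadForm v.2.2 x y) * z +
        (linForm v.2.1 x y * (c.normForm x y * c.conic x y z) -
        z * ((linForm v.2.1 x y * (C c.l₀ * x + C c.l₁ * y)) * c.normForm x y) -
        (x * ((linForm v.2.1 x y * (C c.m₀ * x + C c.m₁ * y)) * c.normForm x y))) := by
      rw [hTF, ConicPencil.quartic]
      simp only [ConicPencil.conic, algebraMap_eq]
      ring
    rw [this]
    exact Ideal.add_mem _ (Ideal.mul_mem_right _ _ hrest) (Ideal.sub_mem _ (Ideal.sub_mem _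
      (Ideal.mul_mem_left _ _ (Ideal.mul_mem_mul hNP hQ))
      (Ideal.mul_mem_left _ _ (Ideal.mul_mem_mul (hmul hlinF (hlin _ _)) hN)))
      (Ideal.mul_mem_left _ _ (Ideal.mul_mem_mul (hmul hlinF (hlin _ _)) hN)))
  have hX : ∀ i, T F * X i ∈ I := by
    intro i
    obtain ⟨A, B, k, -, -, hAB⟩ := exists_decomposition (n := 0) (h.homog_symm i)
    have h1 := congrArg T hAB
    rw [AlgEquiv.apply_symm_apply] at h1
    rw [h1]
    have : T F * T (X 0 * A + X 1 * B + C k * X 2 ^ (0 + 1)) =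
        T F * (T A * x + T B * y) + T (C k) * (T F * z) := by
      simp only [map_add, map_mul, zero_add, pow_one]
      ring
    rw [this]
    exact Ideal.add_mem _ (hlinear (hlin _ _)) (Ideal.mul_mem_left _ _ hlast)
  refine (Submodule.mem_iInf _).2 fun y => ?_
  rw [Submodule.restrictScalars_mem]
  have hcoord : ∃ i, ∀ j, coord j / coord i ∈ y.localRing := by
    obtain ⟨O, i, d, g, -, -, -, 𝔭, h𝔭, rfl⟩ := y
    exact ⟨i, fun j => ⟨⟨_, Algebra.subset_adjoin (Or.inl ⟨j, rfl⟩)⟩, 1,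
      fun h1 => h𝔭.ne_top ((Ideal.eq_top_iff_one 𝔭).2 h1), by simp⟩⟩
  obtain ⟨i, hi⟩ := hcoord
  -- The exponent 1 is essential: F is presented as F·X_i / X_i with a quintic numerator in I.
  refine Submodule.subset_span ⟨i, 1, hi, T F * X i, hX i,
    (h.coordHom_homog hFhom).mul (isHomogeneous_X K i), ?_⟩
  rw [pow_one, toField, map_mul]
  exact (mul_div_cancel_right₀ (coordHom T F) (coord_ne_zero i)).symm

end IsCentre

end GlobalSections

/-! ### The closed points `P` and `R` -/

section ClosedPoints

open MvPolynomial

variable {K Ω : Type*} [Field K] [Field Ω] [Algebra K Ω]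

theorem aeval_eq_zero_of_mem_closedPointIdeal {p : ℙ Ω (Fin 3 → Ω)} {f : MvPolynomial (Fin 3) K}
    (hf : f ∈ closedPointIdeal K p) : aeval p.rep f = 0 := by
  have : closedPointIdeal K p ≤ RingHom.ker (aeval p.rep : MvPolynomial (Fin 3) K →ₐ[K] Ω) :=
    Ideal.span_le.2 fun g hg => hg.2
  exact this hf

theorem homogeneousComponent_mem_closedPointIdeal {p : ℙ Ω (Fin 3 → Ω)}
    {f : MvPolynomial (Fin 3) K} (hf : f ∈ closedPointIdeal K p) (n : ℕ) :
    homogeneousComponent n f ∈ closedPointIdeal K p :=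
  homogeneousComponent_mem_span (fun _ hg => hg.1) hf n

namespace IsNormalized

variable {P R : ℙ Ω (Fin 3 → Ω)} {T : MvPolynomial (Fin 3) K ≃ₐ[K] MvPolynomial (Fin 3) K}
  {c : ConicPencil K} {α β : Ω} (h : IsNormalized P R T c α β)

include h

theorem map_isHomogeneous {f : MvPolynomial (Fin 3) K} {n : ℕ} (hf : f.IsHomogeneous n) :
    (T f).IsHomogeneous n :=
  isHomogeneous_map (φ := T.toAlgHom) h.homog hf

theorem symm_isHomogeneous {f : MvPolynomial (Fin 3) K} {n : ℕ} (hf : f.IsHomogeneous n) :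
    (T.symm f).IsHomogeneous n :=
  isHomogeneous_map (φ := T.symm.toAlgHom) h.homog_symm hf

theorem exists_aeval_R : ∃ u : Ω, u ≠ 0 ∧ ∀ {f : MvPolynomial (Fin 3) K} {n : ℕ},
    f.IsHomogeneous n → aeval R.rep (T f) = u ^ n * aeval ![1, α, β] f := by
  obtain ⟨u, hu, hR⟩ := h.aeval_R
  refine ⟨u, hu, fun {f n} hf => ?_⟩
  have h1 := aeval_div_of_isHomogeneous hf (fun i => aeval R.rep (T (X i))) u
  have h2 : (fun i => aeval R.rep (T (X i)) / u) = ![1, α, β] := by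
    funext i
    rw [hR, mul_div_cancel_left₀ _ hu]
  have h3 := comp_aeval_apply (X : Fin 3 → MvPolynomial (Fin 3) K)
    ((aeval R.rep).comp T.toAlgHom : MvPolynomial (Fin 3) K →ₐ[K] Ω) f
  rw [aeval_X_left_apply] at h3
  change aeval R.rep (T f) = aeval (fun j => aeval R.rep (T (X j))) f at h3
  rw [h2] at h1
  rw [h3, h1, mul_div_cancel₀ _ (pow_ne_zero n hu)]

theorem isCentre : IsCentre T c (closedPointIdeal K P) (closedPointIdeal K R) where
  homog := h.homog
  homog_symm := h.homog_symm
  general := h.general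
  ideal_P := by
    obtain ⟨u, hu, hP⟩ := h.aeval_P
    apply le_antisymm
    · refine Ideal.span_le.2 ?_
      rintro f ⟨⟨n, hn⟩, hf⟩
      have hfT : T (T.symm f) = f := T.apply_symm_apply f
      cases n with
      | zero =>
        rw [eq_C_of_isHomogeneous hn, aeval_C, map_eq_zero] at hf
        rw [eq_C_of_isHomogeneous hn, hf, C_0]
        exact Ideal.zero_mem _
      | succ n =>
        obtain ⟨A, B, k, -, -, hAB⟩ := exists_decomposition (h.symm_isHomogeneous hn)
        rw [hAB] at hfT
        simp only [map_add, map_mul, map_pow] at hfT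
        have hk : k = 0 := by
          rw [← hfT] at hf
          simp only [map_add (aeval P.rep), map_mul (aeval P.rep), map_pow (aeval P.rep), hP] at hf
          rw [← algebraMap_eq, AlgEquiv.commutes, algebraMap_eq, aeval_C] at hf
          simpa [hu] using hf
        rw [← hfT, hk, C_0, map_zero, zero_mul, add_zero]
        exact Ideal.add_mem _ (Ideal.mul_mem_right _ _ (Ideal.subset_span (Set.mem_insert _ _)))
          (Ideal.mul_mem_right _ _ (Ideal.subset_span (Set.mem_insert_of_mem _ rfl)))
    · refine Ideal.span_le.2 ?_
      rintro f (rfl | hf)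
      · exact Ideal.subset_span ⟨⟨1, h.homog 0⟩, by simp [hP]⟩
      · rw [Set.mem_singleton_iff.1 hf]
        exact Ideal.subset_span ⟨⟨1, h.homog 1⟩, by simp [hP]⟩
  normForm_mem := by
    obtain ⟨u, -, hR⟩ := h.exists_aeval_R
    have hhom := c.isHomogeneous_normForm (isHomogeneous_X K (0 : Fin 3)) (isHomogeneous_X K 1)
    refine Ideal.subset_span ⟨⟨2, h.map_isHomogeneous hhom⟩, ?_⟩
    rw [hR hhom, c.map_normForm (aeval _), aeval_X, aeval_X]
    exact mul_eq_zero_of_right _ h.normForm_eq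
  conic_mem := by
    obtain ⟨u, -, hR⟩ := h.exists_aeval_R
    have hhom := c.isHomogeneous_conic (isHomogeneous_X K (0 : Fin 3)) (isHomogeneous_X K 1)
      (isHomogeneous_X K 2)
    refine Ideal.subset_span ⟨⟨2, h.map_isHomogeneous hhom⟩, ?_⟩
    rw [hR hhom, c.map_conic (aeval _), aeval_X, aeval_X, aeval_X]
    exact mul_eq_zero_of_right _ h.conic_eq

theorem mem_globalSections_iff {s : CoordField K} :
    s ∈ globalSections (centreY K P R) (idealF K P R) 4 ↔
      ∃ v, s = coordHom T (c.quartic v (X 0) (X 1) (X 2)) := by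
  constructor
  swap
  · rintro ⟨v, rfl⟩
    exact h.isCentre.quartic_mem_globalSections v
  intro hs
  have hJ : ∀ f ∈ centreY K P R, ∀ n, homogeneousComponent n f ∈ centreY K P R := fun f hf n =>
    ⟨homogeneousComponent_mem_closedPointIdeal hf.1 n,
      homogeneousComponent_mem_closedPointIdeal hf.2 n⟩
  obtain ⟨f, rfl⟩ := exists_polynomial_of_mem_globalSections hJ h.isCentre.inf_ne_bot hs
  -- The prime ideal used is the kernel of evaluation at the coordinates of R; it contains `idealF`
  -- and misses a coordinate that is nonzero at R.
  have hvan : aeval R.rep f = 0 := by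
    have hprime : (RingHom.ker (aeval R.rep : MvPolynomial (Fin 3) K →ₐ[K] Ω)).IsPrime :=
      RingHom.ker_isPrime _
    obtain ⟨k, hk⟩ := Function.ne_iff.1 R.rep_nonzero
    refine mem_of_mem_globalSections (k := k) hJ h.isCentre.inf_ne_bot hs
      (𝔮 := RingHom.ker (aeval R.rep : MvPolynomial (Fin 3) K →ₐ[K] Ω)) ?_ ?_
    · exact Ideal.mul_le_right.trans fun g hg => aeval_eq_zero_of_mem_closedPointIdeal hg
    · rw [RingHom.mem_ker, aeval_X]
      exact hk
  have hfT : coordHom T (T.symm f) = toField f := by rw [coordHom_apply, AlgEquiv.apply_symm_apply]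
  rw [← hfT] at hs ⊢
  obtain ⟨G₀, G₁, G₂, h₀, h₁, h₂, hF⟩ := h.isCentre.exists_double_point hs
  obtain ⟨v, r₀, r₁, s₀, s₁, hv⟩ := c.exists_remainder h₀ h₁ h₂
  have hhom : (T.symm f).IsHomogeneous 4 := by
    rw [hF]
    exact ((((isHomogeneous_X K 0).pow 2).mul h₀).add
      (((isHomogeneous_X K 0).mul (isHomogeneous_X K 1)).mul h₁)).add
      (((isHomogeneous_X K 1).pow 2).mul h₂)
  obtain ⟨u, hu, hR⟩ := h.exists_aeval_R
  have hz := hR hhom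
  rw [AlgEquiv.apply_symm_apply, hvan, hF, hv] at hz
  replace hz := (mul_eq_zero.1 hz.symm).resolve_left (pow_ne_zero 4 hu)
  rw [map_add (aeval _), map_add (aeval _), c.map_quartic (aeval _)] at hz
  simp only [map_add (aeval _), map_mul (aeval _), map_pow (aeval _), aeval_X, aeval_C,
    ConicPencil.quartic, Matrix.cons_val, h.normForm_eq, h.conic_eq] at hz
  -- At (1, α, β) the pencil vanishes and the remainder becomes s₀ + s₁α + (r₀ + r₁α)β.
  obtain ⟨rfl, rfl, rfl, rfl⟩ := h.indep s₀ s₁ r₀ r₁ (by linear_combination hz)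
  refine ⟨v, ?_⟩
  rw [hF, hv]
  simp

end IsNormalized

end ClosedPoints

/-! ### Parameters of the code -/

section Parameters

open MvPolynomial

variable {K : Type*} [Field K]

theorem ConicPencil.quartic_add (c : ConicPencil K) {S : Type*} [CommRing S] [Algebra K S]
    (v w : (Fin 3 → K) × (Fin 2 → K) × (Fin 3 → K)) (x y z : S) :
    c.quartic (v + w) x y z = c.quartic v x y z + c.quartic w x y z := by
  simp only [quartic, quadForm, linForm, Prod.fst_add, Prod.snd_add, Pi.add_apply, map_add]
  ring

theorem ConicPencil.quartic_smul (c : ConicPencil K) {S : Type*} [CommRing S] [Algebra K S]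
    (a : K) (v : (Fin 3 → K) × (Fin 2 → K) × (Fin 3 → K)) (x y z : S) :
    c.quartic (a • v) x y z = a • c.quartic v x y z := by
  simp only [quartic, quadForm, linForm, Prod.smul_fst, Prod.smul_snd, Pi.smul_apply, smul_eq_mul,
    map_mul]
  rw [Algebra.smul_def]
  ring

variable {T : MvPolynomial (Fin 3) K ≃ₐ[K] MvPolynomial (Fin 3) K} {c : ConicPencil K}
  {IP IR : Ideal (MvPolynomial (Fin 3) K)}

namespace IsCentre

variable (h : IsCentre T c IP IR)

/-- The quartics of the linear system as global sections. -/
def quarticHom : (Fin 3 → K) × (Fin 2 → K) × (Fin 3 → K) →ₗ[K]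
    globalSections (IP ⊓ IR) (IP ^ 2 * IR) 4 where
  toFun v := ⟨coordHom T (c.quartic v (X 0) (X 1) (X 2)), h.quartic_mem_globalSections v⟩
  map_add' v w := Subtype.ext <|
    (congrArg (coordHom T) (c.quartic_add v w _ _ _)).trans (map_add (coordHom T) _ _)
  map_smul' a v := Subtype.ext <|
    (congrArg (coordHom T) (c.quartic_smul a v _ _ _)).trans (map_smul (coordHom T) a _)

include h

theorem evalAt_quarticHom_eq_zero_iff (p : Option K × Option K)
    (v : (Fin 3 → K) × (Fin 2 → K) × (Fin 3 → K)) :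
    evalAt (IP ^ 2 * IR) 4 (h.rationalPoint p).1 (h.quarticHom v) = 0 ↔ c.value v p = 0 := by
  obtain ⟨e, he⟩ := h.exists_fibre_equiv p
  rw [(quartic_hasValue p v).unique (he (h.quarticHom v))]
  exact (EmbeddingLike.map_eq_zero_iff (f := e)).symm

theorem nonempty_fibre_equiv (y : RationalPoint (IP ⊓ IR)) :
    Nonempty (Fibre (IP ^ 2 * IR) 4 y.1 ≃ₗ[K] K) := by
  obtain ⟨p, rfl⟩ := h.indexEquiv.surjective y
  obtain ⟨e, -⟩ := h.exists_fibre_equiv p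
  exact ⟨e⟩

theorem hasParameters [Finite K] (hq : 3 ≤ Nat.card K)
    (hsurj : ∀ s ∈ globalSections (IP ⊓ IR) (IP ^ 2 * IR) 4,
      ∃ v, s = coordHom T (c.quartic v (X 0) (X 1) (X 2)))
    (e : ∀ y : RationalPoint (IP ⊓ IR), Fibre (IP ^ 2 * IR) 4 y.1 ≃ₗ[K] K) :
    HasParameters (evaluationCode (IP ^ 2 * IR) 4 e) ((Nat.card K + 1) ^ 2) 8
      (Nat.card K ^ 2 - Nat.card K - 2) := by
  classical
  let _ := Fintype.ofFinite K
  rw [Nat.card_eq_fintype_card] at hq ⊢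
  set q := Fintype.card K with hqdef
  have hcard : Fintype.card (Option K × Option K) = (q + 1) ^ 2 := by
    rw [Fintype.card_prod, Fintype.card_option, sq]
  let ev := LinearMap.pi fun y : RationalPoint (IP ⊓ IR) =>
    (e y).toLinearMap.comp (evalAt (IP ^ 2 * IR) 4 y.1)
  let W := ev.comp h.quarticHom
  have hrange : evaluationCode (IP ^ 2 * IR) 4 e = LinearMap.range W := by
    refine (LinearMap.range_comp_of_range_eq_top ev (LinearMap.range_eq_top.2 ?_)).symm
    rintro ⟨s, hs⟩
    obtain ⟨v, rfl⟩ := hsurj s hs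
    exact ⟨v, rfl⟩
  have hW : ∀ v p, W v (h.indexEquiv p) = 0 ↔ c.value v p = 0 := fun v p => by
    rw [← h.evalAt_quarticHom_eq_zero_iff p v]
    exact EmbeddingLike.map_eq_zero_iff (f := e (h.rationalPoint p))
  have hweight : ∀ v, Set.ncard {y | W v y ≠ 0} +
      (Finset.univ.filter fun p => c.value v p = 0).card = (q + 1) ^ 2 := by
    intro v
    have h1 : {y | W v y ≠ 0} =
        h.indexEquiv '' (Finset.univ.filter fun p => ¬ c.value v p = 0 : Finset _) := by
      ext y
      obtain ⟨p, rfl⟩ := h.indexEquiv.surjective y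
      simp [hW]
    rw [h1, Set.ncard_image_of_injective _ h.indexEquiv.injective, Set.ncard_coe_finset, add_comm,
      Finset.card_filter_add_card_filter_not, Finset.card_univ, hcard]
  -- A nonzero v in the kernel would have (q + 1)² zeros, more than 3(q + 1) when q ≥ 3.
  have hinj : Function.Injective W := by
    rw [injective_iff_map_eq_zero]
    intro v hv
    by_contra hv0
    have h1 := ConicPencil.card_zeros_value_le h.general hq hv0
    have h2 := hweight v
    rw [hv] at h2
    simp only [Pi.zero_apply, ne_eq, not_true_eq_false, Set.ofPred_false, Set.ncard_empty] at h2
    nlinarith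
  rw [hrange]
  refine ⟨Finite.of_equiv _ h.indexEquiv, ?_, ?_, ?_, ?_⟩
  · rw [← Nat.card_congr h.indexEquiv, Nat.card_eq_fintype_card, hcard]
  · rw [LinearMap.finrank_range_of_inj hinj]
    simp
  · obtain ⟨v, hv0, hv⟩ := ConicPencil.exists_card_zeros_value_eq h.general hq
    refine ⟨W v, ⟨v, rfl⟩, fun h0 => hv0 (hinj (h0.trans (map_zero W).symm)), ?_⟩
    have := hweight v
    rw [hv] at this
    have h2 : (q + 1) ^ 2 = q ^ 2 + 2 * q + 1 := by ring
    omega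
  · rintro _ ⟨_, ⟨v, rfl⟩, hv0, rfl⟩
    have h1 := ConicPencil.card_zeros_value_le h.general hq
      (v := v) (fun h0 => hv0 (by rw [h0, map_zero]))
    have := hweight v
    have h2 : (q + 1) ^ 2 = q ^ 2 + 2 * q + 1 := by ring
    omega

end IsCentre

end Parameters

end RationalSurfaceCode

end

open RationalSurfaceCode in
theorem mainTheorem6 {K Ω : Type*} [Field K] [Finite K] [Field Ω] [Algebra K Ω]
    [IsAlgClosure K Ω] (hq : 3 ≤ Nat.card K)
    (P R l : ℙ Ω (Fin 3 → Ω))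
    (hP : closedPointDegree K Ω P = 1)
    (hl : Function.minimalPeriod (frob K Ω) l = 2)
    (hPl : Projectivization.orthogonal l P ∧ Projectivization.orthogonal (frob K Ω l) P)
    (hR : closedPointDegree K Ω R = 4)
    (hRl : Projectivization.orthogonal l R ∨ Projectivization.orthogonal (frob K Ω l) R) :
    (∀ y : RationalPointY K P R, Nonempty (FibreF K P R 4 y ≃ₗ[K] K)) ∧
    ∀ e : ∀ y : RationalPointY K P R, FibreF K P R 4 y ≃ₗ[K] K,
      HasParameters (codeYF K P R 4 e) ((Nat.card K + 1) ^ 2) 8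
        (Nat.card K ^ 2 - Nat.card K - 2) := by
  obtain ⟨T, c, α, β, h⟩ := exists_isNormalized P R l hP hl hPl hR hRl
  exact ⟨h.isCentre.nonempty_fibre_equiv,
    h.isCentre.hasParameters hq fun s hs => h.mem_globalSections_iff.1 hs⟩
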